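/- Let $(\Omega,\mathcal F,(\mathcal F_t)_{t\in\mathbb N},P)$ be a filtered probability space and let $\tau,\theta$ be $(\mathcal F_t)$-stopping times with values in $\mathbb N\cup\{\infty\}$ such that $\tau<\infty$ and $\tau\le\theta$ almost surely. Equalities and inequalities between random variables or processes are understood almost surely, and processes are identified when they agree almost surely at all times. *Spaces.* Let $\mathcal R^\infty$ be the set of adapted processes $X=(X_t)_{t\in\mathbb N}$ with $\sup_t|X_t|\le m$ for some $m\in\mathbb R$. For an adapted process $a$ put $a_{-1}=0$ and $\Delta a_t=a_t-a_{t-1}$. Let $\mathcal A^1$ be the set of adapted $a$ with $E[\sum_t|\Delta a_t|]<\infty$, and $\mathcal A^1_+=\{a\in\mathcal A^1:\Delta a_t\ge 0\text{ for all }t\}$. Put $\langle X,a\rangle=E[\sum_t X_t\Delta a_t]$ and $\langle X,a\rangle_{\tau,\theta}=E[\sum_{t\in[\tau,\theta]\cap\mathbb N}X_t\Delta a_t\mid\mathcal F_\tau]$. Let $\sigma(\mathcal R^\infty,\mathcal A^1)$ be the coarsest topology on $\mathcal R^\infty$ making all maps $\langle\cdot,a\rangle$, $a\in\mathcal A^1$,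 continuous, and $\sigma(\mathcal A^1,\mathcal R^\infty)$ the coarsest topology on $\mathcal A^1$ making all maps $\langle X,\cdot\rangle$, $X\in\mathcal R^\infty$, continuous. Put $\pi_{\tau,\theta}(X)_t=1_{\{\tau\le t\}}X_{t\wedge\theta}$, $\mathcal R^\infty_{\tau,\theta}=\pi_{\tau,\theta}\mathcal R^\infty$ and $\mathcal D_{\tau,\theta}=\{a\in\pi_{\tau,\theta}\mathcal A^1_+:\langle 1,a\rangle_{\tau,\theta}=1\}$. A set $K$ of processes is $\mathcal F_\tau$-convex if $\lambda a+(1-\lambda)b\in K$ for all $a,b\in K$ and all $\lambda\in L^\infty(\mathcal F_\tau)$ with $0\le\lambda\le1$. *Functionals.* A map $\phi:\mathcal R^\infty_{\tau,\theta}\to L^\infty(\mathcal F_\tau)$ is a coherent utility functional if for all $X,Y\in\mathcal R^\infty_{\tau,\theta}$: (0) $\phi(1_AX)=1_A\phi(X)$ for all $A\in\mathcal F_\tau$; (1) $X\le Y$ implies $\phi(X)\le\phi(Y)$; (2) $\phi(X+m1_{[\tau,\infty)})=\phi(X)+m$ for all $m\in L^\infty(\mathcal F_\tau)$; (3) $\phi(\lambda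 X+(1-\lambda)Y)\ge\lambda\phi(X)+(1-\lambda)\phi(Y)$ for all $\lambda\in L^\infty(\mathcal F_\tau)$ with $0\le\lambda\le 1$; (4) $\phi(\lambda X)=\lambda\phi(X)$ for all $\lambda\in L^\infty(\mathcal F_\tau)$ with $\lambda\ge0$. Its acceptance set is $\mathcal C_\phi=\{X\in\mathcal R^\infty_{\tau,\theta}:\phi(X)\ge0\}$, and $\phi^\#(a)=\operatorname{ess\,inf}_{X\in\mathcal C_\phi}\langle X,a\rangle_{\tau,\theta}$, with values in $[-\infty,\infty]$. It is continuous for bounded decreasing sequences if $\phi(X^n)\to\phi(X)$ almost surely for every decreasing sequence $(X^n)$ in $\mathcal R^\infty_{\tau,\theta}$ and every $X\in\mathcal R^\infty_{\tau,\theta}$ such that $X^n_t\to X_t$ almost surely for all $t\in\mathbb N$. **Corollary.** For a map $\phi$ from $\mathcal R^\infty_{\tau,\theta}$ to the real-valued random variables the following are equivalent: 1. There is a non-empty $\mathcal Q\subset\mathcal D_{\tau,\theta}$ such that $\phi(X)=\operatorname{ess\,inf}_{a\in\mathcal Q}\langle X,a\rangle_{\tau,\theta}$ for all $X\in\mathcal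 R^\infty_{\tau,\theta}$. 2. $\phi$ is a coherent utility functional on $\mathcal R^\infty_{\tau,\theta}$ whose acceptance set $\mathcal C_\phi$ is $\sigma(\mathcal R^\infty,\mathcal A^1)$-closed. 3. $\phi$ is a coherent utility functional on $\mathcal R^\infty_{\tau,\theta}$ that is continuous for bounded decreasing sequences. Moreover, if these hold, then for every $\mathcal Q$ as in 1, the set $\mathcal Q^0_\phi=\{a\in\mathcal D_{\tau,\theta}:\phi^\#(a)=0\}$ is the smallest $\sigma(\mathcal A^1,\mathcal R^\infty)$-closed, $\mathcal F_\tau$-convex subset of $\mathcal D_{\tau,\theta}$ that contains $\mathcal Q$, and $\phi(X)=\operatorname{ess\,inf}_{a\in\mathcal Q^0_\phi}\langle X,a\rangle_{\tau,\theta}$ for all $X\in\mathcal R^\infty_{\tau,\theta}$. -/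

import Mathlib

open MeasureTheory Filter Topology
open scoped ENNReal

namespace CondUtil

/-! ### Essential infima of families of extended real random variables -/

section EssInf

variable {Ω : Type*} {mΩ : MeasurableSpace Ω}

/-- An order-reversing bounded reparametrisation of the extended real line. -/
noncomputable def squash (x : EReal) : ℝ≥0∞ := (1 + EReal.exp x)⁻¹

lemma squash_le_one (x : EReal) : squash x ≤ 1 := by
  unfold squash
  rw [ENNReal.inv_le_one]
  exact le_self_add

lemma squash_le_squash {x y : EReal} : squash x ≤ squash y ↔ y ≤ x := by
  unfold squash
  rw [ENNReal.inv_le_inv, ENNReal.add_le_add_iff_left ENNReal.one_ne_top, EReal.exp_le_exp_iff]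

lemma measurable_squash : Measurable squash :=
  (measurable_const.add EReal.measurable_exp).inv

/-- Every family of (classes of) `[-∞, ∞]`-valued random variables on a finite measure space has
a greatest lower bound with respect to the almost sure order. -/
theorem exists_isGLB (P : Measure Ω) [IsFiniteMeasure P] (S : Set (Ω →ₘ[P] EReal)) :
    ∃ g, IsGLB S g := by
  classical
  let inff : (ℕ → Ω →ₘ[P] EReal) → Ω → EReal := fun u ω => ⨅ n, u n ω
  have hm : ∀ u, Measurable (inff u) := fun u => Measurable.iInf fun n => (u n).measurable
  rcases S.eq_empty_or_nonempty with rfl | ⟨s0, hs0⟩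
  · refine ⟨AEEqFun.mk (fun _ => ⊤) aestronglyMeasurable_const, by simp [lowerBounds], ?_⟩
    intro f _
    rw [← AEEqFun.coeFn_le]
    filter_upwards [AEEqFun.coeFn_mk (μ := P) (fun _ : Ω => (⊤ : EReal))
      aestronglyMeasurable_const] with ω h
    rw [h]
    exact le_top
  let I : (ℕ → Ω →ₘ[P] EReal) → ℝ≥0∞ := fun u => ∫⁻ ω, squash (inff u ω) ∂P
  let T : Set (ℕ → Ω →ₘ[P] EReal) := {u | ∀ n, u n ∈ S}
  have hT : T.Nonempty := ⟨fun _ => s0, fun _ => hs0⟩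
  have hImono : ∀ u v, (∀ ω, inff v ω ≤ inff u ω) → I u ≤ I v := fun u v h =>
    lintegral_mono fun ω => squash_le_squash.2 (h ω)
  have hIfin : ∀ u, I u ≠ ⊤ := fun u => by
    refine ne_top_of_le_ne_top (measure_ne_top P Set.univ) ?_
    calc I u ≤ ∫⁻ _, 1 ∂P := lintegral_mono fun ω => squash_le_one _
      _ = P Set.univ := by simp
  obtain ⟨c, -, hc, hcT⟩ := exists_seq_tendsto_sSup (hT.image I) (OrderTop.bddAbove _)
  choose w hwT hw using hcT
  let v : ℕ → Ω →ₘ[P] EReal := fun n => w n.unpair.1 n.unpair.2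
  have hvT : v ∈ T := fun n => hwT _ _
  have hvw : ∀ k, I (w k) ≤ I v := fun k => hImono _ _ fun ω =>
    le_iInf fun n => (iInf_le (fun n => v n ω) (Nat.pair k n)).trans_eq (by simp [v])
  have hvmax : ∀ u ∈ T, I u ≤ I v := fun u hu =>
    (le_sSup (Set.mem_image_of_mem I hu)).trans
      (le_of_tendsto' hc fun k => (hw k) ▸ hvw k)
  refine ⟨AEEqFun.mk (inff v) (hm v).aestronglyMeasurable, ?_, ?_⟩
  · intro f hf
    rw [← AEEqFun.coeFn_le]
    let u : ℕ → Ω →ₘ[P] EReal := fun n => Nat.casesOn n f v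
    have huT : u ∈ T := fun n => by cases n <;> simp [u, hf, hvT _]
    have huv : ∀ ω, inff u ω ≤ inff v ω := fun ω =>
      le_iInf fun n => iInf_le (fun n => u n ω) (n + 1)
    have hae : (fun ω => squash (inff v ω)) =ᵐ[P] fun ω => squash (inff u ω) :=
      ae_eq_of_ae_le_of_lintegral_le (Eventually.of_forall fun ω => squash_le_squash.2 (huv ω))
        (hIfin v) (measurable_squash.comp (hm u)).aemeasurable (hvmax u huT)
    filter_upwards [hae, AEEqFun.coeFn_mk (inff v) (hm v).aestronglyMeasurable] with ω h1 h2
    rw [h2]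
    exact (squash_le_squash.1 h1.ge).trans (iInf_le (fun n => u n ω) 0)
  · intro f hf
    rw [← AEEqFun.coeFn_le]
    have h : ∀ᵐ ω ∂P, ∀ n, f ω ≤ v n ω :=
      ae_all_iff.2 fun n => AEEqFun.coeFn_le.2 (hf (hvT n))
    filter_upwards [h, AEEqFun.coeFn_mk (inff v) (hm v).aestronglyMeasurable] with ω h1 h2
    rw [h2]
    exact le_iInf h1

/-- The essential infimum of a family of `[-∞, ∞]`-valued random variables: its greatest lower
bound in the almost sure order. -/
noncomputable def essInfFam {P : Measure Ω} [IsFiniteMeasure P] (S : Set (Ω →ₘ[P] EReal)) :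
    Ω →ₘ[P] EReal :=
  (exists_isGLB P S).choose

theorem isGLB_essInfFam {P : Measure Ω} [IsFiniteMeasure P] (S : Set (Ω →ₘ[P] EReal)) :
    IsGLB S (essInfFam S) :=
  (exists_isGLB P S).choose_spec

/-- A real random variable, seen as an extended real one. -/
noncomputable def toE {P : Measure Ω} (f : Ω →ₘ[P] ℝ) : Ω →ₘ[P] EReal :=
  AEEqFun.comp (fun x : ℝ => (x : EReal)) continuous_coe_real_ereal f

end EssInf

/-! ### Spaces of adapted processes and their duality

A process is a sequence of almost sure equivalence classes of random variables, so that two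
processes are equal exactly when they coincide almost surely at all times; sums, scalars and the
order `≤` are the pointwise ones. -/

section Processes

variable {Ω : Type*} {mΩ : MeasurableSpace Ω}

/-- Discrete-time real processes, identified when almost surely equal at all times. -/
abbrev Process0 (P : Measure Ω) : Type _ := ℕ → Ω →ₘ[P] ℝ

variable (P : Measure Ω) (ℱ : Filtration ℕ mΩ)

/-- `R⁰`: the adapted processes. -/
def R0 : Set (Process0 P) := {X | ∀ t, AEStronglyMeasurable[ℱ t] (X t) P}

/-- `R^∞`: the bounded adapted processes. -/
def RInf : Set (Process0 P) :=
  {X | X ∈ R0 P ℱ ∧ ∃ m : ℝ, ∀ᵐ ω ∂P, ∀ t, |X t ω| ≤ m}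

variable {P}

/-- `Δa_t = a_t - a_{t-1}`, with `a_{-1} = 0`. -/
noncomputable def incr (a : Process0 P) : Process0 P
  | 0 => a 0
  | t + 1 => a (t + 1) - a t

variable (P)

/-- `A¹`: the adapted processes of integrable variation. -/
def A1 : Set (Process0 P) :=
  {a | a ∈ R0 P ℱ ∧ ∫⁻ ω, ∑' t, ‖incr a t ω‖ₑ ∂P < ∞}

/-- `A¹₊`: the elements of `A¹` with non-negative increments. -/
def A1Pos : Set (Process0 P) := {a | a ∈ A1 P ℱ ∧ ∀ t, 0 ≤ incr a t}

variable {P}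

/-- `⟨X, a⟩ = E[∑ₜ Xₜ Δaₜ]`. -/
noncomputable def pairing (X a : Process0 P) : ℝ := ∫ ω, ∑' t, X t ω * incr a t ω ∂P

variable (P)

/-- `σ(R^∞, A¹)`: the coarsest topology on `R^∞` that makes all `⟨·, a⟩`, `a ∈ A¹`, continuous. -/
@[reducible] noncomputable def sigmaRA : TopologicalSpace (RInf P ℱ) :=
  ⨅ a : A1 P ℱ, TopologicalSpace.induced (fun X : RInf P ℱ => pairing X.1 a.1) inferInstance

/-- `σ(A¹, R^∞)`: the coarsest topology on `A¹` that makes all `⟨X, ·⟩`, `X ∈ R^∞`, continuous. -/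
@[reducible] noncomputable def sigmaAR : TopologicalSpace (A1 P ℱ) :=
  ⨅ X : RInf P ℱ, TopologicalSpace.induced (fun a : A1 P ℱ => pairing X.1 a.1) inferInstance

end Processes

/-! ### Projection onto `[τ, θ]` and the conditional pairing -/

section Stopping

variable {Ω : Type*} {mΩ : MeasurableSpace Ω} {P : Measure Ω} {ℱ : Filtration ℕ mΩ}
  {τ θ : Ω → WithTop ℕ}

lemma measurableSet_le_time (hτ : IsStoppingTime ℱ τ) (t : ℕ) :
    MeasurableSet {ω | τ ω ≤ (t : WithTop ℕ)} :=
  ℱ.le t _ (hτ t)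

lemma measurable_stoppingTime (hτ : IsStoppingTime ℱ τ) : Measurable τ := by
  have := hτ.measurable
  exact this.mono hτ.measurableSpace_le le_rfl

lemma measurable_stopped {X : ℕ → Ω → ℝ} (hX : ∀ t, Measurable (X t))
    (hθ : IsStoppingTime ℱ θ) (t : ℕ) : Measurable (stoppedProcess X θ t) := by
  have h2 : Measurable fun ω => (min (t : WithTop ℕ) (θ ω)).untopA :=
    (measurable_of_countable (fun x : WithTop ℕ => (min (t : WithTop ℕ) x).untopA)).comp
      (measurable_stoppingTime hθ)
  exact (measurable_from_prod_countable_right (f := fun p : ℕ × Ω => X p.1 p.2) hX).comp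
    (h2.prodMk measurable_id)

/-- `π_{τ,θ}(X)_t = 1_{τ ≤ t} X_{t ∧ θ}`. -/
noncomputable def proj (hτ : IsStoppingTime ℱ τ) (hθ : IsStoppingTime ℱ θ) (X : Process0 P) :
    Process0 P := fun t =>
  AEEqFun.mk ({ω | τ ω ≤ (t : WithTop ℕ)}.indicator (stoppedProcess (fun s ω => X s ω) θ t))
    ((measurable_stopped (fun s => (X s).measurable) hθ t).indicator
      (measurableSet_le_time hτ t)).aestronglyMeasurable

/-- `⟨X, a⟩_{τ,θ} = E[∑_{t ∈ [τ, θ] ∩ ℕ} Xₜ Δaₜ | F_τ]`. -/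
noncomputable def condPairing (hτ : IsStoppingTime ℱ τ) (θ : Ω → WithTop ℕ) (X a : Process0 P) :
    Ω →ₘ[P] ℝ :=
  AEEqFun.mk
    (P[fun ω => ∑' t : ℕ, {t : ℕ | τ ω ≤ (t : WithTop ℕ) ∧ (t : WithTop ℕ) ≤ θ ω}.indicator
        (fun t => X t ω * incr a t ω) t | hτ.measurableSpace])
    (stronglyMeasurable_condExp.mono hτ.measurableSpace_le).aestronglyMeasurable

variable (P) in
/-- `R^∞_{τ,θ} = π_{τ,θ} R^∞`. -/
def RInfST (hτ : IsStoppingTime ℱ τ) (hθ : IsStoppingTime ℱ θ) : Set (Process0 P) :=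
  proj hτ hθ '' RInf P ℱ

variable (P) in
/-- `D_{τ,θ}`: the elements `a` of `π_{τ,θ} A¹₊` with `⟨1, a⟩_{τ,θ} = 1`. -/
def DST (hτ : IsStoppingTime ℱ τ) (hθ : IsStoppingTime ℱ θ) : Set (Process0 P) :=
  {a | a ∈ proj hτ hθ '' A1Pos P ℱ ∧ condPairing hτ θ 1 a = 1}

variable (P) in
/-- `L^∞(F_τ)`. -/
def LInfTau (hτ : IsStoppingTime ℱ τ) : Set (Ω →ₘ[P] ℝ) :=
  {f | AEStronglyMeasurable[hτ.measurableSpace] f P ∧ ∃ c : ℝ, ∀ᵐ ω ∂P, |f ω| ≤ c}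

/-- The random variable `1_A`, for an event `A ∈ F_τ`. -/
noncomputable def ind (hτ : IsStoppingTime ℱ τ) {A : Set Ω}
    (hA : MeasurableSet[hτ.measurableSpace] A) : Ω →ₘ[P] ℝ :=
  AEEqFun.mk (A.indicator 1)
    (measurable_one.indicator (hτ.measurableSpace_le A hA)).aestronglyMeasurable

variable (P) in
/-- The process `1_{[τ,∞)}`. -/
noncomputable def indFrom (hτ : IsStoppingTime ℱ τ) : Process0 P := fun t =>
  AEEqFun.mk ({ω | τ ω ≤ (t : WithTop ℕ)}.indicator 1)
    (measurable_one.indicator (measurableSet_le_time hτ t)).aestronglyMeasurable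

/-- The process `f X`, for a random variable `f` and a process `X`. -/
noncomputable def scale (f : Ω →ₘ[P] ℝ) (X : Process0 P) : Process0 P := fun t => f * X t

/-! ### Conditional utility functionals

A functional on `R^∞_{τ,θ}` is given by a function on all processes of which only the values on
`R^∞_{τ,θ}` matter. -/

/-- Monetary utility functionals on `R^∞_{τ,θ}`. -/
structure IsMonetary (hτ : IsStoppingTime ℱ τ) (hθ : IsStoppingTime ℱ θ)
    (φ : Process0 P → Ω →ₘ[P] ℝ) : Prop where
  mapsTo : ∀ X ∈ RInfST P hτ hθ, φ X ∈ LInfTau P hτ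
  localProp : ∀ X ∈ RInfST P hτ hθ, ∀ (A : Set Ω) (hA : MeasurableSet[hτ.measurableSpace] A),
    φ (scale (ind hτ hA) X) = ind hτ hA * φ X
  monotone : ∀ X ∈ RInfST P hτ hθ, ∀ Y ∈ RInfST P hτ hθ, X ≤ Y → φ X ≤ φ Y
  cash : ∀ X ∈ RInfST P hτ hθ, ∀ m ∈ LInfTau P hτ, φ (X + scale m (indFrom P hτ)) = φ X + m

/-- Concave monetary utility functionals on `R^∞_{τ,θ}`. -/
structure IsConcaveMonetary (hτ : IsStoppingTime ℱ τ) (hθ : IsStoppingTime ℱ θ)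
    (φ : Process0 P → Ω →ₘ[P] ℝ) : Prop extends IsMonetary hτ hθ φ where
  concave : ∀ X ∈ RInfST P hτ hθ, ∀ Y ∈ RInfST P hτ hθ, ∀ l ∈ LInfTau P hτ, 0 ≤ l → l ≤ 1 →
    l * φ X + (1 - l) * φ Y ≤ φ (scale l X + scale (1 - l) Y)

/-- Coherent utility functionals on `R^∞_{τ,θ}`. -/
structure IsCoherent (hτ : IsStoppingTime ℱ τ) (hθ : IsStoppingTime ℱ θ)
    (φ : Process0 P → Ω →ₘ[P] ℝ) : Prop extends IsConcaveMonetary hτ hθ φ where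
  homogeneous : ∀ X ∈ RInfST P hτ hθ, ∀ l ∈ LInfTau P hτ, 0 ≤ l → φ (scale l X) = l * φ X

/-- The acceptance set `C_φ = {X ∈ R^∞_{τ,θ} | φ(X) ≥ 0}`. -/
def acceptanceSet (hτ : IsStoppingTime ℱ τ) (hθ : IsStoppingTime ℱ θ)
    (φ : Process0 P → Ω →ₘ[P] ℝ) : Set (Process0 P) :=
  {X | X ∈ RInfST P hτ hθ ∧ 0 ≤ φ X}

/-- Continuity for bounded decreasing sequences: `φ(Xⁿ) → φ(X)` almost surely whenever
`(Xⁿ)` is a decreasing sequence in `R^∞_{τ,θ}`, `X ∈ R^∞_{τ,θ}`, and `Xⁿ_t → X_t` almost surely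
for all `t`. -/
def ContinuousForBoundedDecreasing (hτ : IsStoppingTime ℱ τ) (hθ : IsStoppingTime ℱ θ)
    (φ : Process0 P → Ω →ₘ[P] ℝ) : Prop :=
  ∀ (Xs : ℕ → Process0 P) (X : Process0 P), (∀ n, Xs n ∈ RInfST P hτ hθ) → X ∈ RInfST P hτ hθ →
    Antitone Xs → (∀ t, ∀ᵐ ω ∂P, Tendsto (fun n => Xs n t ω) atTop (𝓝 (X t ω))) →
    ∀ᵐ ω ∂P, Tendsto (fun n => φ (Xs n) ω) atTop (𝓝 (φ X ω))

/-- `φ^#(a) = ess inf_{X ∈ C_φ} ⟨X, a⟩_{τ,θ}`. -/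
noncomputable def sharp [IsFiniteMeasure P] (hτ : IsStoppingTime ℱ τ) (hθ : IsStoppingTime ℱ θ)
    (φ : Process0 P → Ω →ₘ[P] ℝ) (a : Process0 P) : Ω →ₘ[P] EReal :=
  essInfFam ((fun X => toE (condPairing hτ θ X a)) '' acceptanceSet hτ hθ φ)

/-- `Q⁰_φ = {a ∈ D_{τ,θ} | φ^#(a) = 0}`. -/
def QZero [IsFiniteMeasure P] (hτ : IsStoppingTime ℱ τ) (hθ : IsStoppingTime ℱ θ)
    (φ : Process0 P → Ω →ₘ[P] ℝ) : Set (Process0 P) :=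
  {a | a ∈ DST P hτ hθ ∧ sharp hτ hθ φ a = toE 0}

/-- `φ(X) = ess inf_{a ∈ Q} ⟨X, a⟩_{τ,θ}` for all `X ∈ R^∞_{τ,θ}`. -/
def Represents [IsFiniteMeasure P] (hτ : IsStoppingTime ℱ τ) (hθ : IsStoppingTime ℱ θ)
    (Q : Set (Process0 P)) (φ : Process0 P → Ω →ₘ[P] ℝ) : Prop :=
  ∀ X ∈ RInfST P hτ hθ, toE (φ X) = essInfFam ((fun a => toE (condPairing hτ θ X a)) '' Q)

/-- `K` is `F_τ`-convex: `λ a + (1 - λ) b ∈ K` for all `a, b ∈ K` and all `λ ∈ L^∞(F_τ)` with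
`0 ≤ λ ≤ 1`. -/
def TauConvex (hτ : IsStoppingTime ℱ τ) (K : Set (Process0 P)) : Prop :=
  ∀ a ∈ K, ∀ b ∈ K, ∀ l ∈ LInfTau P hτ, 0 ≤ l → l ≤ 1 → scale l a + scale (1 - l) b ∈ K

end Stopping

end CondUtil

open CondUtil

/-! Acceptability of X under a representation by Q says that E[1_B ∑ X_t Δa_t] ≥ 0 for all a in Q
and all B in F_τ. These conditions are σ(R^∞, A¹)-closed, and the axioms pass from conditional
pairings to their essential infimum; this gives 1 ⇒ 2. For 2 ⇒ 3, let Xⁿ decrease to X and put m =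
-inf φ(Xⁿ). Every Xⁿ + m 1_{[τ,∞)} is acceptable, and so is the weak limit X + m 1_{[τ,∞)}; hence
φ(X) ≥ inf φ(Xⁿ), while the other inequality is monotonicity.

The weight lies in 3 ⇒ 1. Bounded adapted processes are the bounded functions on ℕ × Ω with the
optional σ-algebra, under a finite measure, and integrable densities there are increments of
elements of A¹ (`exists_mem_A1_of_density`). By continuity and monotonicity the bounded parts of the
acceptance set are closed in L² (`isClosed_acceptableL2`). A convex, upward closed set with this
property is separated from outside bounded functions by an integrable density
(`exists_separating_density`). This is a Krein–Šmulian argument carried out in Hilbert space: a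
countable family of L² constraints with summable masses is built level by level, and its sum Z is a
weight under which the set stays away from the outside point; Hahn–Banach after multiplication by √Z
then gives the functional.

Since the acceptance set is a cone containing the non-negative processes, the separating density is
non-negative and its pairing is non-negative on that set (`exists_separating_process`). Locality
turns this into conditional non-negativity, so one gets elements of a dual cone. To normalise them,
their conditional mass must be positive. An exhaustion produces one element with almost surely
positive mass (`exists_dualCone_pos`); a small multiple of it is added to the separating process
before dividing by the mass (`exists_normalization`). It follows that φ is the essential infimum
over the normalised dual cone (`exists_represents`).

This normalised cone is exactly Q⁰_φ (`QZero_eq`), and it is cut out by scalar pairing conditions,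
hence weakly closed. For minimality (`QZero_subset`), suppose a closed F_τ-convex K contains Q but
misses some a₀ in Q⁰_φ. Hahn–Banach gives a bounded X with ⟨X, a₀⟩ < u ≤ ⟨X, a⟩ for a in K. Since
F_τ-convexity makes the conditional pairings directed downwards, E φ(X) is a limit of values ⟨X, bₙ⟩
with bₙ in K, so u ≤ E φ(X) ≤ ⟨X, a₀⟩, a contradiction. -/

namespace CondUtil

/-! ### Essential infima of real families and their countable realisation -/

section EssInfReal

variable {Ω : Type*} {mΩ : MeasurableSpace Ω} {P : Measure Ω}

lemma coeFn_toE (f : Ω →ₘ[P] ℝ) : ∀ᵐ ω ∂P, toE f ω = ((f ω : ℝ) : EReal) :=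
  AEEqFun.coeFn_comp _ _ _

lemma toE_le_toE {f g : Ω →ₘ[P] ℝ} : toE f ≤ toE g ↔ f ≤ g := by
  rw [← AEEqFun.coeFn_le, ← AEEqFun.coeFn_le]
  refine eventually_congr ?_
  filter_upwards [coeFn_toE f, coeFn_toE g] with ω h1 h2
  rw [h1, h2, EReal.coe_le_coe_iff]

/-- An extended lower bound f may take the value -∞, but max(f, h) is real: it lies between h and
any member of S, which is why S must be non-empty. It is still a lower bound, so f ≤ max(f, h) ≤ h.
-/
lemma isGLB_image_toE_iff {S : Set (Ω →ₘ[P] ℝ)} (hS : S.Nonempty) {h : Ω →ₘ[P] ℝ} :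
    IsGLB (toE '' S) (toE h) ↔ IsGLB S h := by
  constructor
  · rintro ⟨h1, h2⟩
    refine ⟨fun s hs => toE_le_toE.1 (h1 (Set.mem_image_of_mem _ hs)), fun f hf => ?_⟩
    refine toE_le_toE.1 (h2 ?_)
    rintro _ ⟨s, hs, rfl⟩
    exact toE_le_toE.2 (hf hs)
  · rintro ⟨h1, h2⟩
    refine ⟨?_, fun f hf => ?_⟩
    · rintro _ ⟨s, hs, rfl⟩
      exact toE_le_toE.2 (h1 hs)
    · have hm : Measurable fun ω => (max (f ω) (h ω : EReal)).toReal :=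
        (f.measurable.max h.measurable.coe_real_ereal).ereal_toReal
      set g : Ω →ₘ[P] ℝ := AEEqFun.mk _ hm.aestronglyMeasurable with hg
      have key : ∀ s ∈ S, ∀ᵐ ω ∂P, f ω ≤ (s ω : EReal) ∧ h ω ≤ s ω := fun s hs => by
        filter_upwards [AEEqFun.coeFn_le.2 (hf (Set.mem_image_of_mem _ hs)),
          AEEqFun.coeFn_le.2 (h1 hs), coeFn_toE s] with ω a b c
        exact ⟨c ▸ a, b⟩
      have real : ∀ (x : EReal) (y z : ℝ), x ≤ z → y ≤ z →
          ((max x (y : EReal)).toReal : EReal) = max x y := fun x y z hx hy => by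
        refine EReal.coe_toReal ?_ ?_
        · exact ((max_le hx (EReal.coe_le_coe_iff.2 hy)).trans_lt (EReal.coe_lt_top z)).ne
        · exact ((EReal.bot_lt_coe y).trans_le (le_max_right _ _)).ne'
      have hgS : g ∈ lowerBounds S := fun s hs => by
        rw [← AEEqFun.coeFn_le]
        filter_upwards [key s hs, AEEqFun.coeFn_mk _ hm.aestronglyMeasurable] with ω a b
        rw [b, ← EReal.coe_le_coe_iff, real _ _ _ a.1 a.2]
        exact max_le a.1 (EReal.coe_le_coe_iff.2 a.2)
      have hgh := AEEqFun.coeFn_le.2 (h2 hgS)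
      obtain ⟨s, hs⟩ := hS
      rw [← AEEqFun.coeFn_le]
      filter_upwards [key s hs, AEEqFun.coeFn_mk _ hm.aestronglyMeasurable, hgh, coeFn_toE h]
        with ω a b c d
      rw [d]
      rw [b, ← EReal.coe_le_coe_iff, real _ _ _ a.1 a.2] at c
      exact (le_max_left _ _).trans c

lemma toE_eq_essInfFam_iff [IsFiniteMeasure P] {S : Set (Ω →ₘ[P] ℝ)} (hS : S.Nonempty)
    {h : Ω →ₘ[P] ℝ} : toE h = essInfFam (toE '' S) ↔ IsGLB S h := by
  rw [← isGLB_image_toE_iff hS]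
  exact ⟨fun e => e ▸ isGLB_essInfFam _, fun e => e.unique (isGLB_essInfFam _)⟩

/-- A greatest lower bound in the almost sure order is the pointwise infimum of a sequence. -/
theorem exists_seq_isGLB [IsFiniteMeasure P] {S : Set (Ω →ₘ[P] ℝ)} (hS : S.Nonempty)
    {h : Ω →ₘ[P] ℝ} (hh : IsGLB S h) :
    ∃ u : ℕ → Ω →ₘ[P] ℝ, (∀ n, u n ∈ S) ∧
      ∀ᵐ ω ∂P, IsGLB (Set.range fun n => u n ω) (h ω) := by
  classical
  let inff : (ℕ → Ω →ₘ[P] ℝ) → Ω → EReal := fun u ω => ⨅ n, ((u n ω : ℝ) : EReal)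
  have hm : ∀ u, Measurable (inff u) := fun u =>
    Measurable.iInf fun n => (u n).measurable.coe_real_ereal
  obtain ⟨s0, hs0⟩ := hS
  -- `squash` is bounded and reverses the order, so making the infimum of a countable subfamily
  -- small means making this finite integral large.
  let I : (ℕ → Ω →ₘ[P] ℝ) → ℝ≥0∞ := fun u => ∫⁻ ω, squash (inff u ω) ∂P
  let T : Set (ℕ → Ω →ₘ[P] ℝ) := {u | ∀ n, u n ∈ S}
  have hT : T.Nonempty := ⟨fun _ => s0, fun _ => hs0⟩
  have hImono : ∀ u v, (∀ ω, inff v ω ≤ inff u ω) → I u ≤ I v := fun u v h =>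
    lintegral_mono fun ω => squash_le_squash.2 (h ω)
  have hIfin : ∀ u, I u ≠ ⊤ := fun u => by
    refine ne_top_of_le_ne_top (measure_ne_top P Set.univ) ?_
    calc I u ≤ ∫⁻ _, 1 ∂P := lintegral_mono fun ω => squash_le_one _
      _ = P Set.univ := by simp
  obtain ⟨c, -, hc, hcT⟩ := exists_seq_tendsto_sSup (hT.image I) (OrderTop.bddAbove _)
  choose w hwT hw using hcT
  -- The pairing function merges a maximising sequence of countable subfamilies into one subfamily
  -- that attains the supremum.
  let v : ℕ → Ω →ₘ[P] ℝ := fun n => w n.unpair.1 n.unpair.2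
  have hvT : v ∈ T := fun n => hwT _ _
  have hvw : ∀ k, I (w k) ≤ I v := fun k => hImono _ _ fun ω =>
    le_iInf fun n => (iInf_le (fun n => ((v n ω : ℝ) : EReal)) (Nat.pair k n)).trans_eq
      (by simp [v])
  have hvmax : ∀ u ∈ T, I u ≤ I v := fun u hu =>
    (le_sSup (Set.mem_image_of_mem I hu)).trans
      (le_of_tendsto' hc fun k => (hw k) ▸ hvw k)
  -- Prepending f to v cannot raise the maximal integral, so it does not change the pointwise
  -- infimum almost everywhere.
  have hlow : ∀ f ∈ S, ∀ᵐ ω ∂P, inff v ω ≤ (f ω : EReal) := fun f hf => by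
    let u : ℕ → Ω →ₘ[P] ℝ := fun n => Nat.casesOn n f v
    have huT : u ∈ T := fun n => by cases n <;> simp [u, hf, hvT _]
    have huv : ∀ ω, inff u ω ≤ inff v ω := fun ω =>
      le_iInf fun n => iInf_le (fun n => ((u n ω : ℝ) : EReal)) (n + 1)
    have hae : (fun ω => squash (inff v ω)) =ᵐ[P] fun ω => squash (inff u ω) :=
      ae_eq_of_ae_le_of_lintegral_le (Eventually.of_forall fun ω => squash_le_squash.2 (huv ω))
        (hIfin v) (measurable_squash.comp (hm u)).aemeasurable (hvmax u huT)
    filter_upwards [hae] with ω h1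
    exact (squash_le_squash.1 h1.ge).trans (iInf_le (fun n => ((u n ω : ℝ) : EReal)) 0)
  have hhv : ∀ᵐ ω ∂P, ∀ n, h ω ≤ v n ω := ae_all_iff.2 fun n => AEEqFun.coeFn_le.2 (hh.1 (hvT n))
  have hreal : ∀ᵐ ω ∂P, (((inff v ω).toReal : ℝ) : EReal) = inff v ω := by
    filter_upwards [hhv] with ω h1
    refine EReal.coe_toReal ?_ ?_
    · exact ((iInf_le _ 0).trans_lt (EReal.coe_lt_top (v 0 ω))).ne
    · exact ((EReal.bot_lt_coe (h ω)).trans_le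
        (le_iInf fun n => EReal.coe_le_coe_iff.2 (h1 n))).ne'
  have hgm : AEStronglyMeasurable (fun ω => (inff v ω).toReal) P :=
    (hm v).ereal_toReal.aestronglyMeasurable
  have hg : AEEqFun.mk _ hgm ≤ h := hh.2 fun s hs => by
    rw [← AEEqFun.coeFn_le]
    filter_upwards [hlow s hs, hreal, AEEqFun.coeFn_mk _ hgm] with ω a b c
    rw [c, ← EReal.coe_le_coe_iff, b]
    exact a
  refine ⟨v, hvT, ?_⟩
  filter_upwards [AEEqFun.coeFn_le.2 hg, hreal, AEEqFun.coeFn_mk _ hgm, hhv] with ω a b c d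
  refine ⟨by rintro _ ⟨n, rfl⟩; exact d n, fun x hx => ?_⟩
  refine le_trans ?_ a
  rw [c, ← EReal.coe_le_coe_iff, b]
  exact le_iInf fun n => EReal.coe_le_coe_iff.2 (hx ⟨n, rfl⟩)

end EssInfReal

/-! ### Separation of convex sets in a Hilbert space -/

section Hilbert

variable {H : Type*} [NormedAddCommGroup H] [InnerProductSpace ℝ H] [CompleteSpace H]

/-- A decreasing sequence of non-empty bounded closed convex subsets of a Hilbert space has
non-empty intersection. -/
theorem nonempty_iInter_of_convex_bounded {L : ℕ → Set H} (hL : Antitone L)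
    (hne : ∀ n, (L n).Nonempty) (hcl : ∀ n, IsClosed (L n)) (hcv : ∀ n, Convex ℝ (L n))
    {R : ℝ} (hR : ∀ x ∈ L 0, ‖x‖ ≤ R) : (⋂ n, L n).Nonempty := by
  -- The points of minimal norm form a Cauchy sequence, so weak compactness is not needed.
  have hmin : ∀ n, ∃ x ∈ L n, ∀ y ∈ L n, ‖x‖ ≤ ‖y‖ := fun n => by
    obtain ⟨x, hx, h⟩ := exists_norm_eq_iInf_of_complete_convex (hne n) (hcl n).isComplete
      (hcv n) 0
    refine ⟨x, hx, fun y hy => ?_⟩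
    rw [zero_sub, norm_neg] at h
    rw [h]
    refine (ciInf_le ⟨0, ?_⟩ (⟨y, hy⟩ : L n)).trans (by simp)
    rintro _ ⟨z, rfl⟩
    exact norm_nonneg _
  choose x hx hxm using hmin
  have hmono : Monotone fun n => ‖x n‖ ^ 2 := fun m n hmn =>
    pow_le_pow_left₀ (norm_nonneg _) (hxm m _ (hL hmn (hx n))) 2
  have hbdd : BddAbove (Set.range fun n => ‖x n‖ ^ 2) := by
    refine ⟨R ^ 2, ?_⟩
    rintro _ ⟨n, rfl⟩
    exact pow_le_pow_left₀ (norm_nonneg _) (hR _ (hL (Nat.zero_le n) (hx n))) 2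
  set r := ⨆ n, ‖x n‖ ^ 2
  have hlim : Tendsto (fun n => ‖x n‖ ^ 2) atTop (𝓝 r) := tendsto_atTop_ciSup hmono hbdd
  -- The midpoint of x m and x n lies in L m, so its norm is at least that of x m; the parallelogram
  -- law then bounds the distance.
  have hdist : ∀ m n, m ≤ n → ‖x m - x n‖ ^ 2 ≤ 2 * (r - ‖x m‖ ^ 2) := fun m n hmn => by
    have hmid := hxm m _ (hcv m (hx m) (hL hmn (hx n)) (by norm_num : (0 : ℝ) ≤ 1 / 2)
      (by norm_num : (0 : ℝ) ≤ 1 / 2) (by norm_num))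
    have h1 : ‖x m + x n‖ = 2 * ‖(1 / 2 : ℝ) • x m + (1 / 2 : ℝ) • x n‖ := by
      rw [← smul_add, norm_smul]
      norm_num
      ring
    have h2 := parallelogram_law_with_norm ℝ (x m) (x n)
    have h3 : ‖x n‖ ^ 2 ≤ r := le_ciSup hbdd n
    have h4 := pow_le_pow_left₀ (norm_nonneg _) hmid 2
    rw [h1] at h2
    nlinarith
  have hcauchy : CauchySeq x := by
    refine Metric.cauchySeq_iff'.2 fun ε hε => ?_
    have h0 : Tendsto (fun n => 2 * (r - ‖x n‖ ^ 2)) atTop (𝓝 0) := by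
      simpa using (hlim.const_sub r).const_mul 2
    obtain ⟨N, hN⟩ := (h0.eventually (gt_mem_nhds (pow_pos hε 2))).exists
    refine ⟨N, fun n hn => ?_⟩
    rw [dist_comm, dist_eq_norm]
    exact lt_of_pow_lt_pow_left₀ 2 hε.le ((hdist N n hn).trans_lt hN)
  obtain ⟨z, hz⟩ := cauchySeq_tendsto_of_complete hcauchy
  refine ⟨z, Set.mem_iInter.2 fun n => (hcl n).mem_of_tendsto hz ?_⟩
  filter_upwards [eventually_ge_atTop n] with m hm using hL hm (hx m)

/-- Disjoint closed convex sets in a Hilbert space, one of them bounded, can be separated. -/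
theorem exists_separating_of_convex_bounded {K W : Set H} (hK : Convex ℝ K) (hKc : IsClosed K)
    {R : ℝ} (hKR : ∀ x ∈ K, ‖x‖ ≤ R) (hW : Convex ℝ W) (hWc : IsClosed W) (hd : Disjoint K W)
    (h0 : (0 : H) ∈ W) :
    ∃ h : H, (∀ x ∈ K, 1 < inner ℝ h x) ∧ ∀ x ∈ W, inner ℝ h x ≤ 2 := by
  -- If K met every closed thickening of W, these intersections would have a common point, at
  -- distance zero from the closed set W.
  obtain ⟨n, hn⟩ : ∃ n : ℕ, K ∩ Metric.cthickening (1 / (n + 1 : ℝ)) W = ∅ := by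
    by_contra! hcon
    have hmono : Antitone fun n : ℕ => K ∩ Metric.cthickening (1 / (n + 1 : ℝ)) W :=
      fun m n hmn => Set.inter_subset_inter_right _ (Metric.cthickening_mono
        (one_div_le_one_div_of_le (by positivity) (by gcongr)) _)
    obtain ⟨z, hz⟩ := nonempty_iInter_of_convex_bounded hmono hcon
      (fun n => hKc.inter Metric.isClosed_cthickening) (fun n => hK.inter (hW.cthickening _))
      (R := R) (fun x hx => hKR x hx.1)
    rw [Set.mem_iInter] at hz
    refine Set.disjoint_left.1 hd (hz 0).1 ?_
    rw [← hWc.closure_eq, Metric.mem_closure_iff_infDist_zero ⟨0, h0⟩]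
    refine le_antisymm (ge_of_tendsto' tendsto_one_div_add_atTop_nhds_zero_nat fun n => ?_)
      Metric.infDist_nonneg
    have := (hz n).2
    rw [Metric.mem_cthickening_iff] at this
    exact ENNReal.toReal_le_of_le_ofReal (by positivity) this
  have hpos : (0 : ℝ) < 1 / (n + 1 : ℝ) := by positivity
  obtain ⟨f, u, hf, hfK⟩ := geometric_hahn_banach_open (hW.thickening (1 / (n + 1 : ℝ)))
    Metric.isOpen_thickening hK (Set.disjoint_left.2 fun x hx hxK =>
      (hn ▸ ⟨hxK, Metric.thickening_subset_cthickening _ _ hx⟩ : x ∈ (∅ : Set H)))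
  have hsub := Metric.self_subset_thickening hpos W
  have hu : 0 < u := by simpa using hf 0 (hsub h0)
  -- The functional is below u on W and at least u on K, with u > 0 because 0 lies in W; the factor
  -- 2/u moves the threshold to 2.
  refine ⟨(2 / u) • (InnerProductSpace.toDual ℝ H).symm f, fun x hx => ?_, fun x hx => ?_⟩ <;>
    rw [real_inner_smul_left, InnerProductSpace.toDual_symm_apply, div_mul_eq_mul_div]
  · rw [lt_div_iff₀ hu]
    linarith [hfK x hx]
  · rw [div_le_iff₀ hu]
    linarith [hf x (hsub hx)]

end Hilbert

/-! ### A Krein–Šmulian argument: densities from constraints in L² -/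

section Separation

variable {α : Type*} {mα : MeasurableSpace α} {μ : Measure α}

lemma L2_inner_eq (f g : Lp ℝ 2 μ) : inner ℝ f g = ∫ x, f x * g x ∂μ := by
  rw [L2.inner_def]
  simp [mul_comm]

lemma L2_integrable_mul (f g : Lp ℝ 2 μ) : Integrable (fun x => f x * g x) μ := by
  simpa [mul_comm] using L2.integrable_inner (𝕜 := ℝ) f g

/-- Test with Y = f ⊓ 0: the inner product is the squared norm of f ⊓ 0, which must therefore
vanish. -/
lemma L2_nonneg_of_inner_nonpos {f : Lp ℝ 2 μ} (h : ∀ Y : Lp ℝ 2 μ, Y ≤ 0 → inner ℝ f Y ≤ 0) :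
    0 ≤ f := by
  have h1 : inner ℝ f (f ⊓ 0) = inner ℝ (f ⊓ 0) (f ⊓ 0) := by
    rw [L2_inner_eq, L2_inner_eq]
    refine integral_congr_ae ?_
    filter_upwards [Lp.coeFn_inf f 0, Lp.coeFn_zero ℝ 2 μ] with x hx h0
    rw [hx]
    simp only [Pi.inf_apply, h0, Pi.zero_apply]
    rcases le_total (f x) 0 with hf | hf
    · rw [inf_eq_left.2 hf]
    · rw [inf_eq_right.2 hf]; simp
  have h2 := h (f ⊓ 0) inf_le_right
  rw [h1, real_inner_self_nonpos] at h2
  exact inf_eq_right.1 h2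

instance instIsOrderedModuleL2 : IsOrderedModule ℝ (Lp ℝ 2 μ) :=
  .of_smul_nonneg fun c hc f hf => by
    rw [← Lp.coeFn_nonneg] at hf ⊢
    filter_upwards [hf, Lp.coeFn_smul c f] with x h1 h2
    rw [h2]
    exact mul_nonneg hc h1

variable [IsFiniteMeasure μ]

/-- The constant function `1`, as an element of `L²`. -/
noncomputable def oneL2 (μ : Measure α) [IsFiniteMeasure μ] : Lp ℝ 2 μ := Lp.const 2 μ 1

lemma coeFn_smul_oneL2 (c : ℝ) : ∀ᵐ x ∂μ, (c • oneL2 μ) x = c := by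
  filter_upwards [Lp.coeFn_smul c (oneL2 μ), Lp.coeFn_const (p := 2) (μ := μ) (1 : ℝ)]
    with x h1 h2
  rw [h1, Pi.smul_apply, oneL2, h2]
  simp

lemma oneL2_nonneg : 0 ≤ oneL2 μ := by
  rw [← Lp.coeFn_nonneg]
  filter_upwards [coeFn_smul_oneL2 (μ := μ) 1] with x hx
  rw [one_smul] at hx
  simp [hx]

lemma abs_le_smul_oneL2_iff {X : Lp ℝ 2 μ} {c : ℝ} :
    |X| ≤ c • oneL2 μ ↔ ∀ᵐ x ∂μ, |X x| ≤ c := by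
  rw [← Lp.coeFn_le]
  refine eventually_congr ?_
  filter_upwards [coeFn_smul_oneL2 (μ := μ) c, Lp.coeFn_abs X] with x h1 h2
  rw [h1, h2]

/-- One step of the construction of a dominating density. -/
lemma exists_constraint {K : Set (Lp ℝ 2 μ)} (hK : Convex ℝ K) (hKc : IsClosed K) {c d : ℝ}
    (hc : 0 ≤ c) (hd : ∀ Y ∈ K, 0 ≤ Y ∧ Y ≤ d • oneL2 μ)
    (hdisj : ∀ Y ∈ K, ¬ Y ≤ c • oneL2 μ) :
    ∃ f : Lp ℝ 2 μ, 0 ≤ f ∧ c * inner ℝ f (oneL2 μ) ≤ 2 ∧ ∀ Y ∈ K, 1 < inner ℝ f Y := by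
  obtain ⟨f, hf1, hf2⟩ := exists_separating_of_convex_bounded (W := Set.Iic (c • oneL2 μ))
    (R := ‖d • oneL2 μ‖) hK hKc (fun Y hY => norm_le_norm_of_abs_le_abs (by
      rw [abs_of_nonneg (hd Y hY).1, abs_of_nonneg ((hd Y hY).1.trans (hd Y hY).2)]
      exact (hd Y hY).2)) (convex_Iic _) isClosed_Iic
    (Set.disjoint_left.2 fun Y hY hY' => hdisj Y hY hY') (smul_nonneg hc oneL2_nonneg)
  refine ⟨f, L2_nonneg_of_inner_nonpos fun Y hY => ?_, ?_, hf1⟩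
  -- The set of functions below c is stable under adding multiples of non-positive ones, so a
  -- positive value at such a Y, scaled to 3, would break the bound 2.
  · by_contra! hcon
    have := hf2 ((3 / inner ℝ f Y) • Y)
      ((smul_nonpos_of_nonneg_of_nonpos (by positivity) hY).trans (smul_nonneg hc oneL2_nonneg))
    rw [real_inner_smul_right, div_mul_cancel₀ _ hcon.ne'] at this
    norm_num at this
  · have := hf2 (c • oneL2 μ) (Set.mem_Iic.2 le_rfl)
    rwa [real_inner_smul_right] at this

/-- A convex set of non-negative bounded functions whose bounded parts are closed, and which does
not contain functions below some positive constant, is bounded away from zero by an integrable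
density. -/
theorem exists_density_of_bounded_closed {K : Set (Lp ℝ 2 μ)} (hK : Convex ℝ K)
    (hpos : ∀ Y ∈ K, 0 ≤ Y) (hbd : ∀ Y ∈ K, ∃ c : ℝ, Y ≤ c • oneL2 μ)
    (hcl : ∀ c : ℝ, IsClosed {Y | Y ∈ K ∧ Y ≤ c • oneL2 μ}) {η : ℝ} (hη : 0 < η)
    (h0 : ∀ Y ∈ K, ¬ Y ≤ η • oneL2 μ) :
    ∃ Z : α → ℝ, Integrable Z μ ∧ (∀ x, 0 ≤ Z x) ∧ ∀ Y ∈ K, 1 < ∫ x, Z x * Y x ∂μ := by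
  -- Each new constraint has mass at most 2 / c n; geometric levels make these masses summable.
  let c : ℕ → ℝ := fun n => η * 2 ^ n
  have hcpos : ∀ n, 0 < c n := fun n => by positivity
  -- Invariant: whatever in K obeys the constraints F is not below the level c n. The part of K
  -- below c (n + 1) that obeys F is closed, convex, bounded and disjoint from the functions below c
  -- n, so one further constraint excludes it and raises the level.
  let I : ℕ → Set (Lp ℝ 2 μ) → Prop := fun n F =>
    ∀ Y ∈ K, (∀ f ∈ F, inner ℝ f Y ≤ 1) → ¬ Y ≤ c n • oneL2 μ
  have step : ∀ n F, I n F → ∃ f : Lp ℝ 2 μ, 0 ≤ f ∧ c n * inner ℝ f (oneL2 μ) ≤ 2 ∧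
      I (n + 1) (insert f F) := fun n F hF => by
    obtain ⟨f, hf0, hfc, hf1⟩ := exists_constraint
      (K := {Y | Y ∈ K ∧ Y ≤ c (n + 1) • oneL2 μ} ∩ {Y | ∀ f ∈ F, inner ℝ f Y ≤ 1}) (c := c n)
      (d := c (n + 1))
      ((hK.inter (convex_Iic (c (n + 1) • oneL2 μ))).inter fun Y hY Y' hY' a b ha hb hab f hf => by
        rw [inner_add_right, real_inner_smul_right, real_inner_smul_right]
        calc _ ≤ a * 1 + b * 1 := by gcongr; exacts [hY f hf, hY' f hf]
          _ = 1 := by rw [mul_one, mul_one, hab])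
      ((hcl _).inter (by
        have : {Y : Lp ℝ 2 μ | ∀ f ∈ F, inner ℝ f Y ≤ 1} =
            ⋂ f ∈ F, {Y | inner ℝ f Y ≤ 1} := by ext; simp
        rw [this]
        exact isClosed_biInter fun f _ =>
          isClosed_le (continuous_const.inner continuous_id) continuous_const))
      (hcpos n).le (fun Y hY => ⟨hpos Y hY.1.1, hY.1.2⟩) (fun Y hY => hF Y hY.1.1 hY.2)
    refine ⟨f, hf0, hfc, fun Y hY hYF hYc => ?_⟩
    exact (hf1 Y ⟨⟨hY, hYc⟩, fun g hg => hYF g (Set.mem_insert_of_mem _ hg)⟩).not_ge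
      (hYF f (Set.mem_insert _ _))
  choose! f hf0 hfc hfI using step
  let S : ℕ → Set (Lp ℝ 2 μ) := fun n => Nat.rec ∅ (fun n F => insert (f n F) F) n
  have hS : ∀ n, I n (S n) := fun n => by
    induction n with
    | zero => intro Y hY _; simpa [c] using h0 Y hY
    | succ n ih => exact hfI n _ ih
  let g : ℕ → Lp ℝ 2 μ := fun n => f n (S n)
  have hSg : ∀ n, S n ⊆ Set.range g := fun n => by
    induction n with
    | zero => exact Set.empty_subset _
    | succ n ih => exact Set.insert_subset ⟨n, rfl⟩ ih
  have hg0 : ∀ n, 0 ≤ g n := fun n => hf0 n _ (hS n)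
  -- Each Y in K is bounded, hence below some c n, and so it must violate one of the constraints.
  have hKg : ∀ Y ∈ K, ∃ n, 1 < inner ℝ (g n) Y := fun Y hY => by
    by_contra! hcon
    obtain ⟨d, hd⟩ := hbd Y hY
    obtain ⟨n, hn⟩ : ∃ n, d ≤ c n := by
      obtain ⟨n, hn⟩ := pow_unbounded_of_one_lt (d / η) (one_lt_two (α := ℝ))
      exact ⟨n, by rw [div_lt_iff₀ hη] at hn; simp only [c]; linarith⟩
    refine hS n Y hY (fun f hf => ?_) (hd.trans (smul_le_smul_of_nonneg_right hn oneL2_nonneg))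
    obtain ⟨m, rfl⟩ := hSg n hf
    exact hcon m
  have hgint : ∀ n, Integrable (g n) μ := fun n => (Lp.memLp (g n)).integrable one_le_two
  have hgsum : ∀ n, ∫ x, ‖g n x‖ ∂μ ≤ 2 / η * (1 / 2) ^ n := fun n => by
    have h1 : ∫ x, ‖g n x‖ ∂μ = inner ℝ (g n) (oneL2 μ) := by
      rw [L2_inner_eq]
      refine integral_congr_ae ?_
      filter_upwards [(Lp.coeFn_nonneg _).2 (hg0 n), coeFn_smul_oneL2 (μ := μ) 1] with x h1 h2
      rw [one_smul] at h2
      rw [h2, mul_one, Real.norm_of_nonneg h1]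
    have h2 := hfc n _ (hS n)
    rw [h1, one_div, inv_pow, ← div_eq_mul_inv, div_div, le_div_iff₀ (hcpos n), mul_comm]
    exact h2
  have hsummable : Summable fun n => ∫ x, ‖g n x‖ ∂μ :=
    Summable.of_nonneg_of_le (fun n => integral_nonneg fun x => norm_nonneg _) hgsum
      ((summable_geometric_of_lt_one (by norm_num) (by norm_num)).mul_left _)
  have hfin : ∫⁻ x, ∑' n, ‖g n x‖ₑ ∂μ < ∞ := by
    rw [lintegral_tsum fun n => (hgint n).1.enorm]
    have : ∀ n, ∫⁻ x, ‖g n x‖ₑ ∂μ = ENNReal.ofReal (∫ x, ‖g n x‖ ∂μ) := fun n => by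
      rw [ofReal_integral_norm_eq_lintegral_enorm (hgint n)]
    simp_rw [this]
    exact hsummable.tsum_ofReal_lt_top
  have hZm : AEMeasurable (fun x => ∑' n, ‖g n x‖ₑ) μ :=
    AEMeasurable.tsum fun n => (hgint n).1.enorm
  -- The sum of all constraints dominates each of them and is integrable, so it exceeds 1 on all of
  -- K at once.
  refine ⟨fun x => (∑' n, ‖g n x‖ₑ).toReal, integrable_toReal_of_lintegral_ne_top hZm hfin.ne,
    fun x => ENNReal.toReal_nonneg, fun Y hY => ?_⟩
  obtain ⟨n, hn⟩ := hKg Y hY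
  obtain ⟨d, hd⟩ := hbd Y hY
  refine hn.trans_le ?_
  rw [L2_inner_eq]
  have hY0 := (Lp.coeFn_nonneg _).2 (hpos Y hY)
  have hYd : ∀ᵐ x ∂μ, Y x ≤ d := by
    filter_upwards [(Lp.coeFn_le _ _).2 hd, coeFn_smul_oneL2 (μ := μ) d] with x h1 h2
    rwa [h2] at h1
  refine integral_mono_ae (L2_integrable_mul _ _)
    ((integrable_toReal_of_lintegral_ne_top hZm hfin.ne).mul_bdd (c := d)
      (Lp.aestronglyMeasurable Y) ?_) ?_
  · filter_upwards [hY0, hYd] with x h1 h2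
    rwa [Real.norm_of_nonneg h1]
  · filter_upwards [hY0, ae_lt_top' hZm hfin.ne] with x h1 h2
    refine mul_le_mul_of_nonneg_right ?_ h1
    rw [← ENNReal.ofReal_le_iff_le_toReal h2.ne]
    refine le_trans ?_ (ENNReal.le_tsum n)
    rw [← ofReal_norm]
    exact ENNReal.ofReal_le_ofReal (le_abs_self _)

end Separation

section Separation

variable {α : Type*} {mα : MeasurableSpace α} {μ : Measure α} [IsFiniteMeasure μ]

lemma abs_smul_oneL2 {c : ℝ} (hc : 0 ≤ c) : |c • oneL2 μ| = c • oneL2 μ :=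
  abs_of_nonneg (smul_nonneg hc oneL2_nonneg)

lemma integrable_mul_of_abs_le {Z : α → ℝ} (hZ : Integrable Z μ) {X : Lp ℝ 2 μ} {c : ℝ}
    (hX : |X| ≤ c • oneL2 μ) : Integrable (fun x => Z x * X x) μ :=
  hZ.mul_bdd (Lp.aestronglyMeasurable X) (abs_le_smul_oneL2_iff.1 hX)

/-- Apply the preceding theorem to the non-negative Y with X₀ + Y in C. If such Y could be
arbitrarily small in sup norm, upward closedness would put X₀ + 1/(n+1) in C, and closedness of a
bounded part would put X₀ there too. -/
lemma exists_density_of_upper {C : Set (Lp ℝ 2 μ)} (hC : Convex ℝ C)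
    (hbd : ∀ X ∈ C, ∃ c : ℝ, |X| ≤ c • oneL2 μ)
    (hup : ∀ X ∈ C, ∀ Y, X ≤ Y → (∃ c : ℝ, |Y| ≤ c • oneL2 μ) → Y ∈ C)
    (hcl : ∀ c : ℝ, IsClosed {X | X ∈ C ∧ |X| ≤ c • oneL2 μ})
    {X₀ : Lp ℝ 2 μ} {c₀ : ℝ} (hX₀ : |X₀| ≤ c₀ • oneL2 μ) (h : X₀ ∉ C) :
    ∃ Z : α → ℝ, Integrable Z μ ∧ (∀ x, 0 ≤ Z x) ∧
      ∀ Y, 0 ≤ Y → X₀ + Y ∈ C → 1 < ∫ x, Z x * Y x ∂μ := by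
  obtain ⟨η, hη, h0⟩ : ∃ η : ℝ, 0 < η ∧ ∀ Y, 0 ≤ Y → X₀ + Y ∈ C → ¬ Y ≤ η • oneL2 μ := by
    by_contra! hcon
    have hmem : ∀ n : ℕ, X₀ + (1 / (n + 1 : ℝ)) • oneL2 μ ∈
        {X | X ∈ C ∧ |X| ≤ (c₀ + 1) • oneL2 μ} := fun n => by
      obtain ⟨Y, -, hYC, hYn⟩ := hcon (1 / (n + 1 : ℝ)) (by positivity)
      have hle : |X₀ + (1 / (n + 1 : ℝ)) • oneL2 μ| ≤ (c₀ + 1) • oneL2 μ := by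
        refine (abs_add_le _ _).trans ?_
        rw [abs_smul_oneL2 (by positivity), add_smul]
        refine add_le_add hX₀ (smul_le_smul_of_nonneg_right ?_ oneL2_nonneg)
        rw [div_le_one (by positivity)]
        linarith [n.cast_nonneg (α := ℝ)]
      exact ⟨hup _ hYC _ (by gcongr) ⟨_, hle⟩, hle⟩
    have hlim : Tendsto (fun n : ℕ => X₀ + (1 / (n + 1 : ℝ)) • oneL2 μ) atTop (𝓝 X₀) := by
      simpa using (tendsto_one_div_add_atTop_nhds_zero_nat (𝕜 := ℝ)).smul_const (oneL2 μ)
        |>.const_add X₀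
    exact h ((hcl _).mem_of_tendsto hlim (Eventually.of_forall hmem)).1
  have hKbd : ∀ Y, 0 ≤ Y → ∀ c : ℝ, Y ≤ c • oneL2 μ → |X₀ + Y| ≤ (c₀ + c) • oneL2 μ :=
    fun Y hY c hc => (abs_add_le _ _).trans (by
      rw [abs_of_nonneg hY, add_smul]
      exact add_le_add hX₀ hc)
  obtain ⟨Z, hZ, hZ0, hZK⟩ := exists_density_of_bounded_closed (K := {Y | 0 ≤ Y ∧ X₀ + Y ∈ C})
    (by
      refine (convex_Ici (0 : Lp ℝ 2 μ)).inter ?_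
      exact hC.translate_preimage_right X₀)
    (fun Y hY => hY.1)
    (fun Y hY => by
      obtain ⟨c, hc⟩ := hbd _ hY.2
      refine ⟨c + c₀, ?_⟩
      have h1 : Y = (X₀ + Y) + -X₀ := by abel
      rw [h1, add_smul]
      exact add_le_add ((le_abs_self _).trans hc) ((neg_le_abs _).trans hX₀))
    (fun c => by
      have : {Y | Y ∈ {Y | 0 ≤ Y ∧ X₀ + Y ∈ C} ∧ Y ≤ c • oneL2 μ} =
          Set.Ici 0 ∩ Set.Iic (c • oneL2 μ) ∩
            (fun Y => X₀ + Y) ⁻¹' {X | X ∈ C ∧ |X| ≤ (c₀ + c) • oneL2 μ} := by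
        ext Y
        constructor
        · rintro ⟨⟨h1, h2⟩, h3⟩
          exact ⟨⟨h1, h3⟩, h2, hKbd Y h1 c h3⟩
        · rintro ⟨⟨h1, h2⟩, h3, -⟩
          exact ⟨⟨h1, h3⟩, h2⟩
      rw [this]
      exact (isClosed_Ici.inter isClosed_Iic).inter
        ((hcl _).preimage (continuous_const.add continuous_id)))
    hη (fun Y hY => h0 Y hY.1 hY.2)
  exact ⟨Z, hZ, hZ0, fun Y h1 h2 => hZK Y ⟨h1, h2⟩⟩

/-- A convex upward closed set of bounded functions whose bounded parts are closed can be strictly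
separated, by an integrable density, from the bounded functions that it does not contain. -/
theorem exists_separating_density {C : Set (Lp ℝ 2 μ)} (hC : Convex ℝ C)
    (hbd : ∀ X ∈ C, ∃ c : ℝ, |X| ≤ c • oneL2 μ)
    (hup : ∀ X ∈ C, ∀ Y, X ≤ Y → (∃ c : ℝ, |Y| ≤ c • oneL2 μ) → Y ∈ C)
    (hcl : ∀ c : ℝ, IsClosed {X | X ∈ C ∧ |X| ≤ c • oneL2 μ})
    {X₀ : Lp ℝ 2 μ} {c₀ : ℝ} (hX₀ : |X₀| ≤ c₀ • oneL2 μ) (h : X₀ ∉ C) :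
    ∃ Z : α → ℝ, Integrable Z μ ∧ ∃ u : ℝ, ∫ x, Z x * X₀ x ∂μ < u ∧
      ∀ X ∈ C, u ≤ ∫ x, Z x * X x ∂μ := by
  obtain ⟨Z, hZ, hZ0, hZ1⟩ := exists_density_of_upper hC hbd hup hcl hX₀ h
  have hsm : AEStronglyMeasurable (fun x => √(Z x)) μ :=
    Real.continuous_sqrt.comp_aestronglyMeasurable hZ.1
  have hs2 : MemLp (fun x => √(Z x)) 2 μ := by
    rw [memLp_two_iff_integrable_sq hsm]
    simpa only [Real.sq_sqrt (hZ0 _)] using hZ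
  set s : Lp ℝ 2 μ := hs2.toLp _ with hs
  have hsx : ∀ᵐ x ∂μ, s x = √(Z x) := hs2.coeFn_toLp
  -- After multiplication by √Z the differences X - X₀ are compared in L², and Z-integrals become
  -- inner products with √Z.
  let D : Set (Lp ℝ 2 μ) := {d | ∃ X ∈ C, ∀ᵐ x ∂μ, d x = √(Z x) * (X x - X₀ x)}
  have hD : ∀ X ∈ C, ∃ d : Lp ℝ 2 μ, ∀ᵐ x ∂μ, d x = √(Z x) * (X x - X₀ x) := fun X hX => by
    obtain ⟨c, hc⟩ := hbd X hX
    have h1 := abs_le_smul_oneL2_iff.1 hc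
    have h2 := abs_le_smul_oneL2_iff.1 hX₀
    have hm : MemLp (fun x => √(Z x) * (X x - X₀ x)) 2 μ := by
      refine MemLp.of_le_mul (c := c + c₀) hs2 (hsm.mul
        ((Lp.aestronglyMeasurable X).sub (Lp.aestronglyMeasurable X₀))) ?_
      filter_upwards [h1, h2] with x a b
      rw [norm_mul, mul_comm]
      refine mul_le_mul_of_nonneg_right ?_ (norm_nonneg _)
      exact (norm_sub_le _ _).trans (add_le_add a b)
    exact ⟨hm.toLp _, hm.coeFn_toLp⟩
  have hDc : Convex ℝ D := by
    rintro d ⟨X, hX, hd⟩ d' ⟨X', hX', hd'⟩ a b ha hb hab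
    refine ⟨a • X + b • X', hC hX hX' ha hb hab, ?_⟩
    filter_upwards [hd, hd', Lp.coeFn_add (a • X) (b • X'), Lp.coeFn_smul a X, Lp.coeFn_smul b X',
      Lp.coeFn_add (a • d) (b • d'), Lp.coeFn_smul a d, Lp.coeFn_smul b d']
      with x h1 h2 h3 h4 h5 h6 h7 h8
    rw [h3, h6]
    simp only [Pi.add_apply, h4, h5, h7, h8, Pi.smul_apply, smul_eq_mul, h1, h2]
    have : b = 1 - a := by linarith
    subst this
    ring
  have hnorm : ∀ d ∈ D, 1 ≤ ‖s‖ * ‖d‖ := by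
    rintro d ⟨X, hX, hd⟩
    -- Replacing X by X ⊔ X₀ stays in C and turns the difference into its positive part, so that the
    -- bound for Z applies. Cauchy–Schwarz then keeps the norm of d away from zero.
    have hXX : X ⊔ X₀ ∈ C := by
      obtain ⟨c, hc⟩ := hbd X hX
      refine hup X hX _ le_sup_left ⟨max c c₀, ?_⟩
      rw [abs_le_smul_oneL2_iff] at hc hX₀ ⊢
      filter_upwards [hc, hX₀, Lp.coeFn_sup X X₀] with x h1 h2 h3
      rw [h3]
      exact abs_max_le_max_abs_abs.trans (max_le_max h1 h2)
    have hlt := hZ1 (X ⊔ X₀ - X₀) (sub_nonneg.2 le_sup_right) (by rwa [add_sub_cancel])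
    have hle : ∫ x, Z x * (X ⊔ X₀ - X₀ : Lp ℝ 2 μ) x ∂μ ≤ inner ℝ s |d| := by
      rw [L2_inner_eq]
      refine integral_mono_of_nonneg ?_ (L2_integrable_mul _ _) ?_
      · filter_upwards [(Lp.coeFn_nonneg _).2 (sub_nonneg.2 (le_sup_right : X₀ ≤ X ⊔ X₀))]
          with x hx
        exact mul_nonneg (hZ0 x) hx
      · filter_upwards [hsx, hd, Lp.coeFn_abs d, Lp.coeFn_sub (X ⊔ X₀) X₀, Lp.coeFn_sup X X₀]
          with x h1 h2 h3 h4 h5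
        simp only [h1, h3, h2, h4, Pi.sub_apply, h5, Pi.sup_apply]
        rw [abs_mul, abs_of_nonneg (Real.sqrt_nonneg _), ← mul_assoc, Real.mul_self_sqrt (hZ0 x)]
        refine mul_le_mul_of_nonneg_left ?_ (hZ0 x)
        rw [sub_le_iff_le_add]
        refine sup_le ?_ ?_
        · linarith [le_abs_self (X x - X₀ x)]
        · linarith [abs_nonneg (X x - X₀ x)]
    have := hlt.le.trans (hle.trans (real_inner_le_norm s |d|))
    rwa [norm_abs_eq_norm] at this
  have h0D : (0 : Lp ℝ 2 μ) ∉ closure D := fun h0 => by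
    have hcl : IsClosed {d : Lp ℝ 2 μ | 1 ≤ ‖s‖ * ‖d‖} :=
      isClosed_le continuous_const (continuous_const.mul continuous_norm)
    have : (1 : ℝ) ≤ ‖s‖ * ‖(0 : Lp ℝ 2 μ)‖ := closure_minimal hnorm hcl h0
    norm_num at this
  obtain ⟨f, u, hf0, hfD⟩ := geometric_hahn_banach_point_closed hDc.closure isClosed_closure h0D
  set g := (InnerProductSpace.toDual ℝ (Lp ℝ 2 μ)).symm f with hg
  have hZint : Integrable (fun x => g x * s x) μ := L2_integrable_mul _ _
  -- Undoing the weight: g represents the separating functional on L², and g √Z is integrable as a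
  -- product of two L² functions.
  refine ⟨fun x => g x * s x, hZint, u + ∫ x, g x * s x * X₀ x ∂μ, ?_, fun X hX => ?_⟩
  · rw [map_zero] at hf0
    linarith
  · obtain ⟨d, hd⟩ := hD X hX
    obtain ⟨c, hc⟩ := hbd X hX
    have h1 := hfD d (subset_closure ⟨X, hX, hd⟩)
    rw [← InnerProductSpace.toDual_symm_apply, ← hg, L2_inner_eq] at h1
    have h2 : ∫ x, g x * d x ∂μ = ∫ x, (g x * s x * X x - g x * s x * X₀ x) ∂μ := by
      refine integral_congr_ae ?_
      filter_upwards [hd, hsx] with x a b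
      rw [a, b]
      ring
    rw [h2, integral_sub (integrable_mul_of_abs_le hZint hc)
      (integrable_mul_of_abs_le hZint hX₀)] at h1
    linarith

end Separation

/-! ### Pathwise facts: increments and projections of real sequences -/

section Sequences

/-- The increments of a real sequence. -/
def seqIncr (x : ℕ → ℝ) : ℕ → ℝ
  | 0 => x 0
  | t + 1 => x (t + 1) - x t

/-- The sequence `x`, set to `0` before `s` and stopped at `e`. -/
noncomputable def seqProj (s e : WithTop ℕ) (x : ℕ → ℝ) (t : ℕ) : ℝ :=
  if s ≤ (t : WithTop ℕ) then x (min (t : WithTop ℕ) e).untopA else 0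

lemma sum_seqIncr (x : ℕ → ℝ) (t : ℕ) : ∑ s ∈ Finset.range (t + 1), seqIncr x s = x t := by
  induction t with
  | zero => simp [seqIncr]
  | succ t ih => rw [Finset.sum_range_succ, ih, seqIncr]; ring

variable {s e : WithTop ℕ} {x : ℕ → ℝ} {t : ℕ}

lemma untopA_natCast (n : ℕ) : (n : WithTop ℕ).untopA = n := by
  rw [Nat.cast_withTop, WithTop.untopA_eq_untop (WithTop.coe_ne_top), WithTop.untop_coe]

lemma exists_natCast_of_le (h : e ≤ (t : WithTop ℕ)) : ∃ k : ℕ, e = (k : WithTop ℕ) :=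
  ⟨e.untop (h.trans_lt (WithTop.coe_lt_top t)).ne, (WithTop.coe_untop _ _).symm⟩

lemma seqProj_of_lt (h : (t : WithTop ℕ) < s) : seqProj s e x t = 0 :=
  if_neg h.not_ge

lemma seqProj_of_le (h : s ≤ (t : WithTop ℕ)) (h' : (t : WithTop ℕ) ≤ e) :
    seqProj s e x t = x t := by
  rw [seqProj, if_pos h, min_eq_left h', untopA_natCast]

lemma seqProj_of_ge {k : ℕ} (h : s ≤ (k : WithTop ℕ)) (h' : k ≤ t) :
    seqProj s (k : WithTop ℕ) x t = x k := by
  have h2 : (k : WithTop ℕ) ≤ t := by exact_mod_cast h'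
  rw [seqProj, if_pos (h.trans h2), min_eq_right h2, untopA_natCast]

lemma seqProj_succ (hse : s ≤ e) (h : e ≤ (t : WithTop ℕ)) :
    seqProj s e x (t + 1) = seqProj s e x t := by
  obtain ⟨e, rfl⟩ := exists_natCast_of_le h
  have h' : e ≤ t := by exact_mod_cast h
  rw [seqProj_of_ge hse h', seqProj_of_ge hse (h'.trans t.le_succ)]

lemma eq_of_stopped {k : ℕ} (h : ∀ t : ℕ, (k : WithTop ℕ) ≤ t → x (t + 1) = x t) (hkt : k ≤ t) :
    x t = x k := by
  induction t, hkt using Nat.le_induction with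
  | base => rfl
  | succ n hn ih => rw [h n (by exact_mod_cast hn), ih]

/-- Describes the fixed points of the projection by local conditions; this makes the projected
spaces of processes recognisable without a preimage. -/
lemma eq_seqProj_iff (hse : s ≤ e) : (∀ t, x t = seqProj s e x t) ↔
    (∀ t : ℕ, (t : WithTop ℕ) < s → x t = 0) ∧ ∀ t : ℕ, e ≤ (t : WithTop ℕ) → x (t + 1) = x t := by
  constructor
  · refine fun h => ⟨fun t ht => by rw [h, seqProj_of_lt ht], fun t ht => ?_⟩
    rw [h, h t, seqProj_succ hse ht]
  · rintro ⟨h1, h2⟩ t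
    rcases lt_or_ge (t : WithTop ℕ) s with hs | hs
    · rw [h1 t hs, seqProj_of_lt hs]
    rcases le_or_gt (t : WithTop ℕ) e with he | he
    · rw [seqProj_of_le hs he]
    obtain ⟨e, rfl⟩ := exists_natCast_of_le he.le
    have he' : e ≤ t := by exact_mod_cast he.le
    rw [seqProj_of_ge hse he', eq_of_stopped h2 he']

/-- By telescoping, vanishing increments up to t force the value 0 at t. At s itself a jump is
allowed, whereas the first increment forced to vanish at the other end is the one after e. -/
lemma seqIncr_eq_zero_iff (hse : s ≤ e) : (∀ t : ℕ, ¬ (s ≤ (t : WithTop ℕ) ∧ (t : WithTop ℕ) ≤ e) →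
      seqIncr x t = 0) ↔
    (∀ t : ℕ, (t : WithTop ℕ) < s → x t = 0) ∧ ∀ t : ℕ, e ≤ (t : WithTop ℕ) →
      x (t + 1) = x t := by
  constructor
  · refine fun h => ⟨fun t ht => ?_, fun t ht => ?_⟩
    · rw [← sum_seqIncr x]
      refine Finset.sum_eq_zero fun u hu => h u fun hc => ?_
      have : (u : WithTop ℕ) ≤ t := by
        exact_mod_cast Nat.lt_succ_iff.1 (Finset.mem_range.1 hu)
      exact (hc.1.trans this).not_gt ht
    · have h1 := h (t + 1) fun hc => ?_
      · simpa [seqIncr, sub_eq_zero] using h1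
      · have : ((t + 1 : ℕ) : WithTop ℕ) ≤ t := hc.2.trans ht
        exact absurd (by exact_mod_cast this : t + 1 ≤ t) (by omega)
  · rintro ⟨h1, h2⟩ t ht
    rcases lt_or_ge (t : WithTop ℕ) s with hs | hs
    · cases t with
      | zero => exact h1 0 hs
      | succ t =>
        have : (t : WithTop ℕ) < s := lt_of_le_of_lt (by exact_mod_cast t.le_succ) hs
        rw [seqIncr, h1 _ hs, h1 _ this, sub_zero]
    · have he : e < (t : WithTop ℕ) := not_le.1 fun hc => ht ⟨hs, hc⟩
      cases t with
      | zero => exact absurd he (by simp)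
      | succ t =>
        have he' : e ≤ (t : WithTop ℕ) := by
          obtain ⟨e, rfl⟩ := exists_natCast_of_le he.le
          have : e < t + 1 := by exact_mod_cast he
          exact_mod_cast Nat.lt_succ_iff.1 this
        rw [seqIncr, h2 t he', sub_self]

lemma seqProj_stopped (hse : s ≤ e) : (∀ t : ℕ, (t : WithTop ℕ) < s → seqProj s e x t = 0) ∧
    ∀ t : ℕ, e ≤ (t : WithTop ℕ) → seqProj s e x (t + 1) = seqProj s e x t :=
  ⟨fun _ => seqProj_of_lt, fun _ => seqProj_succ hse⟩

lemma monotone_of_seqIncr_nonneg (h : ∀ t, 0 ≤ seqIncr x t) : Monotone x :=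
  monotone_nat_of_le_succ fun t => by simpa [seqIncr] using h (t + 1)

lemma nonneg_of_seqIncr_nonneg (h : ∀ t, 0 ≤ seqIncr x t) (t : ℕ) : 0 ≤ x t := by
  rw [← sum_seqIncr x]
  exact Finset.sum_nonneg fun u _ => h u

lemma seqProj_mem (x : ℕ → ℝ) (hse : s ≤ e) (t : ℕ) :
    seqProj s e x t = 0 ∨ ∃ u ≤ t, seqProj s e x t = x u := by
  rcases lt_or_ge (t : WithTop ℕ) s with hs | hs
  · exact Or.inl (seqProj_of_lt hs)
  rcases le_or_gt (t : WithTop ℕ) e with he | he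
  · exact Or.inr ⟨t, le_rfl, seqProj_of_le hs he⟩
  obtain ⟨e, rfl⟩ := exists_natCast_of_le he.le
  have he' : e ≤ t := by exact_mod_cast he.le
  exact Or.inr ⟨e, he', seqProj_of_ge hse he'⟩

lemma seqProj_nonneg_le (hse : s ≤ e) (h : ∀ t, 0 ≤ seqIncr x t) (t : ℕ) :
    0 ≤ seqProj s e x t ∧ seqProj s e x t ≤ x t := by
  rcases seqProj_mem x hse t with h0 | ⟨u, hu, h0⟩ <;> rw [h0]
  · exact ⟨le_rfl, nonneg_of_seqIncr_nonneg h t⟩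
  · exact ⟨nonneg_of_seqIncr_nonneg h u, monotone_of_seqIncr_nonneg h hu⟩

lemma seqIncr_seqProj_nonneg (hse : s ≤ e) (h : ∀ t, 0 ≤ seqIncr x t) (t : ℕ) :
    0 ≤ seqIncr (seqProj s e x) t := by
  cases t with
  | zero => exact (seqProj_nonneg_le hse h 0).1
  | succ t =>
    rw [seqIncr, sub_nonneg]
    rcases lt_or_ge (t : WithTop ℕ) s with hs | hs
    · rw [seqProj_of_lt hs]
      exact (seqProj_nonneg_le hse h _).1
    rcases le_or_gt e (t : WithTop ℕ) with he | he
    · rw [seqProj_succ hse he]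
    · have h1 : (t : WithTop ℕ) ≤ (t + 1 : ℕ) := by exact_mod_cast t.le_succ
      have h2 : ((t + 1 : ℕ) : WithTop ℕ) ≤ e := by
        induction e using WithTop.recTopCoe with
        | top => exact le_top
        | coe e =>
          rw [← Nat.cast_withTop] at he ⊢
          exact_mod_cast he
      rw [seqProj_of_le hs he.le, seqProj_of_le (hs.trans h1) h2]
      exact monotone_of_seqIncr_nonneg h t.le_succ

/-- With non-negative increments the variation up to time t is just the value at t, and projecting
does not raise values. -/
lemma tsum_enorm_seqIncr_seqProj_le (hse : s ≤ e) (h : ∀ t, 0 ≤ seqIncr x t) :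
    ∑' t, ‖seqIncr (seqProj s e x) t‖ₑ ≤ ∑' t, ‖seqIncr x t‖ₑ := by
  have hsum : ∀ y : ℕ → ℝ, (∀ t, 0 ≤ seqIncr y t) → ∀ t,
      ∑ u ∈ Finset.range (t + 1), ‖seqIncr y u‖ₑ = ENNReal.ofReal (y t) := fun y hy t => by
    rw [← sum_seqIncr y t, ENNReal.ofReal_sum_of_nonneg fun u _ => hy u]
    exact Finset.sum_congr rfl fun u _ => Real.enorm_eq_ofReal (hy u)
  rw [ENNReal.tsum_eq_iSup_nat]
  refine iSup_le fun n => ?_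
  refine le_trans ?_ (ENNReal.sum_le_tsum (Finset.range (n + 1)))
  refine (Finset.sum_le_sum_of_subset (Finset.range_mono n.le_succ)).trans ?_
  rw [hsum _ (seqIncr_seqProj_nonneg hse h), hsum x h]
  exact ENNReal.ofReal_le_ofReal (seqProj_nonneg_le hse h n).2

end Sequences

section SubSigmaAlgebra

variable {Ω : Type*} {m mΩ : MeasurableSpace Ω} {P : Measure Ω}

lemma aestronglyMeasurable_mk {f : Ω → ℝ} {hf : AEStronglyMeasurable f P}
    (h : AEStronglyMeasurable[m] f P) : AEStronglyMeasurable[m] (AEEqFun.mk f hf) P :=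
  h.congr (AEEqFun.coeFn_mk f hf).symm

lemma aestronglyMeasurable_add {f g : Ω →ₘ[P] ℝ}
    (hf : AEStronglyMeasurable[m] f P) (hg : AEStronglyMeasurable[m] g P) :
    AEStronglyMeasurable[m] (f + g : Ω →ₘ[P] ℝ) P :=
  (hf.add hg).congr (AEEqFun.coeFn_add f g).symm

lemma aestronglyMeasurable_sub {f g : Ω →ₘ[P] ℝ}
    (hf : AEStronglyMeasurable[m] f P) (hg : AEStronglyMeasurable[m] g P) :
    AEStronglyMeasurable[m] (f - g : Ω →ₘ[P] ℝ) P :=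
  (hf.sub hg).congr (AEEqFun.coeFn_sub f g).symm

lemma aestronglyMeasurable_mul {f g : Ω →ₘ[P] ℝ}
    (hf : AEStronglyMeasurable[m] f P) (hg : AEStronglyMeasurable[m] g P) :
    AEStronglyMeasurable[m] (f * g : Ω →ₘ[P] ℝ) P :=
  (hf.mul hg).congr (AEEqFun.coeFn_mul f g).symm

end SubSigmaAlgebra

/-! ### Pointwise readings of processes, and adaptedness -/

section ProcessBasics

variable {Ω : Type*} {mΩ : MeasurableSpace Ω} {P : Measure Ω} {ℱ : Filtration ℕ mΩ}
  {τ θ : Ω → WithTop ℕ}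

lemma process_ext {X Y : Process0 P} (h : ∀ᵐ ω ∂P, ∀ t, X t ω = Y t ω) : X = Y :=
  funext fun t => AEEqFun.ext (h.mono fun _ hω => hω t)

lemma process_le_iff {X Y : Process0 P} : X ≤ Y ↔ ∀ᵐ ω ∂P, ∀ t, X t ω ≤ Y t ω := by
  rw [ae_all_iff]
  exact forall_congr' fun t => AEEqFun.coeFn_le.symm

lemma coeFn_process_add (X Y : Process0 P) : ∀ᵐ ω ∂P, ∀ t, (X + Y) t ω = X t ω + Y t ω :=
  ae_all_iff.2 fun t => AEEqFun.coeFn_add (X t) (Y t)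

lemma coeFn_process_zero : ∀ᵐ ω ∂P, ∀ t, (0 : Process0 P) t ω = 0 :=
  ae_all_iff.2 fun _ => AEEqFun.coeFn_zero

lemma coeFn_process_one : ∀ᵐ ω ∂P, ∀ t, (1 : Process0 P) t ω = 1 :=
  ae_all_iff.2 fun _ => AEEqFun.coeFn_one

lemma coeFn_scale (f : Ω →ₘ[P] ℝ) (X : Process0 P) :
    ∀ᵐ ω ∂P, ∀ t, scale f X t ω = f ω * X t ω :=
  ae_all_iff.2 fun t => AEEqFun.coeFn_mul f (X t)

lemma coeFn_incr (a : Process0 P) :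
    ∀ᵐ ω ∂P, ∀ t, incr a t ω = seqIncr (fun s => a s ω) t :=
  ae_all_iff.2 fun t => by
    cases t with
    | zero => exact Eventually.of_forall fun ω => rfl
    | succ t => exact AEEqFun.coeFn_sub (a (t + 1)) (a t)

lemma coeFn_proj (hτ : IsStoppingTime ℱ τ) (hθ : IsStoppingTime ℱ θ) (X : Process0 P) :
    ∀ᵐ ω ∂P, ∀ t, proj hτ hθ X t ω = seqProj (τ ω) (θ ω) (fun s => X s ω) t := by
  refine ae_all_iff.2 fun t => ?_
  filter_upwards [AEEqFun.coeFn_mk (μ := P)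
    ({ω | τ ω ≤ (t : WithTop ℕ)}.indicator (stoppedProcess (fun s ω => X s ω) θ t))
    ((measurable_stopped (fun s => (X s).measurable) hθ t).indicator
      (measurableSet_le_time hτ t)).aestronglyMeasurable] with ω h
  rw [proj, h]
  by_cases hω : τ ω ≤ (t : WithTop ℕ)
  · rw [Set.indicator_of_mem (by exact hω), seqProj, if_pos hω, stoppedProcess]
    rfl
  · rw [Set.indicator_of_notMem (by exact hω), seqProj, if_neg hω]

lemma coeFn_indFrom (hτ : IsStoppingTime ℱ τ) :
    ∀ᵐ ω ∂P, ∀ t : ℕ, indFrom P hτ t ω = if τ ω ≤ (t : WithTop ℕ) then 1 else 0 := by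
  refine ae_all_iff.2 fun t => ?_
  filter_upwards [AEEqFun.coeFn_mk (μ := P) ({ω | τ ω ≤ (t : WithTop ℕ)}.indicator (1 : Ω → ℝ))
    (measurable_one.indicator (measurableSet_le_time hτ t)).aestronglyMeasurable] with ω h
  rw [indFrom, h]
  by_cases hω : τ ω ≤ (t : WithTop ℕ)
  · rw [Set.indicator_of_mem (by exact hω), if_pos hω, Pi.one_apply]
  · rw [Set.indicator_of_notMem (by exact hω), if_neg hω]

lemma coeFn_ind (hτ : IsStoppingTime ℱ τ) {A : Set Ω} (hA : MeasurableSet[hτ.measurableSpace] A) :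
    ∀ᵐ ω ∂P, ind (P := P) hτ hA ω = A.indicator (1 : Ω → ℝ) ω :=
  AEEqFun.coeFn_mk _ _

lemma ind_mem_LInfTau (hτ : IsStoppingTime ℱ τ) {A : Set Ω}
    (hA : MeasurableSet[hτ.measurableSpace] A) : ind hτ hA ∈ LInfTau P hτ := by
  refine ⟨⟨A.indicator 1, ?_, coeFn_ind hτ hA⟩, 1, ?_⟩
  · exact StronglyMeasurable.indicator stronglyMeasurable_one hA
  · filter_upwards [coeFn_ind (P := P) hτ hA] with ω h
    rw [h]
    by_cases hω : ω ∈ A <;> simp [hω]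

lemma ind_nonneg (hτ : IsStoppingTime ℱ τ) {A : Set Ω}
    (hA : MeasurableSet[hτ.measurableSpace] A) : 0 ≤ ind (P := P) hτ hA := by
  rw [← AEEqFun.coeFn_le]
  filter_upwards [coeFn_ind (P := P) hτ hA, AEEqFun.coeFn_zero (β := ℝ) (μ := P)] with ω h h0
  rw [h, h0]
  exact Set.indicator_nonneg (fun _ _ => zero_le_one) _

lemma ind_le_one (hτ : IsStoppingTime ℱ τ) {A : Set Ω}
    (hA : MeasurableSet[hτ.measurableSpace] A) : ind (P := P) hτ hA ≤ 1 := by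
  rw [← AEEqFun.coeFn_le]
  filter_upwards [coeFn_ind (P := P) hτ hA, AEEqFun.coeFn_one (β := ℝ) (μ := P)] with ω h h0
  rw [h, h0]
  exact Set.indicator_le_self' (fun _ _ => zero_le_one) _

lemma coeFn_one_sub (l : Ω →ₘ[P] ℝ) : ∀ᵐ ω ∂P, (1 - l) ω = 1 - l ω := by
  filter_upwards [AEEqFun.coeFn_sub 1 l, AEEqFun.coeFn_one (β := ℝ) (μ := P)] with ω h h0
  rw [h, Pi.sub_apply, h0, Pi.one_apply]

lemma incr_scale (f : Ω →ₘ[P] ℝ) (a : Process0 P) : incr (scale f a) = scale f (incr a) := by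
  funext t
  cases t with
  | zero => rfl
  | succ t =>
    refine AEEqFun.ext ?_
    change ((f * a (t + 1) - f * a t : Ω →ₘ[P] ℝ) : Ω → ℝ) =ᵐ[P]
      (f * (a (t + 1) - a t) : Ω →ₘ[P] ℝ)
    filter_upwards [AEEqFun.coeFn_sub (f * a (t + 1)) (f * a t), AEEqFun.coeFn_mul f (a (t + 1)),
      AEEqFun.coeFn_mul f (a t), AEEqFun.coeFn_mul f (a (t + 1) - a t),
      AEEqFun.coeFn_sub (a (t + 1)) (a t)] with ω h1 h2 h3 h4 h5
    simp only [h1, h2, h3, h4, h5, Pi.sub_apply, Pi.mul_apply, mul_sub]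

lemma incr_add (a b : Process0 P) : incr (a + b) = incr a + incr b := by
  funext t
  cases t with
  | zero => rfl
  | succ t => simp only [incr, Pi.add_apply]; abel

/-- The process with given increments. -/
noncomputable def ofIncr (D : Process0 P) : Process0 P := fun t => ∑ s ∈ Finset.range (t + 1), D s

lemma incr_ofIncr (D : Process0 P) : incr (ofIncr D) = D := by
  funext t
  cases t with
  | zero => simp [incr, ofIncr]
  | succ t => simp [incr, ofIncr, Finset.sum_range_succ _ (t + 1)]

/-! ### Adaptedness -/

lemma aestronglyMeasurable_of_filtration_le {s t : ℕ} (h : s ≤ t) {f : Ω → ℝ}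
    (hf : AEStronglyMeasurable[ℱ s] f P) : AEStronglyMeasurable[ℱ t] f P :=
  hf.mono (ℱ.mono h)

lemma ofIncr_mem_R0 {D : Process0 P} (hD : D ∈ R0 P ℱ) : ofIncr D ∈ R0 P ℱ := fun t => by
  have : ∀ n ≤ t + 1, AEStronglyMeasurable[ℱ t] (∑ s ∈ Finset.range n, D s : Ω →ₘ[P] ℝ) P := by
    intro n hn
    induction n with
    | zero =>
      exact (aestronglyMeasurable_const (b := (0 : ℝ))).congr AEEqFun.coeFn_zero.symm
    | succ n ih =>
      rw [Finset.sum_range_succ]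
      exact aestronglyMeasurable_add (ih (by omega))
        (aestronglyMeasurable_of_filtration_le (by omega) (hD n))
  exact this _ le_rfl

lemma incr_mem_R0 {a : Process0 P} (ha : a ∈ R0 P ℱ) : incr a ∈ R0 P ℱ := by
  intro t
  cases t with
  | zero => exact ha 0
  | succ t =>
    exact aestronglyMeasurable_sub (ha (t + 1))
      (aestronglyMeasurable_of_filtration_le t.le_succ (ha t))

lemma measurableSet_inter_le_of_tau (hτ : IsStoppingTime ℱ τ) {A : Set Ω}
    (hA : MeasurableSet[hτ.measurableSpace] A) (t : ℕ) :
    MeasurableSet[ℱ t] (A ∩ {ω | τ ω ≤ (t : WithTop ℕ)}) :=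
  ((hτ.measurableSet A).1 hA).2 t

/-- This is the defining property of F_τ: its events become F_t-measurable once intersected with {τ
≤ t}. -/
lemma aestronglyMeasurable_indicator_le (hτ : IsStoppingTime ℱ τ) {f : Ω → ℝ}
    (hf : AEStronglyMeasurable[hτ.measurableSpace] f P) (t : ℕ) :
    AEStronglyMeasurable[ℱ t] ({ω | τ ω ≤ (t : WithTop ℕ)}.indicator f) P := by
  obtain ⟨g, hg, hfg⟩ := hf
  refine ⟨{ω | τ ω ≤ (t : WithTop ℕ)}.indicator g, ?_, ?_⟩
  · refine Measurable.stronglyMeasurable fun B hB => ?_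
    classical
    rw [Set.indicator_preimage]
    exact (measurableSet_inter_le_of_tau hτ (hg.measurable hB) t).union
      ((measurable_const hB).diff (hτ t))
  · filter_upwards [hfg] with ω h
    by_cases hω : ω ∈ {ω | τ ω ≤ (t : WithTop ℕ)}
    · rw [Set.indicator_of_mem hω, Set.indicator_of_mem hω, h]
    · rw [Set.indicator_of_notMem hω, Set.indicator_of_notMem hω]

end ProcessBasics

/-! ### The projected space as the bounded processes stopped on [τ, θ] -/

section Membership

variable {Ω : Type*} {mΩ : MeasurableSpace Ω} {P : Measure Ω} {ℱ : Filtration ℕ mΩ}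
  {τ θ : Ω → WithTop ℕ}

/-- `X` vanishes before `τ` and is constant from `θ` on. -/
def IsStopped (τ θ : Ω → WithTop ℕ) (X : Process0 P) : Prop :=
  ∀ᵐ ω ∂P, (∀ t : ℕ, (t : WithTop ℕ) < τ ω → X t ω = 0) ∧
    ∀ t : ℕ, θ ω ≤ (t : WithTop ℕ) → X (t + 1) ω = X t ω

lemma proj_mem_R0 (hτ : IsStoppingTime ℱ τ) (hθ : IsStoppingTime ℱ θ) {X : Process0 P}
    (hX : X ∈ R0 P ℱ) : proj hτ hθ X ∈ R0 P ℱ := by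
  choose Y hYm hXY using hX
  intro t
  have h1 : StronglyMeasurable[ℱ t]
      ({ω | τ ω ≤ (t : WithTop ℕ)}.indicator (stoppedProcess Y θ t)) :=
    (StronglyAdapted.stoppedProcess_of_discrete (f := ℱ) (u := Y) hYm hθ t).indicator (hτ t)
  refine ⟨_, h1, ?_⟩
  filter_upwards [AEEqFun.coeFn_mk (μ := P)
    ({ω | τ ω ≤ (t : WithTop ℕ)}.indicator (stoppedProcess (fun s ω => X s ω) θ t))
    ((measurable_stopped (fun s => (X s).measurable) hθ t).indicator
      (measurableSet_le_time hτ t)).aestronglyMeasurable, ae_all_iff.2 hXY] with ω h h2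
  rw [proj, h]
  by_cases hω : ω ∈ {ω | τ ω ≤ (t : WithTop ℕ)}
  · rw [Set.indicator_of_mem hω, Set.indicator_of_mem hω, stoppedProcess, stoppedProcess, h2]
  · rw [Set.indicator_of_notMem hω, Set.indicator_of_notMem hω]

lemma isStopped_proj (hτ : IsStoppingTime ℱ τ) (hθ : IsStoppingTime ℱ θ)
    (hτθ : ∀ᵐ ω ∂P, τ ω ≤ θ ω) (X : Process0 P) : IsStopped τ θ (proj hτ hθ X) := by
  filter_upwards [coeFn_proj hτ hθ X, hτθ] with ω h hle
  simp only [h]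
  exact seqProj_stopped hle

lemma proj_eq_self (hτ : IsStoppingTime ℱ τ) (hθ : IsStoppingTime ℱ θ)
    (hτθ : ∀ᵐ ω ∂P, τ ω ≤ θ ω) {X : Process0 P} (hX : IsStopped τ θ X) : proj hτ hθ X = X := by
  refine process_ext ?_
  filter_upwards [coeFn_proj hτ hθ X, hτθ, hX] with ω h hle hω t
  rw [h, ← (eq_seqProj_iff hle).2 hω t]

lemma proj_mem_RInf (hτ : IsStoppingTime ℱ τ) (hθ : IsStoppingTime ℱ θ)
    (hτθ : ∀ᵐ ω ∂P, τ ω ≤ θ ω) {X : Process0 P}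
    (hX : X ∈ RInf P ℱ) : proj hτ hθ X ∈ RInf P ℱ := by
  obtain ⟨hX0, m, hm⟩ := hX
  refine ⟨proj_mem_R0 hτ hθ hX0, m, ?_⟩
  filter_upwards [coeFn_proj hτ hθ X, hm, hτθ] with ω h1 h2 hle t
  rw [h1]
  rcases seqProj_mem (fun s => X s ω) hle t with h | ⟨u, -, h⟩ <;> rw [h]
  · rw [abs_zero]
    exact (abs_nonneg _).trans (h2 0)
  · exact h2 u

/-- Projected processes are stopped, and stopped processes are fixed by the projection. -/
lemma mem_RInfST_iff (hτ : IsStoppingTime ℱ τ) (hθ : IsStoppingTime ℱ θ)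
    (hτθ : ∀ᵐ ω ∂P, τ ω ≤ θ ω) {X : Process0 P} :
    X ∈ RInfST P hτ hθ ↔ X ∈ RInf P ℱ ∧ IsStopped τ θ X := by
  constructor
  · rintro ⟨Y, hY, rfl⟩
    exact ⟨proj_mem_RInf hτ hθ hτθ hY, isStopped_proj hτ hθ hτθ Y⟩
  · rintro ⟨h1, h2⟩
    exact ⟨X, h1, proj_eq_self hτ hθ hτθ h2⟩

/-- The factor is only F_τ-measurable, but it matters at time t only on {τ ≤ t}, since X vanishes
elsewhere, and there it is F_t-measurable. -/
lemma scale_mem_R0 (hτ : IsStoppingTime ℱ τ) {f : Ω →ₘ[P] ℝ}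
    (hf : AEStronglyMeasurable[hτ.measurableSpace] f P) {X : Process0 P} (hX : X ∈ R0 P ℱ)
    (h0 : ∀ᵐ ω ∂P, ∀ t : ℕ, (t : WithTop ℕ) < τ ω → X t ω = 0) : scale f X ∈ R0 P ℱ := by
  intro t
  refine ((aestronglyMeasurable_indicator_le hτ hf t).mul (hX t)).congr ?_
  filter_upwards [coeFn_scale f X, h0] with ω h1 h2
  rw [h1, Pi.mul_apply]
  by_cases hω : τ ω ≤ (t : WithTop ℕ)
  · rw [Set.indicator_of_mem (by exact hω)]
  · rw [h2 t (not_le.1 hω), mul_zero, mul_zero]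

lemma add_mem_R0 {X Y : Process0 P} (hX : X ∈ R0 P ℱ) (hY : Y ∈ R0 P ℱ) : X + Y ∈ R0 P ℱ :=
  fun t => aestronglyMeasurable_add (hX t) (hY t)

lemma add_mem_RInf {X Y : Process0 P} (hX : X ∈ RInf P ℱ) (hY : Y ∈ RInf P ℱ) :
    X + Y ∈ RInf P ℱ := by
  obtain ⟨hX, c, hc⟩ := hX
  obtain ⟨hY, d, hd⟩ := hY
  refine ⟨add_mem_R0 hX hY, c + d, ?_⟩
  filter_upwards [hc, hd, coeFn_process_add X Y] with ω h1 h2 h3 t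
  rw [h3]
  exact (abs_add_le _ _).trans (add_le_add (h1 t) (h2 t))

lemma IsStopped.add {X Y : Process0 P} (hX : IsStopped τ θ X) (hY : IsStopped τ θ Y) :
    IsStopped τ θ (X + Y) := by
  filter_upwards [hX, hY, coeFn_process_add X Y] with ω h1 h2 h3
  refine ⟨fun t ht => ?_, fun t ht => ?_⟩
  · rw [h3, h1.1 t ht, h2.1 t ht, add_zero]
  · rw [h3, h3, h1.2 t ht, h2.2 t ht]

lemma IsStopped.scale (f : Ω →ₘ[P] ℝ) {X : Process0 P} (hX : IsStopped τ θ X) :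
    IsStopped τ θ (scale f X) := by
  filter_upwards [hX, coeFn_scale f X] with ω h1 h3
  refine ⟨fun t ht => ?_, fun t ht => ?_⟩
  · rw [h3, h1.1 t ht, mul_zero]
  · rw [h3, h3, h1.2 t ht]

lemma scale_mem_RInf (hτ : IsStoppingTime ℱ τ) {f : Ω →ₘ[P] ℝ}
    (hf : f ∈ LInfTau P hτ) {X : Process0 P} (hX : X ∈ RInf P ℱ)
    (h0 : ∀ᵐ ω ∂P, ∀ t : ℕ, (t : WithTop ℕ) < τ ω → X t ω = 0) : scale f X ∈ RInf P ℱ := by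
  obtain ⟨hX, c, hc⟩ := hX
  obtain ⟨hf, d, hd⟩ := hf
  refine ⟨scale_mem_R0 hτ hf hX h0, d * c, ?_⟩
  filter_upwards [hc, hd, coeFn_scale f X] with ω h1 h2 h3 t
  rw [h3, abs_mul]
  exact mul_le_mul h2 (h1 t) (abs_nonneg _) ((abs_nonneg _).trans h2)

variable {hτ : IsStoppingTime ℱ τ} {hθ : IsStoppingTime ℱ θ}

lemma add_mem_RInfST (hτθ : ∀ᵐ ω ∂P, τ ω ≤ θ ω) {X Y : Process0 P}
    (hX : X ∈ RInfST P hτ hθ) (hY : Y ∈ RInfST P hτ hθ) : X + Y ∈ RInfST P hτ hθ := by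
  rw [mem_RInfST_iff hτ hθ hτθ] at *
  exact ⟨add_mem_RInf hX.1 hY.1, hX.2.add hY.2⟩

lemma scale_mem_RInfST (hτθ : ∀ᵐ ω ∂P, τ ω ≤ θ ω) {f : Ω →ₘ[P] ℝ} (hf : f ∈ LInfTau P hτ)
    {X : Process0 P} (hX : X ∈ RInfST P hτ hθ) : scale f X ∈ RInfST P hτ hθ := by
  rw [mem_RInfST_iff hτ hθ hτθ] at *
  exact ⟨scale_mem_RInf hτ hf hX.1 (hX.2.mono fun ω h => h.1), hX.2.scale f⟩

lemma zero_mem_RInfST (hτθ : ∀ᵐ ω ∂P, τ ω ≤ θ ω) : (0 : Process0 P) ∈ RInfST P hτ hθ := by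
  rw [mem_RInfST_iff hτ hθ hτθ]
  refine ⟨⟨fun t => ?_, 0, ?_⟩, ?_⟩
  · exact (aestronglyMeasurable_const (b := (0 : ℝ))).congr AEEqFun.coeFn_zero.symm
  · filter_upwards [coeFn_process_zero (P := P)] with ω h t
    rw [h, abs_zero]
  · filter_upwards [coeFn_process_zero (P := P)] with ω h
    exact ⟨fun t _ => h t, fun t _ => by rw [h, h]⟩

lemma indFrom_mem_RInfST (hτθ : ∀ᵐ ω ∂P, τ ω ≤ θ ω) : indFrom P hτ ∈ RInfST P hτ hθ := by
  rw [mem_RInfST_iff hτ hθ hτθ]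
  refine ⟨⟨fun t => ?_, 1, ?_⟩, ?_⟩
  · refine ⟨{ω | τ ω ≤ (t : WithTop ℕ)}.indicator 1, ?_, AEEqFun.coeFn_mk _ _⟩
    exact StronglyMeasurable.indicator stronglyMeasurable_one (hτ t)
  · filter_upwards [coeFn_indFrom (P := P) hτ] with ω h t
    rw [h]
    split_ifs <;> simp
  · filter_upwards [coeFn_indFrom (P := P) hτ, hτθ] with ω h hle
    refine ⟨fun t ht => by rw [h, if_neg ht.not_ge], fun t ht => ?_⟩
    have h1 : τ ω ≤ (t : WithTop ℕ) := hle.trans ht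
    rw [h, h, if_pos h1, if_pos (h1.trans (by exact_mod_cast t.le_succ))]

variable (P) in
/-- A constant random variable. -/
noncomputable def constRV (c : ℝ) : Ω →ₘ[P] ℝ := AEEqFun.const Ω c

lemma coeFn_constRV (c : ℝ) : ∀ᵐ ω ∂P, constRV P c ω = c := AEEqFun.coeFn_const Ω c

lemma constRV_mem_LInfTau (c : ℝ) : constRV P c ∈ LInfTau P hτ := by
  refine ⟨⟨fun _ => c, stronglyMeasurable_const, coeFn_constRV c⟩, |c|, ?_⟩
  filter_upwards [coeFn_constRV (P := P) c] with ω h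
  rw [h]

lemma sub_mem_LInfTau {f g : Ω →ₘ[P] ℝ} (hf : f ∈ LInfTau P hτ) (hg : g ∈ LInfTau P hτ) :
    f - g ∈ LInfTau P hτ := by
  obtain ⟨hf, c, hc⟩ := hf
  obtain ⟨hg, d, hd⟩ := hg
  refine ⟨aestronglyMeasurable_sub hf hg, c + d, ?_⟩
  filter_upwards [hc, hd, AEEqFun.coeFn_sub f g] with ω h1 h2 h3
  rw [h3]
  exact (abs_sub _ _).trans (add_le_add h1 h2)

lemma one_mem_LInfTau : (1 : Ω →ₘ[P] ℝ) ∈ LInfTau P hτ := constRV_mem_LInfTau 1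

lemma mul_mem_LInfTau {f g : Ω →ₘ[P] ℝ} (hf : f ∈ LInfTau P hτ) (hg : g ∈ LInfTau P hτ) :
    f * g ∈ LInfTau P hτ := by
  obtain ⟨hf, c, hc⟩ := hf
  obtain ⟨hg, d, hd⟩ := hg
  refine ⟨aestronglyMeasurable_mul hf hg, c * d, ?_⟩
  filter_upwards [hc, hd, AEEqFun.coeFn_mul f g] with ω h1 h2 h3
  rw [h3, Pi.mul_apply, abs_mul]
  exact mul_le_mul h1 h2 (abs_nonneg _) ((abs_nonneg _).trans h1)

end Membership

/-! ### The pairing sum and processes of integrable variation -/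

section Pairing

variable {Ω : Type*} {mΩ : MeasurableSpace Ω} {P : Measure Ω} {ℱ : Filtration ℕ mΩ}
  {τ θ : Ω → WithTop ℕ}

/-- `∑ₜ Xₜ Δaₜ`. -/
noncomputable def totalSum (X a : Process0 P) (ω : Ω) : ℝ := ∑' t, X t ω * incr a t ω

/-- The increments of `a` vanish off `[τ, θ]`. -/
def SupportedOn (τ θ : Ω → WithTop ℕ) (a : Process0 P) : Prop :=
  ∀ᵐ ω ∂P, ∀ t : ℕ, ¬ (τ ω ≤ (t : WithTop ℕ) ∧ (t : WithTop ℕ) ≤ θ ω) → incr a t ω = 0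

/-- The total variation `∑ₜ |Δaₜ|`. -/
noncomputable def variation (a : Process0 P) (ω : Ω) : ℝ := ∑' t, |incr a t ω|

lemma measurable_totalSum (X a : Process0 P) : Measurable (totalSum X a) :=
  Measurable.tsum fun t => (X t).measurable.mul (incr a t).measurable

lemma measurable_variation (a : Process0 P) : Measurable (variation a) :=
  Measurable.tsum fun t => (incr a t).measurable.abs

lemma ae_summable_of_mem_A1 {a : Process0 P} (ha : a ∈ A1 P ℱ) :
    ∀ᵐ ω ∂P, Summable fun t => |incr a t ω| := by
  have hm : Measurable fun ω => ∑' t, ‖incr a t ω‖ₑ :=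
    Measurable.tsum fun t => (incr a t).measurable.enorm
  filter_upwards [ae_lt_top hm ha.2.ne] with ω h
  have := ENNReal.summable_toReal h.ne
  simpa using this

lemma integrable_variation {a : Process0 P} (ha : a ∈ A1 P ℱ) : Integrable (variation a) P := by
  have hm : Measurable fun ω => ∑' t, ‖incr a t ω‖ₑ :=
    Measurable.tsum fun t => (incr a t).measurable.enorm
  refine (integrable_toReal_of_lintegral_ne_top hm.aemeasurable ha.2.ne).congr ?_
  filter_upwards [ae_lt_top hm ha.2.ne] with ω h
  rw [ENNReal.tsum_toReal_eq fun t => enorm_ne_top]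
  simp [variation]

/-- Summability is a separate hypothesis because the real series `variation` takes the default value
0 where it diverges. -/
lemma mem_A1_of_integral {a : Process0 P} (ha : a ∈ R0 P ℱ)
    (hs : ∀ᵐ ω ∂P, Summable fun t => |incr a t ω|) (hi : Integrable (variation a) P) :
    a ∈ A1 P ℱ := by
  refine ⟨ha, ?_⟩
  have h : ∫⁻ ω, ∑' t, ‖incr a t ω‖ₑ ∂P = ∫⁻ ω, ‖variation a ω‖ₑ ∂P := by
    refine lintegral_congr_ae ?_
    filter_upwards [hs] with ω hω
    rw [variation, Real.enorm_eq_ofReal (tsum_nonneg fun t => abs_nonneg _),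
      ENNReal.ofReal_tsum_of_nonneg (fun t => abs_nonneg _) hω]
    simp [Real.enorm_eq_ofReal_abs]
  rw [h]
  exact hi.2

section Bounded

variable {X a : Process0 P} {c : ℝ}

lemma ae_totalSum_bound (ha : a ∈ A1 P ℱ) (hX : ∀ᵐ ω ∂P, ∀ t, |X t ω| ≤ c) :
    ∀ᵐ ω ∂P, Summable (fun t => X t ω * incr a t ω) ∧ |totalSum X a ω| ≤ c * variation a ω := by
  filter_upwards [ae_summable_of_mem_A1 ha, hX] with ω h1 h2
  have hle : ∀ t, ‖X t ω * incr a t ω‖ ≤ c * |incr a t ω| := fun t => by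
    rw [norm_mul]
    exact mul_le_mul_of_nonneg_right (h2 t) (abs_nonneg _)
  refine ⟨Summable.of_norm_bounded (h1.mul_left c) hle, ?_⟩
  exact tsum_of_norm_bounded (h1.mul_left c).hasSum hle |>.trans (by rw [tsum_mul_left]; rfl)

lemma integrable_totalSum (ha : a ∈ A1 P ℱ) (hX : ∀ᵐ ω ∂P, ∀ t, |X t ω| ≤ c) :
    Integrable (totalSum X a) P := by
  refine ((integrable_variation ha).const_mul c).mono'
    (measurable_totalSum X a).aestronglyMeasurable ?_
  filter_upwards [ae_totalSum_bound ha hX] with ω h using h.2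

lemma integrable_totalSum_of_mem (ha : a ∈ A1 P ℱ) (hX : X ∈ RInf P ℱ) :
    Integrable (totalSum X a) P := by
  obtain ⟨-, c, hc⟩ := hX
  exact integrable_totalSum ha hc

lemma ae_summable_of_mem (ha : a ∈ A1 P ℱ) (hX : X ∈ RInf P ℱ) :
    ∀ᵐ ω ∂P, Summable (fun t => X t ω * incr a t ω) := by
  obtain ⟨-, c, hc⟩ := hX
  filter_upwards [ae_totalSum_bound ha hc] with ω h using h.1

end Bounded

lemma totalSum_add_left {X Y a : Process0 P} (ha : a ∈ A1 P ℱ) (hX : X ∈ RInf P ℱ)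
    (hY : Y ∈ RInf P ℱ) : totalSum (X + Y) a =ᵐ[P] totalSum X a + totalSum Y a := by
  filter_upwards [ae_summable_of_mem ha hX, ae_summable_of_mem ha hY, coeFn_process_add X Y]
    with ω h1 h2 h3
  rw [Pi.add_apply]
  simp only [totalSum, h3, add_mul]
  exact h1.tsum_add h2

lemma totalSum_add_right {X a b : Process0 P} (ha : a ∈ A1 P ℱ) (hb : b ∈ A1 P ℱ)
    (hX : X ∈ RInf P ℱ) : totalSum X (a + b) =ᵐ[P] totalSum X a + totalSum X b := by
  filter_upwards [ae_summable_of_mem ha hX, ae_summable_of_mem hb hX,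
    coeFn_process_add (incr a) (incr b)] with ω h1 h2 h3
  rw [Pi.add_apply]
  simp only [totalSum, incr_add, h3, mul_add]
  exact h1.tsum_add h2

lemma totalSum_scale_left (f : Ω →ₘ[P] ℝ) (X a : Process0 P) :
    totalSum (scale f X) a =ᵐ[P] fun ω => f ω * totalSum X a ω := by
  filter_upwards [coeFn_scale f X] with ω h
  simp only [totalSum, h, mul_assoc, tsum_mul_left]

lemma totalSum_scale_right (f : Ω →ₘ[P] ℝ) (X a : Process0 P) :
    totalSum X (scale f a) =ᵐ[P] fun ω => f ω * totalSum X a ω := by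
  filter_upwards [coeFn_scale f (incr a)] with ω h
  simp only [totalSum, incr_scale, h, ← tsum_mul_left]
  exact tsum_congr fun t => by ring

lemma incr_nonneg_iff {a : Process0 P} :
    (∀ t, 0 ≤ incr a t) ↔ ∀ᵐ ω ∂P, ∀ t, 0 ≤ incr a t ω := by
  rw [ae_all_iff]
  refine forall_congr' fun t => ?_
  rw [← AEEqFun.coeFn_le]
  refine eventually_congr ?_
  filter_upwards [AEEqFun.coeFn_zero (β := ℝ) (μ := P)] with ω h
  rw [h, Pi.zero_apply]

lemma totalSum_mono {X Y a : Process0 P} (ha : a ∈ A1 P ℱ) (hX : X ∈ RInf P ℱ)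
    (hY : Y ∈ RInf P ℱ) (ha0 : ∀ t, 0 ≤ incr a t) (hXY : X ≤ Y) :
    totalSum X a ≤ᵐ[P] totalSum Y a := by
  filter_upwards [ae_summable_of_mem ha hX, ae_summable_of_mem ha hY, process_le_iff.1 hXY,
    incr_nonneg_iff.1 ha0] with ω h1 h2 h3 h4
  exact h1.tsum_le_tsum (fun t => mul_le_mul_of_nonneg_right (h3 t) (h4 t)) h2

lemma totalSum_congr {X Y a : Process0 P}
    (h : ∀ᵐ ω ∂P, ∀ t, incr a t ω ≠ 0 → X t ω = Y t ω) : totalSum X a =ᵐ[P] totalSum Y a := by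
  filter_upwards [h] with ω hω
  refine tsum_congr fun t => ?_
  by_cases h0 : incr a t ω = 0
  · rw [h0, mul_zero, mul_zero]
  · rw [hω t h0]

lemma SupportedOn.scale {a : Process0 P} (ha : SupportedOn τ θ a) (f : Ω →ₘ[P] ℝ) :
    SupportedOn τ θ (scale f a) := by
  filter_upwards [ha, coeFn_scale f (incr a)] with ω h1 h2 t ht
  rw [incr_scale, h2, h1 t ht, mul_zero]

lemma SupportedOn.add {a b : Process0 P} (ha : SupportedOn τ θ a) (hb : SupportedOn τ θ b) :
    SupportedOn τ θ (a + b) := by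
  filter_upwards [ha, hb, coeFn_process_add (incr a) (incr b)] with ω h1 h2 h3 t ht
  rw [incr_add, h3, h1 t ht, h2 t ht, add_zero]

lemma supportedOn_iff (hτθ : ∀ᵐ ω ∂P, τ ω ≤ θ ω) {a : Process0 P} :
    SupportedOn τ θ a ↔ IsStopped τ θ a := by
  refine eventually_congr ?_
  filter_upwards [hτθ, coeFn_incr a] with ω hle h
  simp only [h]
  exact seqIncr_eq_zero_iff hle

lemma add_mem_A1 {a b : Process0 P} (ha : a ∈ A1 P ℱ) (hb : b ∈ A1 P ℱ) : a + b ∈ A1 P ℱ := by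
  have hae := coeFn_process_add (incr a) (incr b)
  refine mem_A1_of_integral (add_mem_R0 ha.1 hb.1) ?_ ?_
  · filter_upwards [ae_summable_of_mem_A1 ha, ae_summable_of_mem_A1 hb, hae] with ω h1 h2 h3
    refine Summable.of_nonneg_of_le (fun t => abs_nonneg _) (fun t => ?_) (h1.add h2)
    rw [incr_add, h3]
    exact abs_add_le _ _
  · refine ((integrable_variation ha).add (integrable_variation hb)).mono'
      (measurable_variation _).aestronglyMeasurable ?_
    filter_upwards [ae_summable_of_mem_A1 ha, ae_summable_of_mem_A1 hb, hae] with ω h1 h2 h3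
    rw [Pi.add_apply, variation, variation, variation, ← h1.tsum_add h2,
      Real.norm_of_nonneg (tsum_nonneg fun t => abs_nonneg _)]
    refine Summable.tsum_le_tsum (fun t => ?_) ?_ (h1.add h2)
    · rw [incr_add, h3]
      exact abs_add_le _ _
    · refine Summable.of_nonneg_of_le (fun t => abs_nonneg _) (fun t => ?_) (h1.add h2)
      rw [incr_add, h3]
      exact abs_add_le _ _

/-- The factor may be unbounded; this is needed for the reciprocal of a conditional mass. -/
lemma scale_mem_A1_of_integrable (hτ : IsStoppingTime ℱ τ) {f : Ω →ₘ[P] ℝ}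
    (hf : AEStronglyMeasurable[hτ.measurableSpace] f P) {a : Process0 P} (ha : a ∈ A1 P ℱ)
    (h0 : ∀ᵐ ω ∂P, ∀ t : ℕ, (t : WithTop ℕ) < τ ω → a t ω = 0)
    (hi : Integrable (fun ω => f ω * variation a ω) P) : scale f a ∈ A1 P ℱ := by
  have hae := coeFn_scale f (incr a)
  refine mem_A1_of_integral (scale_mem_R0 hτ hf ha.1 h0) ?_ ?_
  · filter_upwards [ae_summable_of_mem_A1 ha, hae] with ω h1 h2
    simp only [incr_scale, h2, abs_mul]
    exact h1.mul_left _
  · refine hi.norm.congr ?_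
    filter_upwards [hae] with ω h2
    simp only [variation, incr_scale, h2, abs_mul, tsum_mul_left, norm_mul, Real.norm_eq_abs]
    rw [abs_of_nonneg (tsum_nonneg fun t => abs_nonneg (incr a t ω))]

lemma scale_mem_A1 (hτ : IsStoppingTime ℱ τ) {f : Ω →ₘ[P] ℝ} (hf : f ∈ LInfTau P hτ)
    {a : Process0 P} (ha : a ∈ A1 P ℱ)
    (h0 : ∀ᵐ ω ∂P, ∀ t : ℕ, (t : WithTop ℕ) < τ ω → a t ω = 0) : scale f a ∈ A1 P ℱ := by
  obtain ⟨c, hc⟩ := hf.2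
  exact scale_mem_A1_of_integrable hτ hf.1 ha h0
    ((integrable_variation ha).bdd_mul f.aestronglyMeasurable hc)

end Pairing

section SubSigmaAlgebra

variable {Ω : Type*} {m mΩ : MeasurableSpace Ω} {P : Measure Ω}

/-- Test on the event where an m-measurable version is negative: it belongs to m, and an integral
over it can be non-negative only if it is null. -/
lemma ae_nonneg_of_setIntegral_nonneg (hm : m ≤ mΩ) {f : Ω → ℝ}
    (hf : AEStronglyMeasurable[m] f P) (hi : Integrable f P)
    (h : ∀ B, MeasurableSet[m] B → 0 ≤ ∫ ω in B, f ω ∂P) : ∀ᵐ ω ∂P, 0 ≤ f ω := by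
  obtain ⟨g, hg, hfg⟩ := hf
  have hB : MeasurableSet[m] {ω | g ω < 0} :=
    measurableSet_lt hg.measurable measurable_const
  have h1 := h _ hB
  rw [integral_congr_ae (ae_restrict_of_ae hfg)] at h1
  have hgi : Integrable g P := hi.congr hfg
  have h2 : ∀ᵐ ω ∂P.restrict {ω | g ω < 0}, 0 ≤ -g ω := by
    filter_upwards [ae_restrict_mem (hm _ hB)] with ω hω
    exact neg_nonneg.2 (le_of_lt hω)
  have h3 : ∫ ω in {ω | g ω < 0}, -g ω ∂P = 0 :=
    le_antisymm (by rw [integral_neg]; linarith) (integral_nonneg_of_ae h2)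
  rw [integral_eq_zero_iff_of_nonneg_ae h2 hgi.neg.integrableOn,
    EventuallyEq, ae_restrict_iff' (hm _ hB)] at h3
  filter_upwards [h3, hfg] with ω h4 h5
  rw [h5]
  by_contra! hc
  have := h4 hc
  simp only [Pi.zero_apply, neg_eq_zero] at this
  exact hc.ne this

end SubSigmaAlgebra

/-! ### The conditional pairing -/

section CondPairing

variable {Ω : Type*} {mΩ : MeasurableSpace Ω} {P : Measure Ω}
  {ℱ : Filtration ℕ mΩ} {τ θ : Ω → WithTop ℕ} (hτ : IsStoppingTime ℱ τ)

/-- When the increments live on [τ, θ], the cut-off in the definition changes nothing, so the full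
sum may be conditioned. -/
lemma coeFn_condPairing {a : Process0 P} (ha : SupportedOn τ θ a) (X : Process0 P) :
    condPairing hτ θ X a =ᵐ[P] P[totalSum X a | hτ.measurableSpace] := by
  refine (AEEqFun.coeFn_mk _ _).trans (condExp_congr_ae ?_)
  filter_upwards [ha] with ω h
  refine tsum_congr fun t => ?_
  by_cases ht : τ ω ≤ (t : WithTop ℕ) ∧ (t : WithTop ℕ) ≤ θ ω
  · rw [Set.indicator_of_mem (by exact ht)]
  · rw [Set.indicator_of_notMem (by exact ht), h t ht, mul_zero]

lemma aestronglyMeasurable_condPairing (X a : Process0 P) :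
    AEStronglyMeasurable[hτ.measurableSpace] (condPairing hτ θ X a) P :=
  ⟨_, stronglyMeasurable_condExp, AEEqFun.coeFn_mk _ _⟩

lemma integrable_condPairing (X a : Process0 P) : Integrable (condPairing hτ θ X a) P :=
  integrable_condExp.congr (AEEqFun.coeFn_mk _ _).symm

variable {hτ} {X Y a b : Process0 P} {f : Ω →ₘ[P] ℝ}

/-- An event of F_τ can be absorbed into either argument of the pairing. Conditional statements
thereby become families of scalar ones, to which the weak topologies apply. -/
lemma setIntegral_totalSum_eq_pairing_left {B : Set Ω}
    (hB : MeasurableSet[hτ.measurableSpace] B) :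
    ∫ ω in B, totalSum X a ω ∂P = pairing (scale (ind hτ hB) X) a := by
  rw [← integral_indicator (hτ.measurableSpace_le _ hB)]
  refine integral_congr_ae ?_
  filter_upwards [totalSum_scale_left (ind hτ hB) X a, coeFn_ind (P := P) hτ hB] with ω h1 h2
  refine Eq.trans ?_ h1.symm
  rw [h2]
  by_cases hω : ω ∈ B <;> simp [hω]

lemma setIntegral_totalSum_eq_pairing_right {B : Set Ω}
    (hB : MeasurableSet[hτ.measurableSpace] B) :
    ∫ ω in B, totalSum X a ω ∂P = pairing X (scale (ind hτ hB) a) := by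
  rw [← integral_indicator (hτ.measurableSpace_le _ hB)]
  refine integral_congr_ae ?_
  filter_upwards [totalSum_scale_right (ind hτ hB) X a, coeFn_ind (P := P) hτ hB] with ω h1 h2
  refine Eq.trans ?_ h1.symm
  rw [h2]
  by_cases hω : ω ∈ B <;> simp [hω]

lemma pairing_congr (has : SupportedOn τ θ a)
    (h : ∀ᵐ ω ∂P, ∀ t : ℕ, τ ω ≤ (t : WithTop ℕ) → (t : WithTop ℕ) ≤ θ ω → X t ω = Y t ω) :
    pairing X a = pairing Y a := by
  refine integral_congr_ae (totalSum_congr ?_)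
  filter_upwards [h, has] with ω h1 h2 t ht
  by_contra hc
  exact ht (h2 t fun hc' => hc (h1 t hc'.1 hc'.2))

lemma setIntegral_condPairing [IsFiniteMeasure P] (ha : a ∈ A1 P ℱ) (has : SupportedOn τ θ a) (hX : X ∈ RInf P ℱ)
    {B : Set Ω} (hB : MeasurableSet[hτ.measurableSpace] B) :
    ∫ ω in B, condPairing hτ θ X a ω ∂P = ∫ ω in B, totalSum X a ω ∂P := by
  rw [integral_congr_ae (ae_restrict_of_ae (coeFn_condPairing hτ has X))]
  exact setIntegral_condExp hτ.measurableSpace_le (integrable_totalSum_of_mem ha hX) hB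

lemma integral_condPairing [IsFiniteMeasure P] (ha : a ∈ A1 P ℱ) (has : SupportedOn τ θ a) (hX : X ∈ RInf P ℱ) :
    ∫ ω, condPairing hτ θ X a ω ∂P = pairing X a := by
  have := setIntegral_condPairing (hτ := hτ) ha has hX MeasurableSet.univ
  rwa [setIntegral_univ, setIntegral_univ] at this

lemma condPairing_add_left (ha : a ∈ A1 P ℱ) (has : SupportedOn τ θ a) (hX : X ∈ RInf P ℱ)
    (hY : Y ∈ RInf P ℱ) :
    condPairing hτ θ (X + Y) a = condPairing hτ θ X a + condPairing hτ θ Y a := by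
  refine AEEqFun.ext ?_
  filter_upwards [coeFn_condPairing hτ has X, coeFn_condPairing hτ has Y,
    coeFn_condPairing hτ has (X + Y), condExp_congr_ae (m := hτ.measurableSpace)
      (totalSum_add_left ha hX hY),
    condExp_add (integrable_totalSum_of_mem ha hX) (integrable_totalSum_of_mem ha hY)
      hτ.measurableSpace, AEEqFun.coeFn_add (condPairing hτ θ X a) (condPairing hτ θ Y a)]
    with ω h1 h2 h3 h4 h5 h6
  rw [h3, h4, h5, h6, Pi.add_apply, Pi.add_apply, h1, h2]

lemma condPairing_add_right (ha : a ∈ A1 P ℱ) (has : SupportedOn τ θ a) (hb : b ∈ A1 P ℱ)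
    (hbs : SupportedOn τ θ b) (hX : X ∈ RInf P ℱ) :
    condPairing hτ θ X (a + b) = condPairing hτ θ X a + condPairing hτ θ X b := by
  refine AEEqFun.ext ?_
  filter_upwards [coeFn_condPairing hτ has X, coeFn_condPairing hτ hbs X,
    coeFn_condPairing hτ (has.add hbs) X, condExp_congr_ae (m := hτ.measurableSpace)
      (totalSum_add_right ha hb hX),
    condExp_add (integrable_totalSum_of_mem ha hX) (integrable_totalSum_of_mem hb hX)
      hτ.measurableSpace, AEEqFun.coeFn_add (condPairing hτ θ X a) (condPairing hτ θ X b)]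
    with ω h1 h2 h3 h4 h5 h6
  rw [h3, h4, h5, h6, Pi.add_apply, Pi.add_apply, h1, h2]

/-- Pulling an F_τ-measurable factor out of the conditional expectation; one form serves for both
arguments, and the factor need only keep the product integrable. -/
lemma condPairing_eq_mul {X' a' : Process0 P} (has : SupportedOn τ θ a)
    (has' : SupportedOn τ θ a') (hf : AEStronglyMeasurable[hτ.measurableSpace] f P)
    (hi : Integrable (totalSum X a) P) (hi' : Integrable (totalSum X' a') P)
    (h : totalSum X' a' =ᵐ[P] fun ω => f ω * totalSum X a ω) :
    condPairing hτ θ X' a' = f * condPairing hτ θ X a := by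
  refine AEEqFun.ext ?_
  have h0 : Integrable ((f : Ω → ℝ) * totalSum X a) P := hi'.congr h
  filter_upwards [coeFn_condPairing hτ has X, coeFn_condPairing hτ has' X',
    condExp_congr_ae (m := hτ.measurableSpace) h,
    condExp_mul_of_aestronglyMeasurable_left hf h0 hi,
    AEEqFun.coeFn_mul f (condPairing hτ θ X a)] with ω h1 h2 h3 h4 h5
  rw [h2, h3, h5, Pi.mul_apply, h1]
  exact h4

lemma condPairing_scale_left (ha : a ∈ A1 P ℱ) (has : SupportedOn τ θ a) (hX : X ∈ RInf P ℱ)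
    (hf : f ∈ LInfTau P hτ) :
    condPairing hτ θ (scale f X) a = f * condPairing hτ θ X a := by
  have hi := integrable_totalSum_of_mem ha hX
  refine condPairing_eq_mul has has hf.1 hi ?_ (totalSum_scale_left f X a)
  obtain ⟨c, hc⟩ := hf.2
  exact (hi.bdd_mul f.aestronglyMeasurable hc).congr (totalSum_scale_left f X a).symm

lemma condPairing_scale_right (ha : a ∈ A1 P ℱ) (has : SupportedOn τ θ a) (hX : X ∈ RInf P ℱ)
    (hf : AEStronglyMeasurable[hτ.measurableSpace] f P) (hfa : scale f a ∈ A1 P ℱ) :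
    condPairing hτ θ X (scale f a) = f * condPairing hτ θ X a :=
  condPairing_eq_mul has (has.scale f) hf (integrable_totalSum_of_mem ha hX)
    (integrable_totalSum_of_mem hfa hX) (totalSum_scale_right f X a)

lemma condPairing_mono (ha : a ∈ A1 P ℱ) (has : SupportedOn τ θ a) (ha0 : ∀ t, 0 ≤ incr a t)
    (hX : X ∈ RInf P ℱ) (hY : Y ∈ RInf P ℱ) (hXY : X ≤ Y) :
    condPairing hτ θ X a ≤ condPairing hτ θ Y a := by
  rw [← AEEqFun.coeFn_le]
  filter_upwards [coeFn_condPairing hτ has X, coeFn_condPairing hτ has Y,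
    condExp_mono (m := hτ.measurableSpace) (integrable_totalSum_of_mem ha hX)
      (integrable_totalSum_of_mem ha hY) (totalSum_mono ha hX hY ha0 hXY)] with ω h1 h2 h3
  rw [h1, h2]
  exact h3

lemma condPairing_congr (has : SupportedOn τ θ a)
    (h : ∀ᵐ ω ∂P, ∀ t : ℕ, τ ω ≤ (t : WithTop ℕ) → (t : WithTop ℕ) ≤ θ ω → X t ω = Y t ω) :
    condPairing hτ θ X a = condPairing hτ θ Y a := by
  refine AEEqFun.ext ?_
  refine (coeFn_condPairing hτ has X).trans ((condExp_congr_ae (totalSum_congr ?_)).trans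
    (coeFn_condPairing hτ has Y).symm)
  filter_upwards [h, has] with ω h1 h2 t ht
  by_contra hc
  exact ht (h2 t fun hc' => hc (h1 t hc'.1 hc'.2))

lemma pairing_proj {hθ : IsStoppingTime ℱ θ} (has : SupportedOn τ θ a) (X : Process0 P) :
    pairing (proj hτ hθ X) a = pairing X a := by
  refine pairing_congr has ?_
  filter_upwards [coeFn_proj hτ hθ X] with ω h t h1 h2
  rw [h, seqProj_of_le h1 h2]

variable {hθ : IsStoppingTime ℱ θ}

/-- Projection keeps increments non-negative and does not increase variation, so the preimage in the
definition can be traded for a support condition. -/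
lemma mem_DST_iff (hτθ : ∀ᵐ ω ∂P, τ ω ≤ θ ω) : a ∈ DST P hτ hθ ↔
    a ∈ A1 P ℱ ∧ (∀ t, 0 ≤ incr a t) ∧ SupportedOn τ θ a ∧ condPairing hτ θ 1 a = 1 := by
  constructor
  · rintro ⟨⟨b, ⟨hb, hb0⟩, rfl⟩, h1⟩
    have key : ∀ᵐ ω ∂P, τ ω ≤ θ ω ∧ (∀ t, 0 ≤ seqIncr (fun s => b s ω) t) ∧
        (∀ t, incr b t ω = seqIncr (fun s => b s ω) t) ∧
        ∀ t, incr (proj hτ hθ b) t ω = seqIncr (seqProj (τ ω) (θ ω) fun s => b s ω) t := by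
      filter_upwards [hτθ, incr_nonneg_iff.1 hb0, coeFn_incr b,
        coeFn_incr (proj hτ hθ b), coeFn_proj hτ hθ b] with ω h2 h3 h5 h6 h7
      refine ⟨h2, fun t => ?_, h5, fun t => ?_⟩
      · rw [← h5]
        exact h3 t
      · rw [h6]
        congr 1
        funext s
        exact h7 s
    refine ⟨⟨proj_mem_R0 hτ hθ hb.1, lt_of_le_of_lt (lintegral_mono_ae ?_) hb.2⟩, ?_,
      (supportedOn_iff hτθ).2 (isStopped_proj hτ hθ hτθ b), h1⟩
    · filter_upwards [key] with ω h
      simp only [h.2.2.2, h.2.2.1]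
      exact tsum_enorm_seqIncr_seqProj_le h.1 h.2.1
    · refine incr_nonneg_iff.2 ?_
      filter_upwards [key] with ω h t
      rw [h.2.2.2]
      exact seqIncr_seqProj_nonneg h.1 h.2.1 t
  · rintro ⟨h1, h2, h3, h4⟩
    exact ⟨⟨a, ⟨h1, h2⟩, proj_eq_self hτ hθ hτθ ((supportedOn_iff hτθ).1 h3)⟩, h4⟩

lemma condPairing_indFrom (has : SupportedOn τ θ a) :
    condPairing hτ θ (indFrom P hτ) a = condPairing hτ θ 1 a := by
  refine condPairing_congr has ?_
  filter_upwards [coeFn_indFrom (P := P) hτ, coeFn_process_one (P := P)] with ω h1 h2 t h3 _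
  rw [h1, h2, if_pos h3]

end CondPairing

/-! ### From a representation to the axioms -/

section Representation

variable {Ω : Type*} {mΩ : MeasurableSpace Ω} {P : Measure Ω}
  {ℱ : Filtration ℕ mΩ} {τ θ : Ω → WithTop ℕ} {hτ : IsStoppingTime ℱ τ} {hθ : IsStoppingTime ℱ θ}
  {X Y a : Process0 P} {φ : Process0 P → Ω →ₘ[P] ℝ} {Q : Set (Process0 P)}

lemma condPairing_scale_indFrom (hτθ : ∀ᵐ ω ∂P, τ ω ≤ θ ω) (ha : a ∈ DST P hτ hθ)
    {f : Ω →ₘ[P] ℝ} (hf : f ∈ LInfTau P hτ) :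
    condPairing hτ θ (scale f (indFrom P hτ)) a = f := by
  obtain ⟨h1, -, h3, h4⟩ := (mem_DST_iff hτθ).1 ha
  rw [condPairing_scale_left h1 h3 ((mem_RInfST_iff hτ hθ hτθ).1 (indFrom_mem_RInfST hτθ)).1 hf,
    condPairing_indFrom h3, h4, mul_one]

lemma le_scale_indFrom (hτθ : ∀ᵐ ω ∂P, τ ω ≤ θ ω) (hX : X ∈ RInfST P hτ hθ) {c : ℝ}
    (hc : ∀ᵐ ω ∂P, ∀ t, X t ω ≤ c) : X ≤ scale (constRV P c) (indFrom P hτ) := by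
  refine process_le_iff.2 ?_
  filter_upwards [hc, ((mem_RInfST_iff hτ hθ hτθ).1 hX).2, coeFn_constRV (P := P) c,
    coeFn_indFrom (P := P) hτ, coeFn_scale (constRV P c) (indFrom P hτ)] with ω h1 h2 h3 h4 h5 t
  rw [h5, h3, h4]
  split_ifs with h
  · simpa using h1 t
  · rw [h2.1 t (not_le.1 h), mul_zero]

lemma scale_indFrom_le (hτθ : ∀ᵐ ω ∂P, τ ω ≤ θ ω) (hX : X ∈ RInfST P hτ hθ) {c : ℝ}
    (hc : ∀ᵐ ω ∂P, ∀ t, c ≤ X t ω) : scale (constRV P c) (indFrom P hτ) ≤ X := by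
  refine process_le_iff.2 ?_
  filter_upwards [hc, ((mem_RInfST_iff hτ hθ hτθ).1 hX).2, coeFn_constRV (P := P) c,
    coeFn_indFrom (P := P) hτ, coeFn_scale (constRV P c) (indFrom P hτ)] with ω h1 h2 h3 h4 h5 t
  rw [h5, h3, h4]
  split_ifs with h
  · simpa using h1 t
  · rw [h2.1 t (not_le.1 h), mul_zero]

/-- X lies between -c 1_{[τ,∞)} and c 1_{[τ,∞)}, whose conditional pairings with a normalised
process are -c and c. -/
lemma abs_condPairing_le (hτθ : ∀ᵐ ω ∂P, τ ω ≤ θ ω) (ha : a ∈ DST P hτ hθ)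
    (hX : X ∈ RInfST P hτ hθ) {c : ℝ} (hc : ∀ᵐ ω ∂P, ∀ t, |X t ω| ≤ c) :
    ∀ᵐ ω ∂P, |condPairing hτ θ X a ω| ≤ c := by
  obtain ⟨h1, h2, h3, -⟩ := (mem_DST_iff hτθ).1 ha
  have hI : ∀ c, scale (constRV P c) (indFrom P hτ) ∈ RInfST P hτ hθ := fun c =>
    scale_mem_RInfST hτθ (constRV_mem_LInfTau c) (indFrom_mem_RInfST hτθ)
  have hR : ∀ {Z : Process0 P}, Z ∈ RInfST P hτ hθ → Z ∈ RInf P ℱ := fun h =>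
    ((mem_RInfST_iff hτ hθ hτθ).1 h).1
  have hu := condPairing_mono (hτ := hτ) h1 h3 h2 (hR hX) (hR (hI c))
    (le_scale_indFrom hτθ hX (hc.mono fun ω h t => (abs_le.1 (h t)).2))
  have hl := condPairing_mono (hτ := hτ) h1 h3 h2 (hR (hI (-c))) (hR hX)
    (scale_indFrom_le hτθ hX (hc.mono fun ω h t => (abs_le.1 (h t)).1))
  rw [condPairing_scale_indFrom hτθ ha (constRV_mem_LInfTau _), ← AEEqFun.coeFn_le] at hu hl
  filter_upwards [hu, hl, coeFn_constRV (P := P) c, coeFn_constRV (P := P) (-c)]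
    with ω h4 h5 h6 h7
  rw [h6] at h4
  rw [h7] at h5
  exact abs_le.2 ⟨h5, h4⟩

variable [IsProbabilityMeasure P]

lemma represents_iff (hQ : Q.Nonempty) : Represents hτ hθ Q φ ↔
    ∀ X ∈ RInfST P hτ hθ, IsGLB ((fun a => condPairing hτ θ X a) '' Q) (φ X) := by
  refine forall₂_congr fun X _ => ?_
  rw [← toE_eq_essInfFam_iff (hQ.image _), Set.image_image]

lemma Represents.exists_seq (hQ : Q.Nonempty) (h : Represents hτ hθ Q φ)
    (hX : X ∈ RInfST P hτ hθ) : ∃ a : ℕ → Process0 P, (∀ n, a n ∈ Q) ∧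
      ∀ᵐ ω ∂P, IsGLB (Set.range fun n => condPairing hτ θ X (a n) ω) (φ X ω) := by
  obtain ⟨u, hu, hglb⟩ := exists_seq_isGLB (hQ.image _) ((represents_iff hQ).1 h X hX)
  choose a ha hau using hu
  exact ⟨a, ha, by simpa only [hau] using hglb⟩

/-- Each axiom holds for the single conditional pairings, which are linear over bounded
F_τ-variables and monotone. Realising the infimum by a sequence gives F_τ-measurability and the
pointwise upper bound in homogeneity. -/
theorem Represents.isCoherent (hτθ : ∀ᵐ ω ∂P, τ ω ≤ θ ω) (hQ : Q.Nonempty)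
    (hQD : Q ⊆ DST P hτ hθ) (h : Represents hτ hθ Q φ) : IsCoherent hτ hθ φ := by
  have hglb := (represents_iff hQ).1 h
  have hD := fun a (ha : a ∈ Q) => (mem_DST_iff hτθ).1 (hQD ha)
  have hR : ∀ {Z : Process0 P}, Z ∈ RInfST P hτ hθ → Z ∈ RInf P ℱ := fun h =>
    ((mem_RInfST_iff hτ hθ hτθ).1 h).1
  have hle : ∀ X ∈ RInfST P hτ hθ, ∀ a ∈ Q, φ X ≤ condPairing hτ θ X a := fun X hX a ha =>
    (hglb X hX).1 (Set.mem_image_of_mem _ ha)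
  have hge : ∀ X ∈ RInfST P hτ hθ, ∀ f, (∀ a ∈ Q, f ≤ condPairing hτ θ X a) → f ≤ φ X :=
    fun X hX f hf => (hglb X hX).2 (by rintro _ ⟨a, ha, rfl⟩; exact hf a ha)
  have hhom : ∀ X ∈ RInfST P hτ hθ, ∀ l ∈ LInfTau P hτ, 0 ≤ l →
      φ (scale l X) = l * φ X := fun X hX l hl hl0 => by
    have hlX := scale_mem_RInfST hτθ hl hX
    have hl0' := AEEqFun.coeFn_le.2 hl0
    have hz := AEEqFun.coeFn_zero (β := ℝ) (μ := P) (α := Ω)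
    refine le_antisymm ?_ ?_
    · obtain ⟨a, ha, hau⟩ := h.exists_seq hQ hX
      have hall : ∀ᵐ ω ∂P, ∀ n, φ (scale l X) ω ≤ l ω * condPairing hτ θ X (a n) ω := by
        refine ae_all_iff.2 fun n => ?_
        obtain ⟨h1, h2, h3, -⟩ := hD _ (ha n)
        have := hle _ hlX _ (ha n)
        rw [condPairing_scale_left h1 h3 (hR hX) hl, ← AEEqFun.coeFn_le] at this
        filter_upwards [this, AEEqFun.coeFn_mul l (condPairing hτ θ X (a n))] with ω h4 h5
        rwa [h5] at h4
      rw [← AEEqFun.coeFn_le]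
      filter_upwards [hau, hall, hl0', hz, AEEqFun.coeFn_mul l (φ X)] with ω h1 h2 h3 h4 h5
      rw [h5, Pi.mul_apply]
      rw [h4, Pi.zero_apply] at h3
      -- Where l = 0 a single term of the sequence suffices; where l > 0 one divides by l and uses
      -- that φ X is the greatest pointwise lower bound.
      rcases h3.eq_or_lt with h0 | h0
      · have := h2 0
        rwa [← h0, zero_mul] at this ⊢
      · rw [mul_comm, ← div_le_iff₀ h0]
        refine h1.2 ?_
        rintro _ ⟨n, rfl⟩
        rw [div_le_iff₀ h0, mul_comm]
        exact h2 n
    · refine hge _ hlX _ fun a ha => ?_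
      obtain ⟨h1, h2, h3, -⟩ := hD _ ha
      rw [condPairing_scale_left h1 h3 (hR hX) hl, ← AEEqFun.coeFn_le]
      filter_upwards [AEEqFun.coeFn_le.2 (hle X hX a ha), hl0', hz,
        AEEqFun.coeFn_mul l (φ X), AEEqFun.coeFn_mul l (condPairing hτ θ X a)]
        with ω h4 h5 h6 h7 h8
      rw [h7, h8]
      rw [h6] at h5
      exact mul_le_mul_of_nonneg_left h4 h5
  refine ⟨⟨⟨fun X hX => ?_, fun X hX A hA => ?_, fun X hX Y hY hXY => ?_, fun X hX m hm => ?_⟩,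
    fun X hX Y hY l hl hl0 hl1 => ?_⟩, hhom⟩
  · obtain ⟨a, ha, hau⟩ := h.exists_seq hQ hX
    choose g hg hag using fun n => aestronglyMeasurable_condPairing (θ := θ) hτ X (a n)
    refine ⟨⟨fun ω => ⨅ n, g n ω, ?_, ?_⟩, ?_⟩
    · exact (Measurable.iInf fun n => (hg n).measurable).stronglyMeasurable
    · filter_upwards [hau, ae_all_iff.2 hag] with ω h1 h2
      simp only [h2] at h1
      exact h1.ciInf_eq.symm
    · obtain ⟨c, hc⟩ := (hR hX).2
      refine ⟨c, ?_⟩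
      filter_upwards [hau, ae_all_iff.2 fun n => abs_condPairing_le hτθ (hQD (ha n)) hX hc]
        with ω h1 h2
      refine abs_le.2 ⟨h1.2 ?_, (h1.1 ⟨0, rfl⟩).trans (abs_le.1 (h2 0)).2⟩
      rintro _ ⟨n, rfl⟩
      exact (abs_le.1 (h2 n)).1
  -- Locality is homogeneity for the factor 1_A.
  · exact hhom X hX _ (ind_mem_LInfTau hτ hA) (ind_nonneg hτ hA)
  · refine hge Y hY _ fun a ha => (hle X hX a ha).trans ?_
    obtain ⟨h1, h2, h3, -⟩ := hD _ ha
    exact condPairing_mono h1 h3 h2 (hR hX) (hR hY) hXY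
  · have hmI : scale m (indFrom P hτ) ∈ RInfST P hτ hθ :=
      scale_mem_RInfST hτθ hm (indFrom_mem_RInfST hτθ)
    have hX' := add_mem_RInfST hτθ hX hmI
    have heq : ∀ a ∈ Q, condPairing hτ θ (X + scale m (indFrom P hτ)) a =
        condPairing hτ θ X a + m := fun a ha => by
      obtain ⟨h1, h2, h3, -⟩ := hD _ ha
      rw [condPairing_add_left h1 h3 (hR hX) (hR hmI),
        condPairing_scale_indFrom hτθ (hQD ha) hm]
    refine le_antisymm ?_ (hge _ hX' _ fun a ha => ?_)
    · have : φ (X + scale m (indFrom P hτ)) - m ≤ φ X := hge X hX _ fun a ha => by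
        have := hle _ hX' a ha
        rw [heq a ha, ← AEEqFun.coeFn_le] at this
        rw [← AEEqFun.coeFn_le]
        filter_upwards [this, AEEqFun.coeFn_sub (φ (X + scale m (indFrom P hτ))) m,
          AEEqFun.coeFn_add (condPairing hτ θ X a) m] with ω h1 h2 h3
        rw [h3, Pi.add_apply] at h1
        rw [h2, Pi.sub_apply]
        linarith
      rw [← AEEqFun.coeFn_le] at this ⊢
      filter_upwards [this, AEEqFun.coeFn_sub (φ (X + scale m (indFrom P hτ))) m,
          AEEqFun.coeFn_add (φ X) m] with ω h1 h2 h3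
      rw [h2, Pi.sub_apply] at h1
      rw [h3, Pi.add_apply]
      linarith
    · rw [heq a ha, ← AEEqFun.coeFn_le]
      filter_upwards [AEEqFun.coeFn_le.2 (hle X hX a ha), AEEqFun.coeFn_add (φ X) m,
        AEEqFun.coeFn_add (condPairing hτ θ X a) m] with ω h1 h2 h3
      rw [h2, h3, Pi.add_apply, Pi.add_apply]
      linarith
  · have hl' := sub_mem_LInfTau one_mem_LInfTau hl
    have h1 := scale_mem_RInfST hτθ hl hX
    have h2 := scale_mem_RInfST hτθ hl' hY
    refine hge _ (add_mem_RInfST hτθ h1 h2) _ fun a ha => ?_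
    obtain ⟨h3, -, h4, -⟩ := hD _ ha
    rw [condPairing_add_left h3 h4 (hR h1) (hR h2), condPairing_scale_left h3 h4 (hR hX) hl,
      condPairing_scale_left h3 h4 (hR hY) hl', ← AEEqFun.coeFn_le]
    filter_upwards [AEEqFun.coeFn_le.2 (hle X hX a ha), AEEqFun.coeFn_le.2 (hle Y hY a ha),
      AEEqFun.coeFn_le.2 hl0, AEEqFun.coeFn_le.2 hl1, coeFn_one_sub l,
      AEEqFun.coeFn_zero (β := ℝ) (μ := P), AEEqFun.coeFn_one (β := ℝ) (μ := P),
      AEEqFun.coeFn_mul l (φ X), AEEqFun.coeFn_mul (1 - l) (φ Y),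
      AEEqFun.coeFn_add (l * φ X) ((1 - l) * φ Y),
      AEEqFun.coeFn_mul l (condPairing hτ θ X a), AEEqFun.coeFn_mul (1 - l) (condPairing hτ θ Y a),
      AEEqFun.coeFn_add (l * condPairing hτ θ X a) ((1 - l) * condPairing hτ θ Y a)]
      with ω h5 h6 h7 h8 h9 h10 h11 h12 h13 h14 h15 h16 h17
    rw [h14, h17, Pi.add_apply, Pi.add_apply, h12, h13, h15, h16]
    simp only [Pi.mul_apply, h9]
    rw [h10, Pi.zero_apply] at h7
    rw [h11, Pi.one_apply] at h8
    exact add_le_add (mul_le_mul_of_nonneg_left h5 h7)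
      (mul_le_mul_of_nonneg_left h6 (by linarith))

end Representation

/-! ### Weak closedness of the acceptance set -/

section WeakTopology

variable {Ω : Type*} {mΩ : MeasurableSpace Ω} {P : Measure Ω}
  {ℱ : Filtration ℕ mΩ} {τ θ : Ω → WithTop ℕ} {hτ : IsStoppingTime ℱ τ} {hθ : IsStoppingTime ℱ θ}
  {X a : Process0 P} {φ : Process0 P → Ω →ₘ[P] ℝ} {Q : Set (Process0 P)}

lemma continuous_pairing_left (ha : a ∈ A1 P ℱ) :
    Continuous[sigmaRA P ℱ, inferInstance] fun X : RInf P ℱ => pairing X.1 a :=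
  continuous_iInf_dom (i := (⟨a, ha⟩ : A1 P ℱ)) continuous_induced_dom

lemma continuous_pairing_right (hX : X ∈ RInf P ℱ) :
    Continuous[sigmaAR P ℱ, inferInstance] fun a : A1 P ℱ => pairing X a.1 :=
  continuous_iInf_dom (i := (⟨X, hX⟩ : RInf P ℱ)) continuous_induced_dom

lemma coeFn_single (s : ℕ) (f : Ω →ₘ[P] ℝ) :
    ∀ᵐ ω ∂P, ∀ t, (Pi.single s f : Process0 P) t ω = if t = s then f ω else 0 := by
  refine ae_all_iff.2 fun t => ?_
  by_cases h : t = s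
  · subst h
    simp
  · filter_upwards [AEEqFun.coeFn_zero (β := ℝ) (μ := P)] with ω h0
    rw [Pi.single_eq_of_ne h, if_neg h, h0, Pi.zero_apply]

lemma single_mem_R0 {s : ℕ} {f : Ω →ₘ[P] ℝ} (hf : AEStronglyMeasurable[ℱ s] f P) :
    (Pi.single s f : Process0 P) ∈ R0 P ℱ := by
  intro t
  by_cases h : t = s
  · subst h
    simpa using hf
  · rw [Pi.single_eq_of_ne h]
    exact (aestronglyMeasurable_const (b := (0 : ℝ))).congr AEEqFun.coeFn_zero.symm

lemma ofIncr_single_mem_A1 {s : ℕ} {f : Ω →ₘ[P] ℝ} (hf : AEStronglyMeasurable[ℱ s] f P)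
    (hi : Integrable f P) : ofIncr (Pi.single s f) ∈ A1 P ℱ := by
  refine mem_A1_of_integral (ofIncr_mem_R0 (single_mem_R0 hf)) ?_ ?_
  · filter_upwards [coeFn_single s f] with ω h
    refine summable_of_ne_finset_zero (s := {s}) fun t ht => ?_
    rw [incr_ofIncr, h, if_neg (by simpa using ht), abs_zero]
  · refine hi.abs.congr ?_
    filter_upwards [coeFn_single s f] with ω h
    rw [variation, tsum_eq_single s fun t ht => by
      rw [incr_ofIncr, h, if_neg ht, abs_zero], incr_ofIncr, h, if_pos rfl]

lemma single_mem_RInf {s : ℕ} {f : Ω →ₘ[P] ℝ} (hf : AEStronglyMeasurable[ℱ s] f P) {c : ℝ}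
    (hc : ∀ᵐ ω ∂P, |f ω| ≤ c) : (Pi.single s f : Process0 P) ∈ RInf P ℱ := by
  refine ⟨single_mem_R0 hf, c, ?_⟩
  filter_upwards [hc, coeFn_single s f] with ω h1 h2 t
  rw [h2]
  split_ifs
  · exact h1
  · rw [abs_zero]
    exact (abs_nonneg _).trans h1

lemma pairing_single_left (s : ℕ) (f : Ω →ₘ[P] ℝ) (a : Process0 P) :
    pairing (Pi.single s f) a = ∫ ω, f ω * incr a s ω ∂P := by
  refine integral_congr_ae ?_
  filter_upwards [coeFn_single s f] with ω h
  rw [tsum_eq_single s fun t ht => by rw [h, if_neg ht, zero_mul], h, if_pos rfl]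

lemma pairing_ofIncr_single (s : ℕ) (f : Ω →ₘ[P] ℝ) (X : Process0 P) :
    pairing X (ofIncr (Pi.single s f)) = ∫ ω, X s ω * f ω ∂P := by
  refine integral_congr_ae ?_
  filter_upwards [coeFn_single s f] with ω h
  rw [incr_ofIncr, tsum_eq_single s fun t ht => by rw [h, if_neg ht, mul_zero], h, if_pos rfl]

lemma integrable_of_mem_RInf [IsFiniteMeasure P] (hX : X ∈ RInf P ℱ) (t : ℕ) :
    Integrable (X t) P := by
  obtain ⟨c, hc⟩ := hX.2
  exact Integrable.of_bound (X t).aestronglyMeasurable c (hc.mono fun ω h => h t)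

/-- `X ↦ E[1_A Xₛ]` is `σ(R^∞, A¹)`-continuous. -/
lemma continuous_setIntegral [IsFiniteMeasure P] {A : Set Ω} (hA : MeasurableSet A) (s : ℕ) :
    Continuous[sigmaRA P ℱ, inferInstance] fun X : RInf P ℱ => ∫ ω in A, X.1 s ω ∂P := by
  have hgi : Integrable (A.indicator (1 : Ω → ℝ)) P :=
    (integrable_const (1 : ℝ)).indicator hA
  -- 1_A need not be F_s-measurable, so it is replaced by E[1_A | F_s], which has the same integral
  -- against the adapted X_s; the test process then has this variable as its only increment, at time
  -- s.
  have hm : AEStronglyMeasurable (P[A.indicator (1 : Ω → ℝ) | ℱ s]) P :=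
    integrable_condExp.aestronglyMeasurable
  have hf : AEStronglyMeasurable[ℱ s] (AEEqFun.mk _ hm) P :=
    aestronglyMeasurable_mk stronglyMeasurable_condExp.aestronglyMeasurable
  have hfi : Integrable (AEEqFun.mk _ hm) P := integrable_condExp.congr (AEEqFun.coeFn_mk _ _).symm
  convert continuous_pairing_left (ofIncr_single_mem_A1 hf hfi) using 2 with X
  rw [pairing_ofIncr_single, ← integral_indicator hA]
  obtain ⟨c, hc⟩ := X.2.2
  have hi : Integrable ((X.1 s : Ω → ℝ) * A.indicator 1) P :=
    hgi.bdd_mul (X.1 s).aestronglyMeasurable (hc.mono fun ω h => h s)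
  have h1 := condExp_mul_of_aestronglyMeasurable_left (m := ℱ s) (X.2.1 s) hi hgi
  calc ∫ ω, A.indicator (X.1 s) ω ∂P = ∫ ω, ((X.1 s : Ω → ℝ) * A.indicator (1 : Ω → ℝ)) ω ∂P := by
        refine integral_congr_ae (Eventually.of_forall fun ω => ?_)
        by_cases h : ω ∈ A <;> simp [h]
    _ = ∫ ω, (P[(X.1 s : Ω → ℝ) * A.indicator (1 : Ω → ℝ) | ℱ s]) ω ∂P := (integral_condExp (ℱ.le s)).symm
    _ = ∫ ω, X.1 s ω * AEEqFun.mk _ hm ω ∂P := by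
        refine integral_congr_ae ?_
        filter_upwards [h1, AEEqFun.coeFn_mk _ hm] with ω h2 h3
        rw [h2, h3, Pi.mul_apply]

/-- Vanishing before τ and constancy from θ on are detected by integrals of X_t and X_{t+1} - X_t
over events inside {t < τ} and {θ ≤ t}, and such integrals are weakly continuous. -/
lemma isClosed_RInfST [IsFiniteMeasure P] (hτθ : ∀ᵐ ω ∂P, τ ω ≤ θ ω) :
    IsClosed[sigmaRA P ℱ] {X : RInf P ℱ | X.1 ∈ RInfST P hτ hθ} := by
  have hmτ : ∀ t : ℕ, MeasurableSet {ω | (t : WithTop ℕ) < τ ω} := fun t =>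
    measurableSet_lt measurable_const (measurable_stoppingTime hτ)
  have hmθ := measurableSet_le_time hθ
  have hset : {X : RInf P ℱ | X.1 ∈ RInfST P hτ hθ} =
      (⋂ t : ℕ, ⋂ B : {B : Set Ω // MeasurableSet B},
        (fun X : RInf P ℱ => ∫ ω in B.1 ∩ {ω | (t : WithTop ℕ) < τ ω}, X.1 t ω ∂P) ⁻¹' {0}) ∩
      ⋂ t : ℕ, ⋂ B : {B : Set Ω // MeasurableSet B},
        (fun X : RInf P ℱ => ∫ ω in B.1 ∩ {ω | θ ω ≤ (t : WithTop ℕ)}, X.1 (t + 1) ω ∂P -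
          ∫ ω in B.1 ∩ {ω | θ ω ≤ (t : WithTop ℕ)}, X.1 t ω ∂P) ⁻¹' {0} := by
    ext X
    simp only [Set.mem_inter_iff, Set.mem_iInter, Set.mem_preimage, Set.mem_singleton_iff,
      Subtype.forall]
    change X.1 ∈ RInfST P hτ hθ ↔ _
    rw [mem_RInfST_iff hτ hθ hτθ, and_iff_right X.2, IsStopped, eventually_and, ae_all_iff,
      ae_all_iff]
    have hi := integrable_of_mem_RInf X.2
    refine and_congr (forall_congr' fun t => ?_) (forall_congr' fun t => ?_)
    · constructor
      · intro h B hB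
        refine (setIntegral_congr_ae (hB.inter (hmτ t)) (h.mono fun ω h hω => h hω.2)).trans ?_
        simp
      · intro h
        have := ((hi t).indicator (hmτ t)).ae_eq_zero_of_forall_setIntegral_eq_zero
          fun B hB _ => by rw [setIntegral_indicator (hmτ t)]; exact h B hB
        filter_upwards [this] with ω h1 h2
        rwa [Set.indicator_of_mem (by exact h2)] at h1
    · constructor
      · intro h B hB
        rw [sub_eq_zero]
        exact setIntegral_congr_ae (hB.inter (hmθ t)) (h.mono fun ω h hω => h hω.2)
      · intro h
        have := (((hi (t + 1)).sub (hi t)).indicator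
          (hmθ t)).ae_eq_zero_of_forall_setIntegral_eq_zero fun B hB _ => by
            rw [setIntegral_indicator (hmθ t)]
            exact (integral_sub (hi (t + 1)).integrableOn (hi t).integrableOn).trans (h B hB)
        filter_upwards [this] with ω h1 h2
        rw [Set.indicator_of_mem (by exact h2)] at h1
        exact sub_eq_zero.1 h1
  rw [hset]
  let := sigmaRA P ℱ
  refine IsClosed.inter (isClosed_iInter fun t => isClosed_iInter fun B => ?_)
    (isClosed_iInter fun t => isClosed_iInter fun B => ?_)
  · exact isClosed_singleton.preimage (continuous_setIntegral (B.2.inter (hmτ t)) t)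
  · exact isClosed_singleton.preimage
      ((continuous_setIntegral (B.2.inter (hmθ t)) (t + 1)).sub
        (continuous_setIntegral (B.2.inter (hmθ t)) t))

lemma condPairing_nonneg_iff [IsFiniteMeasure P] (ha : a ∈ A1 P ℱ) (has : SupportedOn τ θ a)
    (hX : X ∈ RInf P ℱ) : 0 ≤ condPairing hτ θ X a ↔
    ∀ B : {B : Set Ω // MeasurableSet[hτ.measurableSpace] B},
      0 ≤ ∫ ω in B.1, totalSum X a ω ∂P := by
  have hz := AEEqFun.coeFn_zero (β := ℝ) (μ := P) (α := Ω)
  rw [← AEEqFun.coeFn_le]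
  constructor
  · rintro h ⟨B, hB⟩
    rw [← setIntegral_condPairing ha has hX hB]
    refine integral_nonneg_of_ae (ae_restrict_of_ae ?_)
    filter_upwards [h, hz] with ω h1 h2
    rwa [h2] at h1
  · intro h
    have := ae_nonneg_of_setIntegral_nonneg hτ.measurableSpace_le
      (aestronglyMeasurable_condPairing (θ := θ) hτ X a) (integrable_condPairing hτ X a)
      fun B hB => by rw [setIntegral_condPairing ha has hX hB]; exact h ⟨B, hB⟩
    filter_upwards [this, hz] with ω h1 h2
    rwa [h2]

lemma scale_ind_mem_A1 (hτθ : ∀ᵐ ω ∂P, τ ω ≤ θ ω) (ha : a ∈ A1 P ℱ) (has : SupportedOn τ θ a)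
    {B : Set Ω} (hB : MeasurableSet[hτ.measurableSpace] B) : scale (ind hτ hB) a ∈ A1 P ℱ :=
  scale_mem_A1 hτ (ind_mem_LInfTau hτ hB) ha
    (((supportedOn_iff hτθ).1 has).mono fun _ h => h.1)

/-- Acceptability means that all conditional pairings with Q are non-negative, that is, that the
pairings with 1_B a are non-negative for a in Q and B in F_τ. -/
theorem Represents.isClosed_acceptanceSet [IsProbabilityMeasure P] (hτθ : ∀ᵐ ω ∂P, τ ω ≤ θ ω)
    (hQ : Q.Nonempty) (hQD : Q ⊆ DST P hτ hθ) (h : Represents hτ hθ Q φ) :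
    IsClosed[sigmaRA P ℱ] {X : RInf P ℱ | X.1 ∈ acceptanceSet hτ hθ φ} := by
  have hset : {X : RInf P ℱ | X.1 ∈ acceptanceSet hτ hθ φ} =
      {X : RInf P ℱ | X.1 ∈ RInfST P hτ hθ} ∩
      ⋂ a : Q, ⋂ B : {B : Set Ω // MeasurableSet[hτ.measurableSpace] B},
        (fun X : RInf P ℱ => pairing X.1 (scale (ind hτ B.2) a.1)) ⁻¹' Set.Ici 0 := by
    ext X
    simp only [Set.mem_inter_iff, Set.mem_iInter, Set.mem_preimage, Set.mem_Ici]
    change (X.1 ∈ RInfST P hτ hθ ∧ 0 ≤ φ X.1) ↔ X.1 ∈ RInfST P hτ hθ ∧ _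
    refine and_congr_right fun hX => ?_
    have hglb := (represents_iff hQ).1 h X.1 hX
    rw [le_isGLB_iff hglb]
    simp only [lowerBounds, Set.forall_mem_image]
    change (∀ a ∈ Q, 0 ≤ condPairing hτ θ X.1 a) ↔ _
    rw [Subtype.forall]
    refine forall₂_congr fun a ha => ?_
    obtain ⟨h1, -, h3, -⟩ := (mem_DST_iff hτθ).1 (hQD ha)
    rw [condPairing_nonneg_iff h1 h3 X.2]
    exact forall_congr' fun B => by rw [setIntegral_totalSum_eq_pairing_right B.2]
  rw [hset]
  let := sigmaRA P ℱ
  refine IsClosed.inter (isClosed_RInfST hτθ)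
    (isClosed_iInter fun a => isClosed_iInter fun B => ?_)
  obtain ⟨h1, -, h3, -⟩ := (mem_DST_iff hτθ).1 (hQD a.2)
  exact isClosed_Ici.preimage
    (continuous_pairing_left (scale_ind_mem_A1 hτθ h1 h3 B.2))

lemma tendsto_pairing {Xs : ℕ → Process0 P} {c : ℝ} (ha : a ∈ A1 P ℱ)
    (hc : ∀ᵐ ω ∂P, ∀ n t, |Xs n t ω| ≤ c)
    (hX : ∀ᵐ ω ∂P, ∀ t, Tendsto (fun n => Xs n t ω) atTop (𝓝 (X t ω))) :
    Tendsto (fun n => pairing (Xs n) a) atTop (𝓝 (pairing X a)) := by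
  refine tendsto_integral_of_dominated_convergence (fun ω => c * variation a ω)
    (fun n => (measurable_totalSum (Xs n) a).aestronglyMeasurable)
    ((integrable_variation ha).const_mul c) (fun n => ?_) ?_
  · filter_upwards [ae_totalSum_bound ha (hc.mono fun ω h => h n)] with ω h using h.2
  · filter_upwards [ae_summable_of_mem_A1 ha, hc, hX] with ω h1 h2 h3
    refine tendsto_tsum_of_dominated_convergence (h1.mul_left c)
      (fun t => (h3 t).mul_const _) (Eventually.of_forall fun n t => ?_)
    rw [norm_mul]
    exact mul_le_mul_of_nonneg_right (h2 n t) (abs_nonneg _)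

lemma tendsto_sigmaRA_iff {Xs : ℕ → RInf P ℱ} {X : RInf P ℱ} :
    Tendsto Xs atTop (@nhds _ (sigmaRA P ℱ) X) ↔
      ∀ a ∈ A1 P ℱ, Tendsto (fun n => pairing (Xs n).1 a) atTop (𝓝 (pairing X.1 a)) := by
  rw [nhds_iInf, tendsto_iInf, Subtype.forall]
  refine forall₂_congr fun a ha => ?_
  rw [nhds_induced, tendsto_comap_iff]
  rfl

end WeakTopology

/-! ### Closedness and continuity for decreasing sequences -/

section Continuity

variable {Ω : Type*} {mΩ : MeasurableSpace Ω} {P : Measure Ω}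
  {ℱ : Filtration ℕ mΩ} {τ θ : Ω → WithTop ℕ} {hτ : IsStoppingTime ℱ τ} {hθ : IsStoppingTime ℱ θ}
  {X : Process0 P} {φ : Process0 P → Ω →ₘ[P] ℝ}

theorem continuousForBoundedDecreasing_of_isClosed (hτθ : ∀ᵐ ω ∂P, τ ω ≤ θ ω)
    (hφ : IsMonetary hτ hθ φ)
    (hcl : IsClosed[sigmaRA P ℱ] {X : RInf P ℱ | X.1 ∈ acceptanceSet hτ hθ φ}) :
    ContinuousForBoundedDecreasing hτ hθ φ := by
  intro Xs X hXs hX hanti hlim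
  have hlim' := ae_all_iff.2 hlim
  have hanti' : ∀ᵐ ω ∂P, ∀ t, Antitone fun n => Xs n t ω := by
    have : ∀ᵐ ω ∂P, ∀ n t, Xs (n + 1) t ω ≤ Xs n t ω :=
      ae_all_iff.2 fun n => process_le_iff.1 (hanti n.le_succ)
    filter_upwards [this] with ω h t using antitone_nat_of_succ_le fun n => h n t
  have hXle : ∀ᵐ ω ∂P, ∀ n t, X t ω ≤ Xs n t ω := by
    filter_upwards [hlim', hanti'] with ω h1 h2 n t using (h2 t).le_of_tendsto (h1 t) n
  have hle : ∀ᵐ ω ∂P, ∀ n, φ X ω ≤ φ (Xs n) ω := ae_all_iff.2 fun n =>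
    AEEqFun.coeFn_le.2 (hφ.monotone _ hX _ (hXs n)
      (process_le_iff.2 (hXle.mono fun ω h => h n)))
  have hφanti : ∀ᵐ ω ∂P, Antitone fun n => φ (Xs n) ω := by
    have : ∀ᵐ ω ∂P, ∀ n, φ (Xs (n + 1)) ω ≤ φ (Xs n) ω := ae_all_iff.2 fun n =>
      AEEqFun.coeFn_le.2 (hφ.monotone _ (hXs _) _ (hXs n) (hanti n.le_succ))
    filter_upwards [this] with ω h using antitone_nat_of_succ_le h
  have hbdd : ∀ᵐ ω ∂P, BddBelow (Set.range fun n => φ (Xs n) ω) := by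
    filter_upwards [hle] with ω h
    exact ⟨φ X ω, by rintro _ ⟨n, rfl⟩; exact h n⟩
  have hm : Measurable fun ω => -⨅ n, φ (Xs n) ω :=
    (Measurable.iInf fun n => (φ (Xs n)).measurable).neg
  -- The least cash amount that makes all Xs n acceptable at once; it is bounded because φ X ≤ φ (Xs
  -- n) ≤ φ (Xs 0).
  set m : Ω →ₘ[P] ℝ := AEEqFun.mk _ hm.aestronglyMeasurable
  have hmω : ∀ᵐ ω ∂P, m ω = -⨅ n, φ (Xs n) ω := AEEqFun.coeFn_mk _ hm.aestronglyMeasurable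
  have hmL : m ∈ LInfTau P hτ := by
    choose g hg hgφ using fun n => (hφ.mapsTo _ (hXs n)).1
    refine ⟨⟨fun ω => -⨅ n, g n ω, ?_, ?_⟩, ?_⟩
    · exact (Measurable.iInf fun n => (hg n).measurable).neg.stronglyMeasurable
    · filter_upwards [hmω, ae_all_iff.2 hgφ] with ω h1 h2
      rw [h1]
      simp only [h2]
    · obtain ⟨c, hc⟩ := (hφ.mapsTo _ hX).2
      obtain ⟨d, hd⟩ := (hφ.mapsTo _ (hXs 0)).2
      refine ⟨max c d, ?_⟩
      filter_upwards [hmω, hc, hd, hle, hbdd] with ω h1 h2 h3 h4 h5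
      rw [h1, abs_neg]
      have h6 : ⨅ n, φ (Xs n) ω ≤ φ (Xs 0) ω := ciInf_le h5 0
      have h7 : φ X ω ≤ ⨅ n, φ (Xs n) ω := le_ciInf h4
      exact (abs_le_max_abs_abs h7 h6).trans (max_le_max h2 h3)
  have hmI := scale_mem_RInfST (hθ := hθ) hτθ hmL (indFrom_mem_RInfST hτθ)
  have hR : ∀ {Z : Process0 P}, Z ∈ RInfST P hτ hθ → Z ∈ RInf P ℱ := fun h =>
    ((mem_RInfST_iff hτ hθ hτθ).1 h).1
  have hYs := fun n => add_mem_RInfST hτθ (hXs n) hmI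
  have hY := add_mem_RInfST hτθ hX hmI
  -- The shifted sequence is uniformly bounded and converges pointwise, hence weakly, so closedness
  -- passes acceptability to the limit.
  have hacc : X + scale m (indFrom P hτ) ∈ acceptanceSet hτ hθ φ := by
    let := sigmaRA P ℱ
    refine hcl.mem_of_tendsto (b := atTop)
      (f := fun n => (⟨Xs n + scale m (indFrom P hτ), hR (hYs n)⟩ : RInf P ℱ))
      (x := ⟨X + scale m (indFrom P hτ), hR hY⟩) (tendsto_sigmaRA_iff.2 fun a ha => ?_)
      (Eventually.of_forall fun n => ⟨hYs n, ?_⟩)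
    · obtain ⟨c, hc⟩ := (hR hX).2
      obtain ⟨d, hd⟩ := (hR (hXs 0)).2
      obtain ⟨e, he⟩ := (hR hmI).2
      refine tendsto_pairing (c := max c d + e) ha ?_ ?_
      · filter_upwards [hc, hd, he, hXle, hanti',
          ae_all_iff.2 fun n => coeFn_process_add (Xs n) (scale m (indFrom P hτ))]
          with ω h1 h2 h3 h4 h5 h6 n t
        rw [h6]
        refine (abs_add_le _ _).trans (add_le_add ?_ (h3 t))
        exact (abs_le_max_abs_abs (h4 n t) (h5 t (Nat.zero_le n))).trans
          (max_le_max (h1 t) (h2 t))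
      · filter_upwards [hlim', coeFn_process_add X (scale m (indFrom P hτ)),
          ae_all_iff.2 fun n => coeFn_process_add (Xs n) (scale m (indFrom P hτ))]
          with ω h1 h2 h3 t
        simp only [h2, h3]
        exact (h1 t).add_const _
    · rw [hφ.cash _ (hXs n) _ hmL, ← AEEqFun.coeFn_le]
      filter_upwards [AEEqFun.coeFn_add (φ (Xs n)) m, hmω, hbdd,
        AEEqFun.coeFn_zero (β := ℝ) (μ := P)] with ω h1 h2 h3 h4
      rw [h1, h4, Pi.add_apply, h2, Pi.zero_apply]
      linarith [ciInf_le h3 n]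
  have hfin := hacc.2
  rw [hφ.cash _ hX _ hmL, ← AEEqFun.coeFn_le] at hfin
  filter_upwards [hfin, AEEqFun.coeFn_add (φ X) m, hmω, hbdd, hφanti, hle,
    AEEqFun.coeFn_zero (β := ℝ) (μ := P)] with ω h1 h2 h3 h4 h5 h6 h7
  rw [h2, h7, Pi.add_apply, h3, Pi.zero_apply] at h1
  have h8 : φ X ω = ⨅ n, φ (Xs n) ω := le_antisymm (le_ciInf h6) (by linarith)
  rw [h8]
  exact tendsto_atTop_ciInf h5 h4

lemma IsCoherent.map_zero (hφ : IsCoherent hτ hθ φ) (hτθ : ∀ᵐ ω ∂P, τ ω ≤ θ ω) : φ 0 = 0 := by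
  have h := hφ.homogeneous 0 (zero_mem_RInfST hτθ) (constRV P 0) (constRV_mem_LInfTau 0) le_rfl
  have h1 : scale (constRV P 0) (0 : Process0 P) = 0 := by
    refine process_ext ?_
    filter_upwards [coeFn_scale (constRV P 0) (0 : Process0 P), coeFn_process_zero (P := P)]
      with ω h1 h2 t
    rw [h1, h2, mul_zero]
  rw [h1] at h
  rw [h]
  refine AEEqFun.ext ?_
  filter_upwards [AEEqFun.coeFn_mul (constRV P 0) (φ 0), coeFn_constRV (P := P) 0,
    AEEqFun.coeFn_zero (β := ℝ) (μ := P)] with ω h2 h3 h4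
  rw [h2, Pi.mul_apply, h3, zero_mul, h4, Pi.zero_apply]

/-- The acceptance set is stable under bounded almost sure limits of its elements. -/
theorem nonneg_of_tendsto (hτθ : ∀ᵐ ω ∂P, τ ω ≤ θ ω) (hφ : IsMonetary hτ hθ φ)
    (hcont : ContinuousForBoundedDecreasing hτ hθ φ) {Xs : ℕ → Process0 P} {c : ℝ}
    (hXs : ∀ n, Xs n ∈ acceptanceSet hτ hθ φ) (hX : X ∈ RInfST P hτ hθ)
    (hc : ∀ᵐ ω ∂P, ∀ n t, |Xs n t ω| ≤ c)
    (hlim : ∀ᵐ ω ∂P, ∀ t, Tendsto (fun n => Xs n t ω) atTop (𝓝 (X t ω))) : 0 ≤ φ X := by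
  have hm : ∀ n t, Measurable fun ω => ⨆ k, Xs (n + k) t ω := fun n t =>
    Measurable.iSup fun k => (Xs (n + k) t).measurable
  -- The tail suprema decrease to X and dominate Xs n, so they are acceptable and the continuity
  -- hypothesis applies to them.
  let Y : ℕ → Process0 P := fun n t => AEEqFun.mk _ (hm n t).aestronglyMeasurable
  have hYω : ∀ᵐ ω ∂P, ∀ n t, Y n t ω = ⨆ k, Xs (n + k) t ω :=
    ae_all_iff.2 fun n => ae_all_iff.2 fun t => AEEqFun.coeFn_mk _ (hm n t).aestronglyMeasurable
  have hbdd : ∀ᵐ ω ∂P, ∀ n t, BddAbove (Set.range fun k => Xs (n + k) t ω) := by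
    filter_upwards [hc] with ω h n t
    exact ⟨c, by rintro _ ⟨k, rfl⟩; exact (abs_le.1 (h _ _)).2⟩
  have hXR := fun n => (mem_RInfST_iff hτ hθ hτθ).1 (hXs n).1
  have hYR : ∀ n, Y n ∈ RInfST P hτ hθ := fun n => by
    refine (mem_RInfST_iff hτ hθ hτθ).2 ⟨⟨fun t => ?_, c, ?_⟩, ?_⟩
    · choose g hg hgX using fun k => (hXR (n + k)).1.1 t
      refine ⟨fun ω => ⨆ k, g k ω,
        (Measurable.iSup fun k => (hg k).measurable).stronglyMeasurable, ?_⟩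
      filter_upwards [hYω, ae_all_iff.2 hgX] with ω h1 h2
      rw [h1]
      simp only [h2]
    · filter_upwards [hYω, hc, hbdd] with ω h1 h2 h3 t
      rw [h1]
      refine abs_le.2 ⟨(abs_le.1 (h2 n t)).1.trans (le_ciSup (h3 n t) 0), ciSup_le fun k => ?_⟩
      exact (abs_le.1 (h2 _ t)).2
    · filter_upwards [hYω, ae_all_iff.2 fun n => (hXR n).2] with ω h1 h2
      refine ⟨fun t ht => ?_, fun t ht => ?_⟩
      · rw [h1]
        simp only [(h2 _).1 t ht, ciSup_const]
      · rw [h1, h1]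
        simp only [(h2 _).2 t ht]
  have hanti : Antitone Y := antitone_nat_of_succ_le fun n => process_le_iff.2 <| by
    filter_upwards [hYω, hbdd] with ω h1 h2 t
    rw [h1, h1]
    refine ciSup_le fun k => ?_
    rw [add_assoc]
    exact le_ciSup (h2 n t) (1 + k)
  have hYlim : ∀ t, ∀ᵐ ω ∂P, Tendsto (fun n => Y n t ω) atTop (𝓝 (X t ω)) := fun t => by
    filter_upwards [hYω, hlim, hbdd] with ω h1 h2 h3
    simp only [h1]
    refine Metric.tendsto_atTop.2 fun ε hε => ?_
    obtain ⟨N, hN⟩ := Metric.tendsto_atTop.1 (h2 t) (ε / 2) (half_pos hε)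
    refine ⟨N, fun n hn => ?_⟩
    have h4 : ∀ k, |Xs (n + k) t ω - X t ω| < ε / 2 := fun k => hN _ (by omega)
    rw [Real.dist_eq, abs_lt]
    have h5 := le_ciSup (h3 n t) 0
    have h6 : ⨆ k, Xs (n + k) t ω ≤ X t ω + ε / 2 :=
      ciSup_le fun k => by linarith [(abs_lt.1 (h4 k)).2]
    have h7 := (abs_lt.1 (h4 0)).1
    constructor <;> linarith
  have hφY : ∀ᵐ ω ∂P, ∀ n, 0 ≤ φ (Y n) ω := ae_all_iff.2 fun n => by
    have h1 : Xs n ≤ Y n := process_le_iff.2 <| by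
      filter_upwards [hYω, hbdd] with ω h1 h2 t
      rw [h1]
      exact le_ciSup (h2 n t) 0
    filter_upwards [AEEqFun.coeFn_le.2 ((hXs n).2.trans (hφ.monotone _ (hXs n).1 _ (hYR n) h1)),
      AEEqFun.coeFn_zero (β := ℝ) (μ := P)] with ω h2 h3
    rwa [h3] at h2
  rw [← AEEqFun.coeFn_le]
  filter_upwards [hcont Y X hYR hX hanti hYlim, hφY, AEEqFun.coeFn_zero (β := ℝ) (μ := P)]
    with ω h1 h2 h3
  rw [h3]
  exact ge_of_tendsto' h1 h2

end Continuity

/-! ### Processes as functions on the optional space -/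

section OptionalSpace

variable {Ω : Type*} {mΩ : MeasurableSpace Ω}

/-- The space `ℕ × Ω`, with the optional `σ`-algebra of the filtration. -/
def OptSpace (_ : Filtration ℕ mΩ) : Type _ := ℕ × Ω

variable (ℱ : Filtration ℕ mΩ)

/-- The embedding of `Ω` as the section of `ℕ × Ω` at time `t`. -/
def optMk (t : ℕ) (ω : Ω) : OptSpace ℱ := (t, ω)

/-- The optional `σ`-algebra. -/
instance instMeasurableSpaceOptSpace : MeasurableSpace (OptSpace ℱ) :=
  ⨅ t, MeasurableSpace.map (optMk ℱ t) (ℱ t)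

lemma measurable_optMk_filtration (t : ℕ) :
    Measurable[ℱ t, instMeasurableSpaceOptSpace ℱ] (optMk ℱ t) := by
  rw [measurable_iff_le_map]
  exact iInf_le _ t

lemma measurable_optMk (t : ℕ) : Measurable (optMk ℱ t) :=
  (measurable_optMk_filtration ℱ t).mono (ℱ.le t) le_rfl

variable {ℱ} in
lemma measurable_optSpace {f : OptSpace ℱ → ℝ}
    (h : ∀ t, Measurable[ℱ t] fun ω => f (optMk ℱ t ω)) : Measurable f := fun B hB => by
  rw [MeasurableSpace.measurableSet_iInf]
  exact fun t => h t hB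

/-- The weight of the time `t` in `optMeasure`. -/
noncomputable def optWeight (t : ℕ) : ℝ≥0∞ := 2⁻¹ ^ (t + 1)

lemma optWeight_ne_zero (t : ℕ) : optWeight t ≠ 0 := pow_ne_zero _ (by simp)

lemma optWeight_ne_top (t : ℕ) : optWeight t ≠ ∞ := ENNReal.pow_ne_top (by simp)

/-- The measure `∑ₜ 2^{-t-1} δₜ ⊗ P` on the optional `σ`-algebra. -/
noncomputable def optMeasure (P : Measure Ω) : Measure (OptSpace ℱ) :=
  Measure.sum fun t => optWeight t • P.map (optMk ℱ t)

variable {P : Measure Ω}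

instance instIsFiniteMeasureOptMeasure [IsFiniteMeasure P] : IsFiniteMeasure (optMeasure ℱ P) := by
  refine ⟨?_⟩
  rw [optMeasure, Measure.sum_apply _ MeasurableSet.univ]
  have : ∀ t, (optWeight t • P.map (optMk ℱ t)) Set.univ = 2⁻¹ ^ (t + 1) * P Set.univ := fun t => by
    rw [Measure.smul_apply, Measure.map_apply (measurable_optMk ℱ t) MeasurableSet.univ]
    rfl
  simp_rw [this]
  rw [ENNReal.tsum_mul_right]
  refine ENNReal.mul_lt_top ?_ (measure_lt_top P _)
  rw [ENNReal.tsum_geometric_add_one]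
  exact ENNReal.mul_lt_top (by simp) (by simp [ENNReal.one_sub_inv_two])

variable {ℱ}

lemma ae_of_ae_optMeasure {p : OptSpace ℱ → Prop} (h : ∀ᵐ x ∂optMeasure ℱ P, p x) :
    ∀ᵐ ω ∂P, ∀ t, p (optMk ℱ t ω) := by
  refine ae_all_iff.2 fun t => ?_
  have h1 := Measure.ae_sum_iff.1 h t
  rw [Measure.ae_ennreal_smul_measure_iff (optWeight_ne_zero t)] at h1
  exact ae_of_ae_map (measurable_optMk ℱ t).aemeasurable h1

lemma ae_optMeasure_of_ae {p : OptSpace ℱ → Prop} (hp : MeasurableSet {x | p x})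
    (h : ∀ᵐ ω ∂P, ∀ t, p (optMk ℱ t ω)) : ∀ᵐ x ∂optMeasure ℱ P, p x := by
  refine Measure.ae_sum_iff.2 fun t => ?_
  rw [Measure.ae_ennreal_smul_measure_iff (optWeight_ne_zero t),
    ae_map_iff (measurable_optMk ℱ t).aemeasurable hp]
  exact h.mono fun ω hω => hω t

lemma lintegral_optMeasure {f : OptSpace ℱ → ℝ≥0∞} (hf : Measurable f) :
    ∫⁻ x, f x ∂optMeasure ℱ P = ∑' t, optWeight t * ∫⁻ ω, f (optMk ℱ t ω) ∂P := by
  rw [optMeasure, lintegral_sum_measure]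
  refine tsum_congr fun t => ?_
  rw [lintegral_smul_measure, lintegral_map hf (measurable_optMk ℱ t), smul_eq_mul]

lemma hasSum_integral_optMeasure {f : OptSpace ℱ → ℝ} (hf : Integrable f (optMeasure ℱ P))
    (hm : Measurable f) :
    HasSum (fun t => (optWeight t).toReal * ∫ ω, f (optMk ℱ t ω) ∂P)
      (∫ x, f x ∂optMeasure ℱ P) := by
  have h := hasSum_integral_measure (μ := fun t => optWeight t • P.map (optMk ℱ t)) hf
  refine h.congr_fun fun t => ?_
  rw [integral_smul_measure, integral_map (measurable_optMk ℱ t).aemeasurable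
    hm.aestronglyMeasurable, smul_eq_mul]

/-- The process of the sections of a function on the optional space. -/
noncomputable def slice (x : Lp ℝ 2 (optMeasure ℱ P)) : Process0 P := fun t =>
  AEEqFun.mk (fun ω => x (optMk ℱ t ω))
    ((Lp.stronglyMeasurable x).measurable.comp (measurable_optMk ℱ t)).aestronglyMeasurable

lemma coeFn_slice (x : Lp ℝ 2 (optMeasure ℱ P)) :
    ∀ᵐ ω ∂P, ∀ t, slice x t ω = x (optMk ℱ t ω) :=
  ae_all_iff.2 fun _ => AEEqFun.coeFn_mk _ _

variable [IsFiniteMeasure P]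

lemma slice_mem_RInf {x : Lp ℝ 2 (optMeasure ℱ P)} {c : ℝ}
    (hx : |x| ≤ c • oneL2 (optMeasure ℱ P)) :
    slice x ∈ RInf P ℱ ∧ ∀ᵐ ω ∂P, ∀ t, |slice x t ω| ≤ c := by
  have hb : ∀ᵐ ω ∂P, ∀ t, |slice x t ω| ≤ c := by
    filter_upwards [coeFn_slice x, ae_of_ae_optMeasure (abs_le_smul_oneL2_iff.1 hx)]
      with ω h1 h2 t
    rw [h1]
    exact h2 t
  refine ⟨⟨fun t => aestronglyMeasurable_mk ?_, c, hb⟩, hb⟩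
  exact ((Lp.stronglyMeasurable x).measurable.comp
    (measurable_optMk_filtration ℱ t)).stronglyMeasurable.aestronglyMeasurable

/-- Choose an F_t-measurable version of X t for each t; the glued function is optional because
measurability is tested section by section. -/
lemma exists_slice_eq {X : Process0 P} (hX : X ∈ R0 P ℱ) {c : ℝ}
    (hc : ∀ᵐ ω ∂P, ∀ t, |X t ω| ≤ c) : ∃ x : Lp ℝ 2 (optMeasure ℱ P),
      |x| ≤ c • oneL2 (optMeasure ℱ P) ∧ ∀ᵐ ω ∂P, ∀ t, x (optMk ℱ t ω) = X t ω := by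
  choose g hg hgX using hX
  have hf : Measurable (fun x : OptSpace ℱ => g x.1 x.2) :=
    measurable_optSpace fun t => (hg t).measurable
  have hb : ∀ᵐ x ∂optMeasure ℱ P, |g x.1 x.2| ≤ c := by
    refine ae_optMeasure_of_ae (measurableSet_le hf.abs measurable_const) ?_
    filter_upwards [hc, ae_all_iff.2 hgX] with ω h1 h2 t
    change |g t ω| ≤ c
    rw [← h2]
    exact h1 t
  have hm : MemLp (fun x : OptSpace ℱ => g x.1 x.2) 2 (optMeasure ℱ P) :=
    MemLp.of_bound hf.aestronglyMeasurable c hb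
  refine ⟨hm.toLp _, abs_le_smul_oneL2_iff.2 ?_, ?_⟩
  · filter_upwards [hm.coeFn_toLp, hb] with x h1 h2
    rwa [h1]
  · filter_upwards [ae_of_ae_optMeasure hm.coeFn_toLp, ae_all_iff.2 hgX] with ω h1 h2 t
    rw [h1, h2]
    rfl

end OptionalSpace

/-! ### Integrable densities as increments -/

section OptionalDensity

variable {Ω : Type*} {mΩ : MeasurableSpace Ω} {P : Measure Ω} [IsFiniteMeasure P]
  {ℱ : Filtration ℕ mΩ}

/-- An integrable density on the optional space is the density of the increments of a process of
integrable variation. -/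
theorem exists_mem_A1_of_density {Z : OptSpace ℱ → ℝ} (hZ : Integrable Z (optMeasure ℱ P)) :
    ∃ a ∈ A1 P ℱ, (∀ᵐ ω ∂P, ∀ t, incr a t ω = (optWeight t).toReal * Z (optMk ℱ t ω)) ∧
      ∀ (x : Lp ℝ 2 (optMeasure ℱ P)) (c : ℝ), |x| ≤ c • oneL2 (optMeasure ℱ P) →
        pairing (slice x) a = ∫ y, Z y * x y ∂optMeasure ℱ P := by
  set Z' := hZ.1.mk Z
  have hZm : Measurable Z' := hZ.1.stronglyMeasurable_mk.measurable
  have hZZ : Z =ᵐ[optMeasure ℱ P] Z' := hZ.1.ae_eq_mk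
  have hZi : Integrable Z' (optMeasure ℱ P) := hZ.congr hZZ
  have hm : ∀ t, Measurable[ℱ t] fun ω => (optWeight t).toReal * Z' (optMk ℱ t ω) := fun t =>
    (hZm.comp (measurable_optMk_filtration ℱ t)).const_mul _
  have hm' : ∀ t, AEStronglyMeasurable (fun ω => (optWeight t).toReal * Z' (optMk ℱ t ω)) P :=
    fun t => ((hm t).mono (ℱ.le t) le_rfl).aestronglyMeasurable
  -- The weight of time t in the measure is moved into the increment, so that summing over t
  -- reproduces the integral on the optional space.
  let D : Process0 P := fun t => AEEqFun.mk _ (hm' t)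
  have hD : ∀ᵐ ω ∂P, ∀ t, incr (ofIncr D) t ω = (optWeight t).toReal * Z' (optMk ℱ t ω) := by
    rw [incr_ofIncr]
    exact ae_all_iff.2 fun t => AEEqFun.coeFn_mk _ (hm' t)
  have hA : ofIncr D ∈ A1 P ℱ := by
    refine ⟨ofIncr_mem_R0 fun t => aestronglyMeasurable_mk
      (hm t).stronglyMeasurable.aestronglyMeasurable, ?_⟩
    calc ∫⁻ ω, ∑' t, ‖incr (ofIncr D) t ω‖ₑ ∂P
        = ∫⁻ ω, ∑' t, optWeight t * ‖Z' (optMk ℱ t ω)‖ₑ ∂P := by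
          refine lintegral_congr_ae (hD.mono fun ω h => tsum_congr fun t => ?_)
          rw [h, enorm_mul, Real.enorm_of_nonneg ENNReal.toReal_nonneg,
            ENNReal.ofReal_toReal (optWeight_ne_top t)]
      _ = ∫⁻ y, ‖Z' y‖ₑ ∂optMeasure ℱ P := by
          rw [lintegral_optMeasure hZm.enorm, lintegral_tsum (f := fun t ω =>
            optWeight t * ‖Z' (optMk ℱ t ω)‖ₑ) fun t =>
            (((hZm.comp (measurable_optMk ℱ t)).enorm).const_mul _).aemeasurable]
          exact tsum_congr fun t =>
            lintegral_const_mul _ (hZm.comp (measurable_optMk ℱ t)).enorm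
      _ < ∞ := hZi.2
  refine ⟨ofIncr D, hA, ?_, fun x c hx => ?_⟩
  · filter_upwards [hD, ae_of_ae_optMeasure hZZ] with ω h1 h2 t
    rw [h1, h2]
  · have hxb := (slice_mem_RInf hx).2
    have h1 : HasSum (fun t => ∫ ω, slice x t ω * incr (ofIncr D) t ω ∂P)
        (pairing (slice x) (ofIncr D)) := by
      refine hasSum_integral_of_dominated_convergence (fun t ω => c * |incr (ofIncr D) t ω|)
        (fun t => ((slice x t).measurable.mul
          (incr (ofIncr D) t).measurable).aestronglyMeasurable) (fun t => ?_) ?_ ?_ ?_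
      · filter_upwards [hxb] with ω h
        rw [norm_mul, Real.norm_eq_abs, Real.norm_eq_abs]
        exact mul_le_mul_of_nonneg_right (h t) (abs_nonneg _)
      · exact (ae_summable_of_mem_A1 hA).mono fun ω h => h.mul_left c
      · simp_rw [tsum_mul_left]
        exact (integrable_variation hA).const_mul c
      · exact (ae_summable_of_mem hA (slice_mem_RInf hx).1).mono fun ω h => h.hasSum
    have hZx : Integrable (fun y => Z' y * x y) (optMeasure ℱ P) :=
      integrable_mul_of_abs_le hZi hx
    have h2 := hasSum_integral_optMeasure hZx (hZm.mul (Lp.stronglyMeasurable x).measurable)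
    have h3 : ∫ y, Z y * x y ∂optMeasure ℱ P = ∫ y, Z' y * x y ∂optMeasure ℱ P :=
      integral_congr_ae (hZZ.mono fun y h => by simp only [h])
    rw [h3]
    refine h1.unique (h2.congr_fun fun t => ?_)
    rw [← integral_const_mul]
    refine integral_congr_ae ?_
    filter_upwards [hD, coeFn_slice x] with ω h4 h5
    rw [h4, h5]
    ring

end OptionalDensity

/-! ### Separating a process from the acceptance set -/

section Separation

lemma seqProj_congr {s e : WithTop ℕ} {x y : ℕ → ℝ} (h : ∀ t, x t = y t) (t : ℕ) :
    seqProj s e x t = seqProj s e y t := by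
  rw [funext h]

lemma seqProj_add (s e : WithTop ℕ) (x y : ℕ → ℝ) (t : ℕ) :
    seqProj s e (fun u => x u + y u) t = seqProj s e x t + seqProj s e y t := by
  unfold seqProj; split_ifs <;> simp

lemma seqProj_const_mul (s e : WithTop ℕ) (r : ℝ) (x : ℕ → ℝ) (t : ℕ) :
    seqProj s e (fun u => r * x u) t = r * seqProj s e x t := by
  unfold seqProj; split_ifs <;> simp

lemma seqProj_mono (s e : WithTop ℕ) {x y : ℕ → ℝ} (h : ∀ t, x t ≤ y t) (t : ℕ) :
    seqProj s e x t ≤ seqProj s e y t := by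
  unfold seqProj; split_ifs; exacts [h _, le_rfl]

lemma tendsto_seqProj (s e : WithTop ℕ) {xs : ℕ → ℕ → ℝ} {x : ℕ → ℝ}
    (h : ∀ t, Tendsto (fun n => xs n t) atTop (𝓝 (x t))) (t : ℕ) :
    Tendsto (fun n => seqProj s e (xs n) t) atTop (𝓝 (seqProj s e x t)) := by
  unfold seqProj; split_ifs; exacts [h _, tendsto_const_nhds]

variable {Ω : Type*} {mΩ : MeasurableSpace Ω} {P : Measure Ω} {ℱ : Filtration ℕ mΩ}
  {τ θ : Ω → WithTop ℕ}

lemma measurableSet_interval (hτ : IsStoppingTime ℱ τ) (hθ : IsStoppingTime ℱ θ) (t : ℕ) :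
    MeasurableSet[ℱ t] {ω | τ ω ≤ (t : WithTop ℕ) ∧ (t : WithTop ℕ) ≤ θ ω} :=
  (hτ t).inter (hθ.measurableSet_ge t)

variable (ℱ τ θ) in
/-- The stochastic interval `[τ, θ]` in the optional space. -/
def optInterval : Set (OptSpace ℱ) :=
  {x | τ x.2 ≤ (x.1 : WithTop ℕ) ∧ (x.1 : WithTop ℕ) ≤ θ x.2}

lemma measurableSet_optInterval (hτ : IsStoppingTime ℱ τ) (hθ : IsStoppingTime ℱ θ) :
    MeasurableSet (optInterval ℱ τ θ) := by
  rw [MeasurableSpace.measurableSet_iInf]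
  exact fun t => measurableSet_interval hτ hθ t

lemma nonneg_constRV {r : ℝ} (hr : 0 ≤ r) : 0 ≤ constRV P r := by
  rw [← AEEqFun.coeFn_le]
  filter_upwards [coeFn_constRV (P := P) r, AEEqFun.coeFn_zero (β := ℝ) (μ := P)] with ω h1 h2
  rwa [h1, h2]

lemma coeFn_nonneg_iff {f : Ω →ₘ[P] ℝ} : 0 ≤ f ↔ ∀ᵐ ω ∂P, 0 ≤ f ω := by
  rw [← AEEqFun.coeFn_le]
  constructor <;> intro h <;>
    filter_upwards [h, AEEqFun.coeFn_zero (β := ℝ) (μ := P)] with ω h1 h2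
  · rwa [h2] at h1
  · rwa [h2]

variable {hτ : IsStoppingTime ℱ τ} {hθ : IsStoppingTime ℱ θ}

lemma coeFn_proj_slice (x : Lp ℝ 2 (optMeasure ℱ P)) : ∀ᵐ ω ∂P, ∀ t,
    proj hτ hθ (slice x) t ω = seqProj (τ ω) (θ ω) (fun s => x (optMk ℱ s ω)) t := by
  filter_upwards [coeFn_proj hτ hθ (slice x), coeFn_slice x] with ω h1 h2 t
  rw [h1]
  exact seqProj_congr h2 t

lemma proj_slice_add (x y : Lp ℝ 2 (optMeasure ℱ P)) :
    proj hτ hθ (slice (x + y)) = proj hτ hθ (slice x) + proj hτ hθ (slice y) := by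
  refine process_ext ?_
  filter_upwards [coeFn_proj_slice (hτ := hτ) (hθ := hθ) x,
    coeFn_proj_slice (hτ := hτ) (hθ := hθ) y, coeFn_proj_slice (hτ := hτ) (hθ := hθ) (x + y),
    coeFn_process_add (proj hτ hθ (slice x)) (proj hτ hθ (slice y)),
    ae_of_ae_optMeasure (Lp.coeFn_add x y)] with ω h1 h2 h3 h4 h5 t
  rw [h3, h4, h1, h2, ← seqProj_add]
  exact seqProj_congr h5 t

lemma proj_slice_smul (r : ℝ) (x : Lp ℝ 2 (optMeasure ℱ P)) :
    proj hτ hθ (slice (r • x)) = scale (constRV P r) (proj hτ hθ (slice x)) := by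
  refine process_ext ?_
  filter_upwards [coeFn_proj_slice (hτ := hτ) (hθ := hθ) x,
    coeFn_proj_slice (hτ := hτ) (hθ := hθ) (r • x), coeFn_constRV (P := P) r,
    coeFn_scale (constRV P r) (proj hτ hθ (slice x)),
    ae_of_ae_optMeasure (Lp.coeFn_smul r x)] with ω h1 h2 h3 h4 h5 t
  rw [h2, h4, h1, h3, ← seqProj_const_mul]
  exact seqProj_congr h5 t

variable [IsProbabilityMeasure P] {φ : Process0 P → Ω →ₘ[P] ℝ}

variable (hτ hθ) in
/-- The bounded elements of `L²` of the optional space whose sections project to acceptable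
processes. -/
def acceptableL2 (φ : Process0 P → Ω →ₘ[P] ℝ) : Set (Lp ℝ 2 (optMeasure ℱ P)) :=
  {x | (∃ c : ℝ, |x| ≤ c • oneL2 (optMeasure ℱ P)) ∧ 0 ≤ φ (proj hτ hθ (slice x))}

lemma proj_slice_mem_RInfST {x : Lp ℝ 2 (optMeasure ℱ P)}
    (hx : ∃ c : ℝ, |x| ≤ c • oneL2 (optMeasure ℱ P)) : proj hτ hθ (slice x) ∈ RInfST P hτ hθ :=
  ⟨_, (slice_mem_RInf hx.choose_spec).1, rfl⟩

lemma smul_mem_acceptableL2 (hφ : IsCoherent hτ hθ φ) {x : Lp ℝ 2 (optMeasure ℱ P)}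
    (hx : x ∈ acceptableL2 hτ hθ φ) {r : ℝ} (hr : 0 ≤ r) : r • x ∈ acceptableL2 hτ hθ φ := by
  obtain ⟨⟨c, hc⟩, h0⟩ := hx
  refine ⟨⟨r * c, abs_le_smul_oneL2_iff.2 ?_⟩, ?_⟩
  · filter_upwards [abs_le_smul_oneL2_iff.1 hc, Lp.coeFn_smul r x] with y h1 h2
    rw [h2, Pi.smul_apply, smul_eq_mul, abs_mul, abs_of_nonneg hr]
    exact mul_le_mul_of_nonneg_left h1 hr
  · rw [proj_slice_smul, hφ.homogeneous _ (proj_slice_mem_RInfST ⟨c, hc⟩) _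
      (constRV_mem_LInfTau r) (nonneg_constRV hr), coeFn_nonneg_iff]
    filter_upwards [AEEqFun.coeFn_mul (constRV P r) (φ (proj hτ hθ (slice x))),
      coeFn_constRV (P := P) r, coeFn_nonneg_iff.1 h0] with ω h1 h2 h3
    rw [h1, Pi.mul_apply, h2]
    exact mul_nonneg hr h3

lemma convex_acceptableL2 (hφ : IsCoherent hτ hθ φ) : Convex ℝ (acceptableL2 hτ hθ φ) := by
  intro x hx y hy r s hr hs hrs
  have hrx := smul_mem_acceptableL2 hφ hx hr
  have hsy := smul_mem_acceptableL2 hφ hy hs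
  obtain ⟨c, hc⟩ := hrx.1
  obtain ⟨d, hd⟩ := hsy.1
  refine ⟨⟨c + d, ?_⟩, ?_⟩
  · rw [add_smul]
    exact (abs_add_le _ _).trans (add_le_add hc hd)
  · have hs1 : constRV P s = 1 - constRV P r := by
      refine AEEqFun.ext ?_
      filter_upwards [coeFn_constRV (P := P) s, coeFn_constRV (P := P) r,
        coeFn_one_sub (constRV P r)] with ω h1 h2 h3
      rw [h1, h3, h2]
      linarith
    have hr1 : constRV P r ≤ 1 := by
      rw [← AEEqFun.coeFn_le]
      filter_upwards [coeFn_constRV (P := P) r, AEEqFun.coeFn_one (β := ℝ) (μ := P)] with ω h1 h2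
      rw [h1, h2, Pi.one_apply]
      linarith
    have h := hφ.concave _ (proj_slice_mem_RInfST hx.1) _ (proj_slice_mem_RInfST hy.1) _
      (constRV_mem_LInfTau r) (nonneg_constRV hr) hr1
    rw [proj_slice_add, proj_slice_smul, proj_slice_smul, hs1]
    refine le_trans (coeFn_nonneg_iff.2 ?_) h
    filter_upwards [AEEqFun.coeFn_add (constRV P r * φ (proj hτ hθ (slice x)))
        ((1 - constRV P r) * φ (proj hτ hθ (slice y))),
      AEEqFun.coeFn_mul (constRV P r) (φ (proj hτ hθ (slice x))),
      AEEqFun.coeFn_mul (1 - constRV P r) (φ (proj hτ hθ (slice y))),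
      coeFn_constRV (P := P) r, coeFn_one_sub (constRV P r), coeFn_nonneg_iff.1 hx.2,
      coeFn_nonneg_iff.1 hy.2] with ω h1 h2 h3 h4 h5 h6 h7
    rw [h1, Pi.add_apply, h2, h3, Pi.mul_apply, Pi.mul_apply, h5, h4]
    have : 1 - r = s := by linarith
    rw [this]
    positivity

lemma acceptableL2_of_le (hφ : IsMonetary hτ hθ φ) {x y : Lp ℝ 2 (optMeasure ℱ P)}
    (hx : x ∈ acceptableL2 hτ hθ φ) (hxy : x ≤ y)
    (hy : ∃ c : ℝ, |y| ≤ c • oneL2 (optMeasure ℱ P)) : y ∈ acceptableL2 hτ hθ φ := by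
  refine ⟨hy, hx.2.trans (hφ.monotone _ (proj_slice_mem_RInfST hx.1) _
    (proj_slice_mem_RInfST hy) (process_le_iff.2 ?_))⟩
  filter_upwards [coeFn_proj_slice (hτ := hτ) (hθ := hθ) x,
    coeFn_proj_slice (hτ := hτ) (hθ := hθ) y, ae_of_ae_optMeasure (Lp.coeFn_le x y |>.2 hxy)]
    with ω h1 h2 h3 t
  rw [h1, h2]
  exact seqProj_mono _ _ h3 t

/-- An L²-convergent sequence has an almost everywhere convergent subsequence; the common bound and
`nonneg_of_tendsto` do the rest. -/
lemma isClosed_acceptableL2 (hτθ : ∀ᵐ ω ∂P, τ ω ≤ θ ω) (hφ : IsMonetary hτ hθ φ)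
    (hcont : ContinuousForBoundedDecreasing hτ hθ φ) (c : ℝ) :
    IsClosed {x | x ∈ acceptableL2 hτ hθ φ ∧ |x| ≤ c • oneL2 (optMeasure ℱ P)} := by
  refine IsSeqClosed.isClosed fun xs x hxs hlim => ?_
  obtain ⟨ns, -, hns⟩ := (tendstoInMeasure_of_tendsto_Lp hlim).exists_seq_tendsto_ae
  have hb : ∀ᵐ y ∂optMeasure ℱ P, ∀ n, |xs n y| ≤ c :=
    ae_all_iff.2 fun n => abs_le_smul_oneL2_iff.1 (hxs n).2
  have hx : |x| ≤ c • oneL2 (optMeasure ℱ P) := abs_le_smul_oneL2_iff.2 <| by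
    filter_upwards [hns, hb] with y h1 h2
    exact le_of_tendsto' h1.abs fun n => h2 _
  refine ⟨⟨⟨c, hx⟩, ?_⟩, hx⟩
  have hps : ∀ᵐ ω ∂P, ∀ n t, proj hτ hθ (slice (xs (ns n))) t ω
      = seqProj (τ ω) (θ ω) (fun s => xs (ns n) (optMk ℱ s ω)) t :=
    ae_all_iff.2 fun n => coeFn_proj_slice (xs (ns n))
  refine nonneg_of_tendsto (Xs := fun n => proj hτ hθ (slice (xs (ns n)))) (c := c) hτθ hφ hcont
    (fun n => ⟨proj_slice_mem_RInfST ⟨c, (hxs _).2⟩, (hxs _).1.2⟩)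
    (proj_slice_mem_RInfST ⟨c, hx⟩) ?_ ?_
  · filter_upwards [hps, ae_of_ae_optMeasure hb, hτθ] with ω h1 h2 h3 n t
    rw [h1]
    rcases seqProj_mem (fun s => xs (ns n) (optMk ℱ s ω)) h3 t with h4 | ⟨u, -, h4⟩
    · rw [h4, abs_zero]
      exact (abs_nonneg _).trans (h2 0 0)
    · rw [h4]
      exact h2 u _
  · filter_upwards [hps, ae_of_ae_optMeasure hns,
      coeFn_proj_slice (hτ := hτ) (hθ := hθ) x] with ω h1 h2 h3 t
    simp only [h1, h3]
    exact tendsto_seqProj _ _ h2 t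

/-- A process that is not acceptable is separated from the acceptance set by an increasing
process of integrable variation. -/
theorem exists_separating_process (hτθ : ∀ᵐ ω ∂P, τ ω ≤ θ ω) (hφ : IsCoherent hτ hθ φ)
    (hcont : ContinuousForBoundedDecreasing hτ hθ φ) {X₀ : Process0 P}
    (hX₀ : X₀ ∈ RInfST P hτ hθ) (h : ¬ 0 ≤ φ X₀) :
    ∃ a ∈ A1 P ℱ, (∀ t, 0 ≤ incr a t) ∧ SupportedOn τ θ a ∧ pairing X₀ a < 0 ∧
      ∀ X ∈ acceptanceSet hτ hθ φ, 0 ≤ pairing X a := by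
  classical
  have hS := measurableSet_optInterval (ℱ := ℱ) hτ hθ
  -- X is represented by its restriction to [τ, θ]. Projecting recovers X, which vanishes before τ
  -- and is constant after θ, and vanishing off the interval will allow the density to be cut off
  -- there.
  have hrep : ∀ X ∈ RInfST P hτ hθ, ∃ (x : Lp ℝ 2 (optMeasure ℱ P)) (c : ℝ),
      |x| ≤ c • oneL2 (optMeasure ℱ P) ∧ (∀ᵐ y ∂optMeasure ℱ P, y ∉ optInterval ℱ τ θ → x y = 0) ∧
      proj hτ hθ (slice x) = X ∧ ∀ᵐ ω ∂P, ∀ t : ℕ, τ ω ≤ (t : WithTop ℕ) →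
        (t : WithTop ℕ) ≤ θ ω → slice x t ω = X t ω := by
    intro X hX
    obtain ⟨⟨hXR, m, hm⟩, hXs⟩ := (mem_RInfST_iff hτ hθ hτθ).1 hX
    have hYm : ∀ t : ℕ, AEStronglyMeasurable[ℱ t]
        ({ω | τ ω ≤ (t : WithTop ℕ) ∧ (t : WithTop ℕ) ≤ θ ω}.indicator (X t)) P :=
      fun t => by
        obtain ⟨g, hg, hgX⟩ := hXR t
        refine ⟨_, hg.indicator (measurableSet_interval hτ hθ t), ?_⟩
        filter_upwards [hgX] with ω h
        simp only [Set.indicator_apply, h]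
    let Y : Process0 P := fun t => AEEqFun.mk _ ((hYm t).mono (ℱ.le t))
    have hYω : ∀ᵐ ω ∂P, ∀ t : ℕ, Y t ω =
        {ω | τ ω ≤ (t : WithTop ℕ) ∧ (t : WithTop ℕ) ≤ θ ω}.indicator (X t) ω :=
      ae_all_iff.2 fun t => AEEqFun.coeFn_mk _ ((hYm t).mono (ℱ.le t))
    obtain ⟨x, hx, hxY⟩ := exists_slice_eq (X := Y) (c := m)
      (fun t => aestronglyMeasurable_mk (hYm t)) <| by
      filter_upwards [hYω, hm] with ω h1 h2 t
      rw [h1, Set.indicator_apply]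
      split_ifs
      · exact h2 t
      · rw [abs_zero]; exact (abs_nonneg _).trans (h2 0)
    have hxX : ∀ᵐ ω ∂P, ∀ t : ℕ, τ ω ≤ (t : WithTop ℕ) → (t : WithTop ℕ) ≤ θ ω →
        slice x t ω = X t ω := by
      filter_upwards [hYω, hxY, coeFn_slice x] with ω h1 h2 h3 t h4 h5
      rw [h3, h2, h1]
      exact Set.indicator_of_mem (s := {ω | τ ω ≤ (t : WithTop ℕ) ∧ (t : WithTop ℕ) ≤ θ ω})
        ⟨h4, h5⟩ _
    refine ⟨x, m, hx, ?_, ?_, hxX⟩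
    · refine ae_optMeasure_of_ae ?_ ?_
      · have : {y | y ∉ optInterval ℱ τ θ → x y = 0} = optInterval ℱ τ θ ∪ {y | x y = 0} := by
          ext y; simp only [Set.mem_ofPred_eq, Set.mem_union]; tauto
        rw [this]
        exact hS.union ((Lp.stronglyMeasurable x).measurable (measurableSet_singleton 0))
      · filter_upwards [hYω, hxY] with ω h1 h2 t h3
        rw [h2, h1]
        exact Set.indicator_of_notMem
          (s := {ω | τ ω ≤ (t : WithTop ℕ) ∧ (t : WithTop ℕ) ≤ θ ω}) h3 _
    · rw [← proj_eq_self hτ hθ hτθ hXs]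
      refine process_ext ?_
      filter_upwards [coeFn_proj hτ hθ (slice x), coeFn_proj hτ hθ X, hxX, hτθ]
        with ω h1 h2 h3 h4 t
      rw [h1, h2]
      rcases lt_or_ge (t : WithTop ℕ) (τ ω) with h5 | h5
      · rw [seqProj_of_lt h5, seqProj_of_lt h5]
      · rcases le_or_gt (t : WithTop ℕ) (θ ω) with h6 | h6
        · rw [seqProj_of_le h5 h6, seqProj_of_le h5 h6, h3 t h5 h6]
        · obtain ⟨k, hk⟩ := exists_natCast_of_le h6.le
          have h7 : k ≤ t := by rw [hk] at h6; exact_mod_cast h6.le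
          rw [hk] at h4
          rw [hk, seqProj_of_ge h4 h7, seqProj_of_ge h4 h7, h3 k h4 hk.ge]
  obtain ⟨x₀, c₀, hx₀, hx₀S, hpx₀, hx₀X⟩ := hrep X₀ hX₀
  obtain ⟨Z, hZ, u, hu, huC⟩ := exists_separating_density (convex_acceptableL2 hφ)
    (fun x hx => hx.1) (fun x hx y hxy hy => acceptableL2_of_le hφ.toIsMonetary hx hxy hy)
    (isClosed_acceptableL2 hτθ hφ.toIsMonetary hcont) hx₀ (fun hx => h (hpx₀ ▸ hx.2))
  have hzero : (0 : Lp ℝ 2 (optMeasure ℱ P)) ∈ acceptableL2 hτ hθ φ := by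
    have h1 : proj hτ hθ (slice (0 : Lp ℝ 2 (optMeasure ℱ P))) = 0 := by
      refine process_ext ?_
      filter_upwards [coeFn_proj_slice (hτ := hτ) (hθ := hθ) (0 : Lp ℝ 2 (optMeasure ℱ P)),
        coeFn_process_zero (P := P), ae_of_ae_optMeasure (Lp.coeFn_zero ℝ 2 (optMeasure ℱ P))]
        with ω h1 h2 h3 t
      rw [h1, h2, seqProj_congr h3]
      unfold seqProj
      simp
    refine ⟨⟨0, by simp⟩, ?_⟩
    rw [h1, hφ.map_zero hτθ]
  -- A linear functional bounded below on a cone is non-negative on it.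
  have hC : ∀ x ∈ acceptableL2 hτ hθ φ, 0 ≤ ∫ y, Z y * x y ∂optMeasure ℱ P := by
    intro x hx
    by_contra! hneg
    set v := ∫ y, Z y * x y ∂optMeasure ℱ P
    have h1 : ∀ r : ℝ, 0 ≤ r → u ≤ r * v := fun r hr => by
      refine (huC _ (smul_mem_acceptableL2 hφ hx hr)).trans_eq ?_
      rw [← integral_const_mul]
      refine integral_congr_ae ((Lp.coeFn_smul r x).mono fun y hy => ?_)
      simp only [hy, Pi.smul_apply, smul_eq_mul]
      ring
    -- This multiple of x has the value -(|u| + 1), which is below u.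
    have h2 := h1 ((|u| + 1) / (-v)) (by have : 0 < -v := by linarith
                                         positivity)
    have h3 : (|u| + 1) / (-v) * v = -(|u| + 1) := by
      rw [div_neg, neg_mul, div_mul_cancel₀ _ hneg.ne]
    rw [h3] at h2
    linarith [neg_abs_le u]
  have hu0 : u ≤ 0 := by
    have h1 := huC 0 hzero
    have h2 : ∫ y, Z y * (0 : Lp ℝ 2 (optMeasure ℱ P)) y ∂optMeasure ℱ P = 0 := by
      refine integral_eq_zero_of_ae ((Lp.coeFn_zero ℝ 2 (optMeasure ℱ P)).mono fun y hy => ?_)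
      simp only [hy, Pi.zero_apply, mul_zero]
    exact h1.trans_eq h2
  -- Indicators are acceptable because they are non-negative, so Z has non-negative integral over
  -- every measurable set.
  have hZ0 : 0 ≤ᵐ[optMeasure ℱ P] Z := by
    refine ae_nonneg_of_forall_setIntegral_nonneg hZ fun s hs _ => ?_
    have hm : MemLp (s.indicator fun _ => (1 : ℝ)) 2 (optMeasure ℱ P) :=
      (memLp_const 1).indicator hs
    have h1 : hm.toLp _ ∈ acceptableL2 hτ hθ φ := by
      refine acceptableL2_of_le hφ.toIsMonetary hzero (Lp.coeFn_le _ _ |>.1 ?_)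
        ⟨1, abs_le_smul_oneL2_iff.2 ?_⟩
      · filter_upwards [hm.coeFn_toLp, Lp.coeFn_zero ℝ 2 (optMeasure ℱ P)] with y h1 h2
        rw [h1, h2]
        exact Set.indicator_nonneg (fun _ _ => zero_le_one) y
      · filter_upwards [hm.coeFn_toLp] with y h1
        rw [h1, Set.indicator_apply]
        split_ifs <;> simp
    refine (hC _ h1).trans_eq ?_
    rw [← integral_indicator hs]
    refine integral_congr_ae (hm.coeFn_toLp.mono fun y hy => ?_)
    simp only [hy, Set.indicator_apply]
    split_ifs <;> simp
  -- Cutting Z off outside [τ, θ] puts the increments on the interval without changing pairings with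
  -- the representatives, which vanish there.
  obtain ⟨a, ha, hinc, hpair⟩ := exists_mem_A1_of_density (hZ.indicator hS)
  have has : SupportedOn τ θ a := by
    filter_upwards [hinc] with ω h1 t ht
    rw [h1, Set.indicator_of_notMem (s := optInterval ℱ τ θ) (a := optMk ℱ t ω) ht, mul_zero]
  have hpair' : ∀ x : Lp ℝ 2 (optMeasure ℱ P), ∀ c : ℝ, |x| ≤ c • oneL2 (optMeasure ℱ P) →
      (∀ᵐ y ∂optMeasure ℱ P, y ∉ optInterval ℱ τ θ → x y = 0) →
      pairing (slice x) a = ∫ y, Z y * x y ∂optMeasure ℱ P := fun x c hx hxS => by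
    rw [hpair x c hx]
    refine integral_congr_ae (hxS.mono fun y hy => ?_)
    by_cases hyS : y ∈ optInterval ℱ τ θ
    · simp only [Set.indicator_of_mem hyS]
    · simp only [hy hyS, mul_zero]
  refine ⟨a, ha, incr_nonneg_iff.2 ?_, has, ?_, fun X hX => ?_⟩
  · filter_upwards [hinc, ae_of_ae_optMeasure hZ0] with ω h1 h2 t
    rw [h1]
    refine mul_nonneg ENNReal.toReal_nonneg ?_
    rw [Set.indicator_apply]
    split_ifs
    exacts [h2 t, le_rfl]
  · rw [← pairing_congr has hx₀X, hpair' x₀ c₀ hx₀ hx₀S]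
    linarith
  · obtain ⟨x, c, hx, hxS, hpx, hxX⟩ := hrep X hX.1
    rw [← pairing_congr has hxX, hpair' x c hx hxS]
    exact hC x ⟨⟨c, hx⟩, hpx ▸ hX.2⟩

end Separation

/-! ### Series in A¹ -/

section CountableSums

variable {Ω : Type*} {mΩ : MeasurableSpace Ω} {P : Measure Ω} {ℱ : Filtration ℕ mΩ}

lemma measurable_tsum_real {α : Type*} {m : MeasurableSpace α} {g : ℕ → α → ℝ}
    (h : ∀ n, Measurable (g n)) : Measurable fun x => ∑' n, g n x := Measurable.tsum h

lemma ofIncr_mem_A1 {D : Process0 P} (hD : D ∈ R0 P ℱ)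
    (h : ∫⁻ ω, ∑' t, ‖D t ω‖ₑ ∂P < ∞) : ofIncr D ∈ A1 P ℱ :=
  ⟨ofIncr_mem_R0 hD, by rwa [incr_ofIncr]⟩

/-- Series of processes of integrable variation. -/
theorem exists_hasSum_A1 {b : ℕ → Process0 P} (hb : ∀ n, b n ∈ R0 P ℱ)
    (h : ∑' n, ∫⁻ ω, ∑' t, ‖incr (b n) t ω‖ₑ ∂P < ∞) : ∃ a ∈ A1 P ℱ,
      (∀ᵐ ω ∂P, ∀ t, HasSum (fun n => incr (b n) t ω) (incr a t ω)) ∧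
      ∀ X ∈ RInf P ℱ, HasSum (fun n => pairing X (b n)) (pairing X a) := by
  have hm : ∀ n t, Measurable fun ω => ‖incr (b n) t ω‖ₑ := fun n t =>
    (incr (b n) t).measurable.enorm
  -- By Tonelli the double series over n and t converges absolutely almost surely; the remaining
  -- steps are interchanges of summation.
  have hfin : ∫⁻ ω, ∑' n, ∑' t, ‖incr (b n) t ω‖ₑ ∂P < ∞ := by
    rwa [lintegral_tsum fun n => (Measurable.tsum fun t => hm n t).aemeasurable]
  have hae : ∀ᵐ ω ∂P, ∑' n, ∑' t, ‖incr (b n) t ω‖ₑ < ∞ :=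
    ae_lt_top (Measurable.tsum fun n => Measurable.tsum fun t => hm n t) hfin.ne
  have hsum : ∀ᵐ ω ∂P, Summable fun p : ℕ × ℕ => |incr (b p.1) p.2 ω| := by
    filter_upwards [hae] with ω h1
    rw [← ENNReal.tsum_prod] at h1
    have h2 := ENNReal.summable_toReal h1.ne
    simpa using h2
  have hDm : ∀ t, Measurable fun ω => ∑' n, incr (b n) t ω := fun t =>
    Measurable.tsum fun n => (incr (b n) t).measurable
  let D : Process0 P := fun t => AEEqFun.mk _ (hDm t).aestronglyMeasurable
  have hDω : ∀ᵐ ω ∂P, ∀ t, D t ω = ∑' n, incr (b n) t ω :=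
    ae_all_iff.2 fun t => AEEqFun.coeFn_mk _ (hDm t).aestronglyMeasurable
  have hD : D ∈ R0 P ℱ := fun t => by
    choose g hg hgb using fun n => incr_mem_R0 (hb n) t
    refine ⟨fun ω => ∑' n, g n ω,
      (measurable_tsum_real fun n => (hg n).measurable).stronglyMeasurable, ?_⟩
    filter_upwards [hDω, ae_all_iff.2 hgb] with ω h1 h2
    rw [h1]
    exact tsum_congr h2
  have hA : ofIncr D ∈ A1 P ℱ := by
    refine ofIncr_mem_A1 hD (lt_of_le_of_lt (lintegral_mono_ae ?_) hfin)
    filter_upwards [hDω] with ω h1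
    rw [ENNReal.tsum_comm]
    refine ENNReal.tsum_le_tsum fun t => ?_
    rw [h1]
    exact enorm_tsum_le_tsum_enorm
  have hinc : ∀ᵐ ω ∂P, ∀ t, HasSum (fun n => incr (b n) t ω) (incr (ofIncr D) t ω) := by
    rw [incr_ofIncr]
    filter_upwards [hDω, hsum] with ω h1 h2 t
    rw [h1]
    exact (h2.of_abs.prod_symm.prod_factor t).hasSum
  refine ⟨ofIncr D, hA, hinc, fun X ⟨hXR, m, hX⟩ => ?_⟩
  have hsumI : Integrable (fun ω => ∑' p : ℕ × ℕ, |incr (b p.1) p.2 ω|) P := by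
    refine ⟨(Measurable.tsum fun p : ℕ × ℕ =>
      (incr (b p.1) p.2).measurable.abs).aestronglyMeasurable, ?_⟩
    refine lt_of_le_of_lt (lintegral_mono fun ω => enorm_tsum_le_tsum_enorm) ?_
    simp_rw [Real.enorm_abs]
    refine lt_of_le_of_lt (lintegral_mono fun ω => ?_) hfin
    exact (ENNReal.tsum_prod (f := fun n t => ‖incr (b n) t ω‖ₑ)).le
  have hXsum : ∀ᵐ ω ∂P, Summable fun p : ℕ × ℕ => X p.2 ω * incr (b p.1) p.2 ω := by
    filter_upwards [hsum, hX] with ω h1 h2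
    refine Summable.of_norm_bounded (h1.mul_left m) fun p => ?_
    rw [norm_mul, Real.norm_eq_abs, Real.norm_eq_abs]
    exact mul_le_mul_of_nonneg_right (h2 _) (abs_nonneg _)
  change HasSum (fun n => ∫ ω, totalSum X (b n) ω ∂P) (∫ ω, totalSum X (ofIncr D) ω ∂P)
  refine hasSum_integral_of_dominated_convergence
    (fun n ω => m * ∑' t, |incr (b n) t ω|)
    (fun n => (measurable_totalSum X (b n)).aestronglyMeasurable) (fun n => ?_) ?_ ?_ ?_
  · filter_upwards [hsum, hX] with ω h3 h4
    rw [← tsum_mul_left]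
    refine tsum_of_norm_bounded ((h3.prod_factor n).mul_left m).hasSum fun t => ?_
    rw [norm_mul, Real.norm_eq_abs, Real.norm_eq_abs]
    exact mul_le_mul_of_nonneg_right (h4 _) (abs_nonneg _)
  · filter_upwards [hsum] with ω h3 using h3.prod.mul_left m
  · simp_rw [tsum_mul_left]
    refine (hsumI.congr ?_).const_mul m
    filter_upwards [hsum] with ω h3 using h3.tsum_prod
  · filter_upwards [hXsum, hinc] with ω h3 h4
    -- The double series is summed over n first, which gives the total sum for the limit process,
    -- and then reordered to be summed over t first.
    have h5 : HasSum (fun p : ℕ × ℕ => X p.1 ω * incr (b p.2) p.1 ω)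
        (totalSum X (ofIncr D) ω) := by
      have h6 := h3.prod_symm.hasSum
      have h7 := h6.prod_fiberwise fun t => (h4 t).mul_left (X t ω)
      rw [totalSum, h7.tsum_eq]
      exact h6
    have h6 := (Equiv.prodComm ℕ ℕ).hasSum_iff.2 h5
    exact h6.prod_fiberwise fun n => (h3.prod_factor n).hasSum

end CountableSums

/-! ### The dual cone and normalisation of conditional mass -/

section DualCone

variable {Ω : Type*} {mΩ : MeasurableSpace Ω} {P : Measure Ω}
  {ℱ : Filtration ℕ mΩ} {τ θ : Ω → WithTop ℕ} {hτ : IsStoppingTime ℱ τ} {hθ : IsStoppingTime ℱ θ}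
  {φ : Process0 P → Ω →ₘ[P] ℝ} {X a b : Process0 P}

variable (hτ hθ) in
/-- The increasing processes of integrable variation on `[τ, θ]` that are conditionally
non-negative on the acceptance set. -/
def dualCone (φ : Process0 P → Ω →ₘ[P] ℝ) : Set (Process0 P) :=
  {a | a ∈ A1 P ℱ ∧ (∀ t, 0 ≤ incr a t) ∧ SupportedOn τ θ a ∧
    ∀ X ∈ acceptanceSet hτ hθ φ, 0 ≤ condPairing hτ θ X a}

lemma RInf_of_acceptanceSet (hτθ : ∀ᵐ ω ∂P, τ ω ≤ θ ω) (hX : X ∈ acceptanceSet hτ hθ φ) :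
    X ∈ RInf P ℱ := ((mem_RInfST_iff hτ hθ hτθ).1 hX.1).1

lemma IsCoherent.map_scale_indFrom (hτθ : ∀ᵐ ω ∂P, τ ω ≤ θ ω) (hφ : IsCoherent hτ hθ φ)
    {f : Ω →ₘ[P] ℝ} (hf : f ∈ LInfTau P hτ) : φ (scale f (indFrom P hτ)) = f := by
  have h := hφ.cash 0 (zero_mem_RInfST hτθ) f hf
  rwa [zero_add, hφ.map_zero hτθ, zero_add] at h

lemma indFrom_mem_acceptanceSet (hτθ : ∀ᵐ ω ∂P, τ ω ≤ θ ω) (hφ : IsCoherent hτ hθ φ) :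
    indFrom P hτ ∈ acceptanceSet hτ hθ φ := by
  refine ⟨indFrom_mem_RInfST hτθ, ?_⟩
  rw [← hφ.map_zero hτθ]
  refine hφ.monotone _ (zero_mem_RInfST hτθ) _ (indFrom_mem_RInfST hτθ) (process_le_iff.2 ?_)
  filter_upwards [coeFn_indFrom (P := P) hτ, coeFn_process_zero (P := P)] with ω h1 h2 t
  rw [h1, h2]
  split_ifs <;> simp

lemma scale_ind_mem_acceptanceSet (hτθ : ∀ᵐ ω ∂P, τ ω ≤ θ ω) (hφ : IsCoherent hτ hθ φ)
    (hX : X ∈ acceptanceSet hτ hθ φ) {B : Set Ω} (hB : MeasurableSet[hτ.measurableSpace] B) :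
    scale (ind hτ hB) X ∈ acceptanceSet hτ hθ φ := by
  refine ⟨scale_mem_RInfST hτθ (ind_mem_LInfTau hτ hB) hX.1, ?_⟩
  rw [hφ.localProp _ hX.1, coeFn_nonneg_iff]
  filter_upwards [AEEqFun.coeFn_mul (ind hτ hB) (φ X), coeFn_nonneg_iff.1 hX.2,
    coeFn_nonneg_iff.1 (ind_nonneg (P := P) hτ hB)] with ω h1 h2 h3
  rw [h1]
  exact mul_nonneg h3 h2

lemma add_mem_dualCone (hτθ : ∀ᵐ ω ∂P, τ ω ≤ θ ω) (ha : a ∈ dualCone hτ hθ φ)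
    (hb : b ∈ dualCone hτ hθ φ) : a + b ∈ dualCone hτ hθ φ := by
  refine ⟨add_mem_A1 ha.1 hb.1, incr_nonneg_iff.2 ?_, ha.2.2.1.add hb.2.2.1, fun X hX => ?_⟩
  · rw [incr_add]
    filter_upwards [coeFn_process_add (incr a) (incr b), incr_nonneg_iff.1 ha.2.1,
      incr_nonneg_iff.1 hb.2.1] with ω h1 h2 h3 t
    rw [h1]
    exact add_nonneg (h2 t) (h3 t)
  · rw [condPairing_add_right ha.1 ha.2.2.1 hb.1 hb.2.2.1 (RInf_of_acceptanceSet hτθ hX),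
      coeFn_nonneg_iff]
    filter_upwards [AEEqFun.coeFn_add (condPairing hτ θ X a) (condPairing hτ θ X b),
      coeFn_nonneg_iff.1 (ha.2.2.2 X hX), coeFn_nonneg_iff.1 (hb.2.2.2 X hX)] with ω h1 h2 h3
    rw [h1]
    exact add_nonneg h2 h3

lemma scale_mem_dualCone (hτθ : ∀ᵐ ω ∂P, τ ω ≤ θ ω) (ha : a ∈ dualCone hτ hθ φ)
    {f : Ω →ₘ[P] ℝ} (hf : AEStronglyMeasurable[hτ.measurableSpace] f P) (hf0 : 0 ≤ f)
    (hfa : scale f a ∈ A1 P ℱ) : scale f a ∈ dualCone hτ hθ φ := by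
  refine ⟨hfa, incr_nonneg_iff.2 ?_, ha.2.2.1.scale f, fun X hX => ?_⟩
  · rw [incr_scale]
    filter_upwards [coeFn_scale f (incr a), incr_nonneg_iff.1 ha.2.1, coeFn_nonneg_iff.1 hf0]
      with ω h1 h2 h3 t
    rw [h1]
    exact mul_nonneg h3 (h2 t)
  · rw [condPairing_scale_right ha.1 ha.2.2.1 (RInf_of_acceptanceSet hτθ hX) hf hfa,
      coeFn_nonneg_iff]
    filter_upwards [AEEqFun.coeFn_mul f (condPairing hτ θ X a), coeFn_nonneg_iff.1 hf0,
      coeFn_nonneg_iff.1 (ha.2.2.2 X hX)] with ω h1 h2 h3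
    rw [h1]
    exact mul_nonneg h2 h3

variable [IsProbabilityMeasure P]

/-- The acceptance set is stable under multiplication by 1_B for B in F_τ, so scalar non-negativity
already yields conditional non-negativity. -/
lemma mem_dualCone_of_pairing (hτθ : ∀ᵐ ω ∂P, τ ω ≤ θ ω) (hφ : IsCoherent hτ hθ φ)
    (ha : a ∈ A1 P ℱ) (ha0 : ∀ t, 0 ≤ incr a t) (has : SupportedOn τ θ a)
    (h : ∀ X ∈ acceptanceSet hτ hθ φ, 0 ≤ pairing X a) : a ∈ dualCone hτ hθ φ := by
  refine ⟨ha, ha0, has, fun X hX => ?_⟩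
  refine (condPairing_nonneg_iff ha has (RInf_of_acceptanceSet hτθ hX)).2 fun B => ?_
  rw [setIntegral_totalSum_eq_pairing_left B.2]
  exact h _ (scale_ind_mem_acceptanceSet hτθ hφ hX B.2)

lemma pairing_nonneg_of_mem_dualCone (hτθ : ∀ᵐ ω ∂P, τ ω ≤ θ ω) (ha : a ∈ dualCone hτ hθ φ)
    (hX : X ∈ acceptanceSet hτ hθ φ) : 0 ≤ pairing X a := by
  rw [← integral_condPairing (hτ := hτ) ha.1 ha.2.2.1 (RInf_of_acceptanceSet hτθ hX)]
  exact integral_nonneg_of_ae (coeFn_nonneg_iff.1 (ha.2.2.2 X hX))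

/-- The conditional mass of a process with positive conditional mass can be normalised. -/
lemma exists_normalization (hθ : IsStoppingTime ℱ θ) (hτθ : ∀ᵐ ω ∂P, τ ω ≤ θ ω) (ha : a ∈ A1 P ℱ)
    (ha0 : ∀ t, 0 ≤ incr a t) (has : SupportedOn τ θ a)
    (hpos : ∀ᵐ ω ∂P, 0 < condPairing hτ θ (indFrom P hτ) a ω) :
    ∃ f : Ω →ₘ[P] ℝ, AEStronglyMeasurable[hτ.measurableSpace] f P ∧ 0 ≤ f ∧
      scale f a ∈ A1 P ℱ ∧ ∀ᵐ ω ∂P, f ω * condPairing hτ θ (indFrom P hτ) a ω = 1 := by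
  set d := condPairing hτ θ (indFrom P hτ) a
  obtain ⟨g, hg, hgd⟩ := aestronglyMeasurable_condPairing (θ := θ) hτ (indFrom P hτ) a
  have hfm : StronglyMeasurable[hτ.measurableSpace] fun ω => (g ω)⁻¹ :=
    (measurable_inv.comp hg.measurable).stronglyMeasurable
  -- Bounded truncations of the reciprocal mass: with them the factor may be pulled out before
  -- integrability of the untruncated product is known.
  have hnm : ∀ n : ℕ, StronglyMeasurable[hτ.measurableSpace] fun ω => min |(g ω)⁻¹| (n : ℝ) :=
    fun n => (((measurable_inv (G := ℝ)).abs.min measurable_const).comp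
      hg.measurable).stronglyMeasurable
  have hle := hτ.measurableSpace_le
  let f : Ω →ₘ[P] ℝ := AEEqFun.mk _ (hfm.mono hle).aestronglyMeasurable
  let fn : ℕ → Ω →ₘ[P] ℝ := fun n => AEEqFun.mk _ ((hnm n).mono hle).aestronglyMeasurable
  have hfω : ∀ᵐ ω ∂P, f ω = (g ω)⁻¹ := AEEqFun.coeFn_mk _ (hfm.mono hle).aestronglyMeasurable
  have hfnω : ∀ᵐ ω ∂P, ∀ n : ℕ, fn n ω = min |(g ω)⁻¹| (n : ℝ) :=
    ae_all_iff.2 fun n => AEEqFun.coeFn_mk _ ((hnm n).mono hle).aestronglyMeasurable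
  have hfL : AEStronglyMeasurable[hτ.measurableSpace] f P :=
    aestronglyMeasurable_mk hfm.aestronglyMeasurable
  have hfnL : ∀ n, fn n ∈ LInfTau P hτ := fun n => by
    refine ⟨aestronglyMeasurable_mk (hnm n).aestronglyMeasurable, n, ?_⟩
    filter_upwards [hfnω] with ω h1
    rw [h1, abs_of_nonneg (le_min (abs_nonneg _) (Nat.cast_nonneg n))]
    exact min_le_right _ _
  have hI : indFrom P hτ ∈ RInf P ℱ := ((mem_RInfST_iff hτ hθ hτθ).1 (indFrom_mem_RInfST hτθ)).1
  -- For an increasing process supported on [τ, θ], its mass on [τ, ∞) is its total variation.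
  have hV : totalSum (indFrom P hτ) a =ᵐ[P] variation a := by
    filter_upwards [coeFn_indFrom (P := P) hτ, has, incr_nonneg_iff.1 ha0] with ω h1 h2 h3
    refine tsum_congr fun t => ?_
    rw [h1, abs_of_nonneg (h3 t)]
    split_ifs with h4
    · rw [one_mul]
    · rw [h2 t fun h5 => h4 h5.1, mul_zero]
  have hn : ∀ n, ∫⁻ ω, ‖fn n ω * variation a ω‖ₑ ∂P ≤ 1 := fun n => by
    have hXn : scale (fn n) (indFrom P hτ) ∈ RInf P ℱ :=
      ((mem_RInfST_iff hτ hθ hτθ).1 (scale_mem_RInfST hτθ (hfnL n) (indFrom_mem_RInfST hτθ))).1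
    have h1 : (fun ω => fn n ω * variation a ω) =ᵐ[P] totalSum (scale (fn n) (indFrom P hτ)) a := by
      filter_upwards [totalSum_scale_left (fn n) (indFrom P hτ) a, hV] with ω h1 h2
      rw [h1, h2]
    have h2 : 0 ≤ᵐ[P] fun ω => fn n ω * variation a ω := by
      filter_upwards [hfnω] with ω h1
      rw [h1]
      exact mul_nonneg (le_min (abs_nonneg _) (Nat.cast_nonneg n))
        (tsum_nonneg fun _ => abs_nonneg _)
    have h3 : ∫ ω, fn n ω * variation a ω ∂P ≤ 1 := by
      rw [integral_congr_ae h1]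
      change pairing _ a ≤ 1
      rw [← integral_condPairing (hτ := hτ) ha has hXn, condPairing_scale_left ha has hI (hfnL n)]
      refine (integral_mono_of_nonneg (g := fun _ => (1 : ℝ)) ?_ (integrable_const _) ?_).trans_eq
        (by simp)
      · filter_upwards [AEEqFun.coeFn_mul (fn n) d, hfnω, hpos] with ω h4 h5 h6
        rw [h4, Pi.mul_apply, h5]
        exact mul_nonneg (le_min (abs_nonneg _) (Nat.cast_nonneg n)) h6.le
      · filter_upwards [AEEqFun.coeFn_mul (fn n) d, hfnω, hpos, hgd] with ω h4 h5 h6 h7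
        rw [h4, Pi.mul_apply, h5, ← h7, abs_of_pos (inv_pos.2 h6)]
        calc min (d ω)⁻¹ (n : ℝ) * d ω ≤ (d ω)⁻¹ * d ω :=
              mul_le_mul_of_nonneg_right (min_le_left _ _) h6.le
          _ = 1 := inv_mul_cancel₀ h6.ne'
    calc ∫⁻ ω, ‖fn n ω * variation a ω‖ₑ ∂P
        = ∫⁻ ω, ENNReal.ofReal (fn n ω * variation a ω) ∂P :=
          lintegral_congr_ae (h2.mono fun ω h => Real.enorm_of_nonneg h)
      _ = ENNReal.ofReal (∫ ω, fn n ω * variation a ω ∂P) :=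
          (ofReal_integral_eq_lintegral_ofReal
            ((integrable_totalSum_of_mem ha hXn).congr h1.symm) h2).symm
      _ ≤ 1 := ENNReal.ofReal_le_one.2 h3
  have hf0 : 0 ≤ f := coeFn_nonneg_iff.2 <| by
    filter_upwards [hfω, hpos, hgd] with ω h1 h2 h3
    rw [h1, ← h3]
    exact (inv_pos.2 h2).le
  refine ⟨f, hfL, hf0, scale_mem_A1_of_integrable hτ hfL ha
    (((supportedOn_iff hτθ).1 has).mono fun ω h => h.1) ⟨?_, ?_⟩, ?_⟩
  · exact (f.measurable.mul (measurable_variation a)).aestronglyMeasurable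
  · have h1 : ∀ᵐ ω ∂P, ‖f ω * variation a ω‖ₑ
        ≤ liminf (fun n => ‖fn n ω * variation a ω‖ₑ) atTop := by
      filter_upwards [hfω, hfnω, hpos, hgd] with ω h1 h2 h3 h4
      have h5 : Tendsto (fun n => ‖fn n ω * variation a ω‖ₑ) atTop
          (𝓝 ‖f ω * variation a ω‖ₑ) := by
        refine tendsto_const_nhds.congr' ?_
        obtain ⟨N, hN⟩ := exists_nat_ge |(g ω)⁻¹|
        filter_upwards [eventually_ge_atTop N] with n hn
        rw [h1, h2, min_eq_left (hN.trans (Nat.cast_le.2 hn)),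
          abs_of_pos (inv_pos.2 (h4 ▸ h3))]
      exact h5.liminf_eq.ge
    calc ∫⁻ ω, ‖f ω * variation a ω‖ₑ ∂P
        ≤ ∫⁻ ω, liminf (fun n => ‖fn n ω * variation a ω‖ₑ) atTop ∂P := lintegral_mono_ae h1
      _ ≤ liminf (fun n => ∫⁻ ω, ‖fn n ω * variation a ω‖ₑ ∂P) atTop :=
          lintegral_liminf_le fun n => ((fn n).measurable.mul (measurable_variation a)).enorm
      _ ≤ liminf (fun _ : ℕ => (1 : ℝ≥0∞)) atTop :=
          liminf_le_liminf (Eventually.of_forall hn)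
      _ < ∞ := by simp
  · filter_upwards [hfω, hpos, hgd] with ω h1 h2 h3
    rw [h1, ← h3]
    exact inv_mul_cancel₀ h2.ne'

end DualCone

/-! ### The dual representation -/

section Representation

variable {Ω : Type*} {mΩ : MeasurableSpace Ω} {P : Measure Ω}
  {ℱ : Filtration ℕ mΩ} {τ θ : Ω → WithTop ℕ} {hτ : IsStoppingTime ℱ τ} {hθ : IsStoppingTime ℱ θ}
  {φ : Process0 P → Ω →ₘ[P] ℝ} {X a b : Process0 P}

/-- Subtracting f on [τ, ∞) lowers the utility and all normalised conditional pairings by f;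
comparisons with f thus become questions of sign. -/
lemma shift_mem (hτθ : ∀ᵐ ω ∂P, τ ω ≤ θ ω) (hφ : IsCoherent hτ hθ φ) (hX : X ∈ RInfST P hτ hθ)
    {f : Ω →ₘ[P] ℝ} (hf : f ∈ LInfTau P hτ) :
    X + scale (0 - f) (indFrom P hτ) ∈ RInfST P hτ hθ ∧
      (∀ᵐ ω ∂P, φ (X + scale (0 - f) (indFrom P hτ)) ω = φ X ω - f ω) ∧
      ∀ q ∈ DST P hτ hθ, ∀ᵐ ω ∂P, condPairing hτ θ (X + scale (0 - f) (indFrom P hτ)) q ω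
        = condPairing hτ θ X q ω - f ω := by
  have hf' : 0 - f ∈ LInfTau P hτ := sub_mem_LInfTau (constRV_mem_LInfTau 0) hf
  have hfI := scale_mem_RInfST (hθ := hθ) hτθ hf' (indFrom_mem_RInfST hτθ)
  have hsub : ∀ g : Ω →ₘ[P] ℝ, ∀ᵐ ω ∂P, (g + (0 - f)) ω = g ω - f ω := fun g => by
    filter_upwards [AEEqFun.coeFn_add g (0 - f), AEEqFun.coeFn_sub 0 f,
      AEEqFun.coeFn_zero (β := ℝ) (μ := P)] with ω h1 h2 h3
    rw [h1, Pi.add_apply, h2, Pi.sub_apply, h3, Pi.zero_apply]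
    ring
  refine ⟨add_mem_RInfST hτθ hX hfI, ?_, fun q hq => ?_⟩
  · rw [hφ.cash _ hX _ hf']
    exact hsub _
  · obtain ⟨hqA, -, hqs, -⟩ := (mem_DST_iff hτθ).1 hq
    rw [condPairing_add_left hqA hqs ((mem_RInfST_iff hτ hθ hτθ).1 hX).1
      ((mem_RInfST_iff hτ hθ hτθ).1 hfI).1, condPairing_scale_indFrom hτθ hq hf']
    exact hsub _

/-- X - φ(X) 1_{[τ,∞)} has utility zero, so it is acceptable and pairs non-negatively with a. -/
lemma le_condPairing (hτθ : ∀ᵐ ω ∂P, τ ω ≤ θ ω) (hφ : IsCoherent hτ hθ φ)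
    (hX : X ∈ RInfST P hτ hθ) (ha : a ∈ dualCone hτ hθ φ ∩ DST P hτ hθ) :
    φ X ≤ condPairing hτ θ X a := by
  obtain ⟨h1, h2, h3⟩ := shift_mem hτθ hφ hX (hφ.mapsTo _ hX)
  have h4 := ha.1.2.2.2 _ ⟨h1, coeFn_nonneg_iff.2 (h2.mono fun ω h => by rw [h, sub_self])⟩
  rw [← AEEqFun.coeFn_le]
  filter_upwards [coeFn_nonneg_iff.1 h4, h3 a ha.2] with ω h5 h6
  linarith

variable [IsProbabilityMeasure P]

/-- Up to positive weights, a series of elements of the dual cone belongs to the dual cone, and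
its conditional mass vanishes only where those of all its terms do. -/
lemma exists_dualCone_of_seq (hτθ : ∀ᵐ ω ∂P, τ ω ≤ θ ω) (hφ : IsCoherent hτ hθ φ)
    {u : ℕ → Process0 P} (hu : ∀ n, u n ∈ dualCone hτ hθ φ) : ∃ a ∈ dualCone hτ hθ φ, ∀ n,
      ∀ᵐ ω ∂P, condPairing hτ θ (indFrom P hτ) a ω = 0 →
        condPairing hτ θ (indFrom P hτ) (u n) ω = 0 := by
  -- Positive weights under which the variations of the terms have a finite total.
  obtain ⟨δ, hδ, hδu⟩ := ENNReal.exists_pos_tsum_mul_lt_of_countable (ε := 1) one_ne_zero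
    (fun n => ∫⁻ ω, ∑' t, ‖incr (u n) t ω‖ₑ ∂P) fun n => (hu n).1.2.ne
  have hnull : ∀ n, ∀ᵐ ω ∂P, ∀ t : ℕ, (t : WithTop ℕ) < τ ω → u n t ω = 0 := fun n =>
    ((supportedOn_iff hτθ).1 (hu n).2.2.1).mono fun ω h => h.1
  have hb : ∀ n, scale (constRV P (δ n)) (u n) ∈ A1 P ℱ := fun n =>
    scale_mem_A1 hτ (constRV_mem_LInfTau _) (hu n).1 (hnull n)
  have hbC : ∀ n, scale (constRV P (δ n)) (u n) ∈ dualCone hτ hθ φ := fun n =>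
    scale_mem_dualCone hτθ (hu n) (constRV_mem_LInfTau (hτ := hτ) _).1
      (nonneg_constRV (δ n).2) (hb n)
  have hinc : ∀ᵐ ω ∂P, ∀ n t, incr (scale (constRV P (δ n)) (u n)) t ω
      = δ n * incr (u n) t ω := by
    simp_rw [incr_scale]
    filter_upwards [ae_all_iff.2 fun n => coeFn_scale (constRV P (δ n)) (incr (u n)),
      ae_all_iff.2 fun n => coeFn_constRV (P := P) (δ n)] with ω h1 h2 n t
    rw [h1, h2]
  have hsum : ∑' n, ∫⁻ ω, ∑' t, ‖incr (scale (constRV P (δ n)) (u n)) t ω‖ₑ ∂P < ∞ := by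
    refine lt_of_le_of_lt (ENNReal.tsum_le_tsum fun n => ?_) (hδu.trans ENNReal.one_lt_top)
    rw [mul_comm, ← lintegral_const_mul _
      (Measurable.tsum fun t => (incr (u n) t).measurable.enorm)]
    refine lintegral_mono_ae (hinc.mono fun ω h => ?_)
    rw [← ENNReal.tsum_mul_left]
    refine (ENNReal.tsum_le_tsum fun t => ?_)
    rw [h, enorm_mul, Real.enorm_of_nonneg (NNReal.coe_nonneg _), ENNReal.ofReal_coe_nnreal]
  obtain ⟨a, ha, hain, hpair⟩ := exists_hasSum_A1 (fun n => (hb n).1) hsum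
  have ha0 : ∀ t, 0 ≤ incr a t := incr_nonneg_iff.2 <| by
    filter_upwards [hain, ae_all_iff.2 fun n => incr_nonneg_iff.1 (hbC n).2.1] with ω h1 h2 t
    exact (h1 t).nonneg fun n => h2 n t
  have has : SupportedOn τ θ a := by
    filter_upwards [hain, ae_all_iff.2 fun n => (hbC n).2.2.1] with ω h1 h2 t ht
    refine (h1 t).unique ?_
    simp only [h2 _ t ht]
    exact hasSum_zero
  have haC : a ∈ dualCone hτ hθ φ := mem_dualCone_of_pairing hτθ hφ ha ha0 has fun X hX =>
    (hpair X (RInf_of_acceptanceSet hτθ hX)).nonneg fun n =>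
      pairing_nonneg_of_mem_dualCone hτθ (hbC n) hX
  refine ⟨a, haC, fun n => ?_⟩
  obtain ⟨g, hg, hga⟩ := aestronglyMeasurable_condPairing (θ := θ) hτ (indFrom P hτ) a
  have hB : MeasurableSet[hτ.measurableSpace] {ω | g ω = 0} :=
    hg.measurable (measurableSet_singleton 0)
  have hI := indFrom_mem_acceptanceSet hτθ hφ
  have hIB := scale_ind_mem_acceptanceSet hτθ hφ hI hB
  have hset : ∀ {c : Process0 P}, c ∈ dualCone hτ hθ φ →
      pairing (scale (ind hτ hB) (indFrom P hτ)) c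
        = ∫ ω in {ω | g ω = 0}, condPairing hτ θ (indFrom P hτ) c ω ∂P := fun hc => by
    rw [setIntegral_condPairing hc.1 hc.2.2.1 (RInf_of_acceptanceSet hτθ hI) hB,
      setIntegral_totalSum_eq_pairing_left hB]
  -- On the event where the limit has no mass, the non-negative masses of the weighted terms sum to
  -- zero, so each vanishes there.
  have h0 : pairing (scale (ind hτ hB) (indFrom P hτ)) a = 0 := by
    rw [hset haC]
    refine setIntegral_eq_zero_of_ae_eq_zero ?_
    filter_upwards [hga] with ω h1 h2
    rw [h1]
    exact h2
  have h1 : HasSum (fun n => pairing (scale (ind hτ hB) (indFrom P hτ))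
      (scale (constRV P (δ n)) (u n))) 0 := by
    have h2 := hpair _ (RInf_of_acceptanceSet hτθ hIB)
    rwa [h0] at h2
  have h2 := congrFun ((hasSum_zero_iff_of_nonneg fun n =>
    pairing_nonneg_of_mem_dualCone hτθ (hbC n) hIB).1 h1) n
  simp only [Pi.zero_apply] at h2
  rw [hset (hbC n), setIntegral_eq_zero_iff_of_nonneg_ae
    (ae_restrict_of_ae (coeFn_nonneg_iff.1 ((hbC n).2.2.2 _ hI)))
    (integrable_condPairing hτ _ _).integrableOn,
    condPairing_scale_right (hu n).1 (hu n).2.2.1 (RInf_of_acceptanceSet hτθ hI)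
      (constRV_mem_LInfTau (hτ := hτ) _).1 (hb n)] at h2
  have h3 := (ae_restrict_iff' (hτ.measurableSpace_le _ hB)).1 h2
  filter_upwards [h3, hga, coeFn_constRV (P := P) (δ n),
    AEEqFun.coeFn_mul (constRV P (δ n)) (condPairing hτ θ (indFrom P hτ) (u n))]
    with ω h4 h5 h6 h7 h8
  have h9 := h4 (h5 ▸ h8 : g ω = 0)
  rw [h7, Pi.mul_apply, h6] at h9
  exact (mul_eq_zero.1 h9).resolve_left (NNReal.coe_pos.2 (hδ n)).ne'

/-- Some element of the dual cone has positive conditional mass. -/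
theorem exists_dualCone_pos (hτθ : ∀ᵐ ω ∂P, τ ω ≤ θ ω) (hφ : IsCoherent hτ hθ φ)
    (hcont : ContinuousForBoundedDecreasing hτ hθ φ) : ∃ a ∈ dualCone hτ hθ φ,
      ∀ᵐ ω ∂P, 0 < condPairing hτ θ (indFrom P hτ) a ω := by
  -- Exhaustion: minimise the probability that the conditional mass is zero. Combining a minimising
  -- sequence into one series attains the minimum.
  let N : Process0 P → Set Ω := fun a => {ω | condPairing hτ θ (indFrom P hτ) a ω = 0}
  have hNm : ∀ a, MeasurableSet (N a) := fun a =>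
    (condPairing hτ θ (indFrom P hτ) a).measurable (measurableSet_singleton 0)
  have hI := indFrom_mem_acceptanceSet hτθ hφ
  have h0 : (0 : Process0 P) ∈ dualCone hτ hθ φ := by
    have hinc : ∀ᵐ ω ∂P, ∀ t, incr (0 : Process0 P) t ω = 0 := by
      filter_upwards [coeFn_incr (0 : Process0 P)] with ω h1 t
      rw [h1]
      cases t <;> simp [seqIncr]
    refine mem_dualCone_of_pairing hτθ hφ ⟨fun t => ?_, ?_⟩ (incr_nonneg_iff.2
      (hinc.mono fun ω h t => (h t).ge)) (hinc.mono fun ω h t _ => h t) fun X _ => ?_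
    · exact ⟨0, stronglyMeasurable_zero, AEEqFun.coeFn_zero⟩
    · refine (lintegral_congr_ae (hinc.mono fun ω h => ?_)).trans_lt
        (lintegral_zero.trans_lt ENNReal.zero_lt_top)
      simp [h]
    · refine (integral_eq_zero_of_ae (hinc.mono fun ω h => ?_)).ge
      simp [h]
  obtain ⟨v, -, hv, hvN⟩ := exists_seq_tendsto_sInf
    (S := (fun a => P (N a)) '' dualCone hτ hθ φ) (Set.Nonempty.image _ ⟨0, h0⟩)
    (OrderBot.bddBelow _)
  choose u hu huN using hvN
  obtain ⟨a, ha, hau⟩ := exists_dualCone_of_seq hτθ hφ hu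
  have hmin : ∀ b ∈ dualCone hτ hθ φ, P (N a) ≤ P (N b) := fun b hb => by
    refine le_trans (ge_of_tendsto' hv fun n => ?_) (sInf_le (Set.mem_image_of_mem _ hb))
    rw [← huN n]
    exact measure_mono_ae (hau n)
  have hmass : ∀ {b}, b ∈ dualCone hτ hθ φ →
      ∀ᵐ ω ∂P, 0 ≤ condPairing hτ θ (indFrom P hτ) b ω := fun hb =>
    coeFn_nonneg_iff.1 (hb.2.2.2 _ hI)
  refine ⟨a, ha, ?_⟩
  suffices hz : P (N a) = 0 by
    filter_upwards [hmass ha, measure_eq_zero_iff_ae_notMem.1 hz] with ω h1 h2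
    exact lt_of_le_of_ne h1 fun h3 => h2 h3.symm
  by_contra hz
  obtain ⟨g, hg, hga⟩ := aestronglyMeasurable_condPairing (θ := θ) hτ (indFrom P hτ) a
  have hB : MeasurableSet[hτ.measurableSpace] {ω | g ω = 0} :=
    hg.measurable (measurableSet_singleton 0)
  have hBN : ({ω | g ω = 0} : Set Ω) =ᵐ[P] N a := by
    filter_upwards [hga] with ω h1
    exact propext (by change g ω = 0 ↔ condPairing hτ θ (indFrom P hτ) a ω = 0; rw [h1])
  -- If the massless event had positive probability, the process -1 on it after τ would not be
  -- acceptable, and some b in the dual cone would pair negatively with it. But minimality for a + b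
  -- forces b to have no mass on that event, so this pairing is zero.
  set l := constRV P (-1) * ind hτ hB
  have hl : l ∈ LInfTau P hτ := mul_mem_LInfTau (constRV_mem_LInfTau _) (ind_mem_LInfTau hτ hB)
  have hlω : ∀ᵐ ω ∂P, l ω = -({ω | g ω = 0}.indicator (1 : Ω → ℝ) ω) := by
    filter_upwards [AEEqFun.coeFn_mul (constRV P (-1)) (ind hτ hB), coeFn_constRV (P := P) (-1),
      coeFn_ind (P := P) hτ hB] with ω h1 h2 h3
    rw [h1, Pi.mul_apply, h2, h3, neg_one_mul]
  have hXl := scale_mem_RInfST (hθ := hθ) hτθ hl (indFrom_mem_RInfST hτθ)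
  have hneg : ¬ 0 ≤ φ (scale l (indFrom P hτ)) := by
    rw [hφ.map_scale_indFrom hτθ hl, coeFn_nonneg_iff]
    intro h
    refine hz ?_
    rw [← measure_congr hBN, measure_eq_zero_iff_ae_notMem]
    filter_upwards [h, hlω] with ω h1 h2 h3
    rw [h2, Set.indicator_of_mem (s := {ω | g ω = 0}) h3, Pi.one_apply] at h1
    norm_num at h1
  obtain ⟨b, hbA, hb0, hbs, hbneg, hbC⟩ := exists_separating_process hτθ hφ hcont hXl hneg
  have hb := mem_dualCone_of_pairing hτθ hφ hbA hb0 hbs hbC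
  have hab := add_mem_dualCone hτθ ha hb
  have hsubset : ∀ᵐ ω ∂P, ω ∈ N (a + b) → ω ∈ N a ∧
      condPairing hτ θ (indFrom P hτ) b ω = 0 := by
    have h1 := condPairing_add_right (hτ := hτ) ha.1 ha.2.2.1 hb.1 hb.2.2.1 (RInf_of_acceptanceSet hτθ hI)
    filter_upwards [hmass ha, hmass hb, AEEqFun.coeFn_add (condPairing hτ θ (indFrom P hτ) a)
      (condPairing hτ θ (indFrom P hτ) b)] with ω h2 h3 h4 h5
    change condPairing hτ θ (indFrom P hτ) (a + b) ω = 0 at h5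
    rw [h1, h4, Pi.add_apply] at h5
    exact ⟨show condPairing hτ θ (indFrom P hτ) a ω = 0 by linarith, by linarith⟩
  have heq : N (a + b) =ᵐ[P] N a := ae_eq_of_ae_subset_of_measure_ge
    (hsubset.mono fun ω h h' => (h h').1) (hmin _ hab) (hNm _).nullMeasurableSet
    (measure_ne_top P _)
  refine hbneg.not_ge ?_
  rw [← integral_condPairing (hτ := hτ) hb.1 hb.2.2.1 ((mem_RInfST_iff hτ hθ hτθ).1 hXl).1,
    condPairing_scale_left hb.1 hb.2.2.1 (RInf_of_acceptanceSet hτθ hI) hl]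
  refine (integral_eq_zero_of_ae ?_).ge
  filter_upwards [AEEqFun.coeFn_mul l (condPairing hτ θ (indFrom P hτ) b), hlω, hsubset,
    heq.mem_iff, hBN.mem_iff] with ω h1 h2 h3 h4 h5
  rw [h1, Pi.mul_apply, h2]
  by_cases h6 : ω ∈ {ω | g ω = 0}
  · rw [(h3 (h4.2 (h5.1 h6))).2, mul_zero, Pi.zero_apply]
  · rw [Set.indicator_of_notMem h6, neg_zero, zero_mul, Pi.zero_apply]

/-- The normalised elements of the dual cone. -/
lemma exists_DST_of_dualCone (hτθ : ∀ᵐ ω ∂P, τ ω ≤ θ ω)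
    (ha : a ∈ dualCone hτ hθ φ) (hpos : ∀ᵐ ω ∂P, 0 < condPairing hτ θ (indFrom P hτ) a ω) :
    ∃ q ∈ dualCone hτ hθ φ, q ∈ DST P hτ hθ ∧ ∀ X ∈ RInf P ℱ,
      0 ≤ condPairing hτ θ X q → 0 ≤ condPairing hτ θ X a := by
  obtain ⟨f, hf, hf0, hfa, hfd⟩ := exists_normalization hθ hτθ ha.1 ha.2.1 ha.2.2.1 hpos
  have hq := scale_mem_dualCone hτθ ha hf hf0 hfa
  have hI : indFrom P hτ ∈ RInf P ℱ := ((mem_RInfST_iff hτ hθ hτθ).1 (indFrom_mem_RInfST hτθ)).1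
  refine ⟨_, hq, (mem_DST_iff hτθ).2 ⟨hfa, hq.2.1, hq.2.2.1, ?_⟩, fun X hX h => ?_⟩
  · rw [← condPairing_indFrom hq.2.2.1, condPairing_scale_right ha.1 ha.2.2.1 hI hf hfa]
    refine AEEqFun.ext ?_
    filter_upwards [AEEqFun.coeFn_mul f (condPairing hτ θ (indFrom P hτ) a), hfd,
      AEEqFun.coeFn_one (β := ℝ) (μ := P)] with ω h1 h2 h3
    rw [h1, h3, Pi.mul_apply, h2, Pi.one_apply]
  · rw [condPairing_scale_right ha.1 ha.2.2.1 hX hf hfa, coeFn_nonneg_iff] at h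
    rw [coeFn_nonneg_iff]
    filter_upwards [h, AEEqFun.coeFn_mul f (condPairing hτ θ X a), hfd, hpos] with ω h1 h2 h3 h4
    rw [h2, Pi.mul_apply] at h1
    have h5 : 0 < f ω := by
      by_contra! h5
      nlinarith
    exact nonneg_of_mul_nonneg_right h1 h5

/-- The dual representation of a coherent utility functional that is continuous for bounded
decreasing sequences. -/
theorem exists_represents (hτθ : ∀ᵐ ω ∂P, τ ω ≤ θ ω) (hφ : IsCoherent hτ hθ φ)
    (hcont : ContinuousForBoundedDecreasing hτ hθ φ) :
    ∃ Q : Set (Process0 P), Q.Nonempty ∧ Q ⊆ DST P hτ hθ ∧ Represents hτ hθ Q φ := by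
  obtain ⟨a₀, ha₀, hpos₀⟩ := exists_dualCone_pos hτθ hφ hcont
  obtain ⟨q₀, hq₀, hq₀D, -⟩ := exists_DST_of_dualCone hτθ ha₀ hpos₀
  set Q := dualCone hτ hθ φ ∩ DST P hτ hθ
  have hQ : Q.Nonempty := ⟨q₀, hq₀, hq₀D⟩
  refine ⟨Q, hQ, Set.inter_subset_right, (represents_iff hQ).2 fun X hX => ?_⟩
  have hXR := ((mem_RInfST_iff hτ hθ hτθ).1 hX).1
  have hIR : indFrom P hτ ∈ RInf P ℱ := ((mem_RInfST_iff hτ hθ hτθ).1 (indFrom_mem_RInfST hτθ)).1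
  set S := (fun q => condPairing hτ θ X q) '' Q
  have hS : S.Nonempty := hQ.image _
  -- The extended essential infimum is real because it lies between φ X and the conditional pairing
  -- with q₀.
  obtain ⟨h, hh⟩ : ∃ h, IsGLB S h := by
    have hE := isGLB_essInfFam (toE '' S)
    have h1 : toE (φ X) ≤ essInfFam (toE '' S) := hE.2 <| by
      rintro _ ⟨_, ⟨q, hq, rfl⟩, rfl⟩
      exact toE_le_toE.2 (le_condPairing hτθ hφ hX hq)
    have h2 : essInfFam (toE '' S) ≤ toE (condPairing hτ θ X q₀) :=
      hE.1 ⟨_, ⟨q₀, ⟨hq₀, hq₀D⟩, rfl⟩, rfl⟩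
    have hm : Measurable fun ω => (essInfFam (toE '' S) ω).toReal :=
      (essInfFam (toE '' S)).measurable.ereal_toReal
    refine ⟨AEEqFun.mk _ hm.aestronglyMeasurable, (toE_eq_essInfFam_iff hS).1 ?_⟩
    refine AEEqFun.ext ?_
    filter_upwards [coeFn_toE (AEEqFun.mk _ hm.aestronglyMeasurable),
      AEEqFun.coeFn_mk _ hm.aestronglyMeasurable, AEEqFun.coeFn_le.2 h1, AEEqFun.coeFn_le.2 h2,
      coeFn_toE (φ X), coeFn_toE (condPairing hτ θ X q₀)] with ω h3 h4 h5 h6 h7 h8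
    rw [h3, h4]
    rw [h7] at h5
    rw [h8] at h6
    exact EReal.coe_toReal (ne_top_of_le_ne_top (EReal.coe_ne_top _) h6)
      (ne_bot_of_le_ne_bot (EReal.coe_ne_bot _) h5)
  obtain ⟨u, hu, huh⟩ := exists_seq_isGLB hS hh
  have hφh : φ X ≤ h := hh.2 <| by
    rintro _ ⟨q, hq, rfl⟩
    exact le_condPairing hτθ hφ hX hq
  have hhL : h ∈ LInfTau P hτ := by
    refine ⟨?_, ?_⟩
    · have hum : ∀ n, AEStronglyMeasurable[hτ.measurableSpace] (u n) P := fun n => by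
        obtain ⟨q, -, hq⟩ := hu n
        rw [← hq]
        exact aestronglyMeasurable_condPairing hτ X q
      choose g hg hgu using hum
      refine ⟨fun ω => ⨅ n, g n ω,
        (Measurable.iInf fun n => (hg n).measurable).stronglyMeasurable, ?_⟩
      filter_upwards [huh, ae_all_iff.2 hgu] with ω h1 h2
      simp only [← h2]
      exact (h1.ciInf_eq).symm
    · obtain ⟨m, hm⟩ := (hφ.mapsTo _ hX).2
      obtain ⟨m', hm'⟩ := hXR.2
      refine ⟨max m m', ?_⟩
      filter_upwards [hm, abs_condPairing_le hτθ hq₀D hX hm', AEEqFun.coeFn_le.2 hφh,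
        AEEqFun.coeFn_le.2 (hh.1 ⟨q₀, ⟨hq₀, hq₀D⟩, rfl⟩)] with ω h1 h2 h3 h4
      exact (abs_le_max_abs_abs h3 h4).trans (max_le_max h1 h2)
  suffices hle : h ≤ φ X by rwa [le_antisymm hφh hle]
  -- X is lowered by the candidate value h: every normalised pairing with the result is
  -- non-negative, so it suffices that it be acceptable.
  obtain ⟨hY, hYφ, hYq⟩ := shift_mem hτθ hφ hX hhL
  have hYR := ((mem_RInfST_iff hτ hθ hτθ).1 hY).1
  by_contra hcontra
  have hneg : ¬ 0 ≤ φ (X + scale (0 - h) (indFrom P hτ)) := fun h0 => hcontra <| by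
    rw [← AEEqFun.coeFn_le]
    filter_upwards [coeFn_nonneg_iff.1 h0, hYφ] with ω h1 h2
    linarith
  obtain ⟨b, hbA, hb0, hbs, hbneg, hbC⟩ := exists_separating_process hτθ hφ hcont hY hneg
  have hb := mem_dualCone_of_pairing hτθ hφ hbA hb0 hbs hbC
  set Y := X + scale (0 - h) (indFrom P hτ)
  set v := pairing Y b
  set w := pairing Y a₀
  -- The separating b may lack mass on some event, so a small multiple of a₀ is added. The chosen ε
  -- makes the extra term at most -v / 2, keeping the total pairing negative.
  obtain ⟨ε, hε, hεw⟩ : ∃ ε : ℝ, 0 < ε ∧ v + ε * w < 0 := by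
    refine ⟨-v / (2 * (|w| + 1)), by have := abs_nonneg w; exact div_pos (by linarith) (by linarith),
      ?_⟩
    have h1 : 0 < |w| + 1 := by positivity
    have h2 : -v / (2 * (|w| + 1)) * w ≤ -v / (2 * (|w| + 1)) * (|w| + 1) :=
      mul_le_mul_of_nonneg_left (by linarith [le_abs_self w])
        (div_nonneg (by linarith) (by linarith))
    have h3 : -v / (2 * (|w| + 1)) * (|w| + 1) = -v / 2 := by field_simp
    linarith
  have hεA : scale (constRV P ε) a₀ ∈ A1 P ℱ := scale_mem_A1 hτ (constRV_mem_LInfTau ε) ha₀.1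
    (((supportedOn_iff hτθ).1 ha₀.2.2.1).mono fun ω h => h.1)
  have hεC := scale_mem_dualCone hτθ ha₀ (constRV_mem_LInfTau (hτ := hτ) ε).1
    (nonneg_constRV hε.le) hεA
  have hadd := add_mem_dualCone hτθ hb hεC
  have hcond : ∀ Z ∈ RInf P ℱ, ∀ᵐ ω ∂P, condPairing hτ θ Z (b + scale (constRV P ε) a₀) ω
      = condPairing hτ θ Z b ω + ε * condPairing hτ θ Z a₀ ω := fun Z hZ => by
    rw [condPairing_add_right hbA hbs hεA hεC.2.2.1 hZ,
      condPairing_scale_right ha₀.1 ha₀.2.2.1 hZ (constRV_mem_LInfTau (hτ := hτ) ε).1 hεA]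
    filter_upwards [AEEqFun.coeFn_add (condPairing hτ θ Z b)
        (constRV P ε * condPairing hτ θ Z a₀),
      AEEqFun.coeFn_mul (constRV P ε) (condPairing hτ θ Z a₀), coeFn_constRV (P := P) ε]
      with ω h1 h2 h3
    rw [h1, Pi.add_apply, h2, Pi.mul_apply, h3]
  have hpos : ∀ᵐ ω ∂P, 0 < condPairing hτ θ (indFrom P hτ) (b + scale (constRV P ε) a₀) ω := by
    filter_upwards [hcond _ hIR, hpos₀,
      coeFn_nonneg_iff.1 (hb.2.2.2 _ (indFrom_mem_acceptanceSet hτθ hφ))] with ω h1 h2 h3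
    rw [h1]
    positivity
  obtain ⟨q, hq, hqD, hqa⟩ := exists_DST_of_dualCone hτθ hadd hpos
  have h1 : 0 ≤ condPairing hτ θ Y q := coeFn_nonneg_iff.2 <| by
    filter_upwards [hYq q hqD, AEEqFun.coeFn_le.2 (hh.1 ⟨q, ⟨hq, hqD⟩, rfl⟩)] with ω h1 h2
    rw [h1]
    linarith
  -- Undoing the normalisation preserves the sign, so b + ε a₀ would pair non-negatively with Y.
  have h2 := integral_nonneg_of_ae (coeFn_nonneg_iff.1 (hqa Y hYR h1))
  rw [integral_congr_ae (hcond Y hYR), integral_add (integrable_condPairing hτ _ _)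
    ((integrable_condPairing hτ _ _).const_mul ε), integral_const_mul,
    integral_condPairing hbA hbs hYR, integral_condPairing ha₀.1 ha₀.2.2.1 hYR] at h2
  exact hεw.not_ge h2

end Representation

/-! ### The set Q⁰_φ: description, convexity, closedness -/

section Polar

variable {Ω : Type*} {mΩ : MeasurableSpace Ω} {P : Measure Ω}
  {ℱ : Filtration ℕ mΩ} {τ θ : Ω → WithTop ℕ} {hτ : IsStoppingTime ℱ τ} {hθ : IsStoppingTime ℱ θ}
  {φ : Process0 P → Ω →ₘ[P] ℝ} {X a b : Process0 P} {Q : Set (Process0 P)}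

lemma nonneg_one_sub {l : Ω →ₘ[P] ℝ} (hl : l ≤ 1) : 0 ≤ 1 - l := coeFn_nonneg_iff.2 <| by
  filter_upwards [coeFn_one_sub l, AEEqFun.coeFn_le.2 hl, AEEqFun.coeFn_one (β := ℝ) (μ := P)]
    with ω h1 h2 h3
  rw [h3, Pi.one_apply] at h2
  rw [h1]
  linarith

lemma scale_mem_A1_of_DST (hτθ : ∀ᵐ ω ∂P, τ ω ≤ θ ω) {l : Ω →ₘ[P] ℝ} (hl : l ∈ LInfTau P hτ)
    (ha : a ∈ DST P hτ hθ) : scale l a ∈ A1 P ℱ := by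
  obtain ⟨haA, -, has, -⟩ := (mem_DST_iff hτθ).1 ha
  exact scale_mem_A1 hτ hl haA (((supportedOn_iff hτθ).1 has).mono fun ω h => h.1)

lemma one_mem_RInf : (1 : Process0 P) ∈ RInf P ℱ := by
  refine ⟨fun t => ⟨1, stronglyMeasurable_one, AEEqFun.coeFn_one⟩, 1, ?_⟩
  filter_upwards [coeFn_process_one (P := P)] with ω h t
  rw [h, abs_one]

lemma integrable_incr (ha : a ∈ A1 P ℱ) (t : ℕ) : Integrable (incr a t) P := by
  refine (integrable_variation ha).mono' (incr a t).aestronglyMeasurable ?_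
  filter_upwards [ae_summable_of_mem_A1 ha] with ω h
  exact h.le_tsum t fun _ _ => abs_nonneg _

/-- Makes the sign and support of the increments testable by weakly continuous functionals. -/
lemma exists_pairing_eq_setIntegral {t : ℕ} {B : Set Ω} (hB : MeasurableSet[ℱ t] B) :
    ∃ Y ∈ RInf P ℱ, ∀ a, pairing Y a = ∫ ω in B, incr a t ω ∂P := by
  have hm : StronglyMeasurable[ℱ t] (B.indicator (1 : Ω → ℝ)) := stronglyMeasurable_one.indicator hB
  set f : Ω →ₘ[P] ℝ := AEEqFun.mk _ (hm.mono (ℱ.le t)).aestronglyMeasurable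
  have hf : ∀ᵐ ω ∂P, f ω = B.indicator 1 ω :=
    AEEqFun.coeFn_mk _ (hm.mono (ℱ.le t)).aestronglyMeasurable
  refine ⟨Pi.single t f, single_mem_RInf (c := 1)
    (aestronglyMeasurable_mk hm.aestronglyMeasurable) ?_, fun a => ?_⟩
  · filter_upwards [hf] with ω h
    rw [h]
    by_cases hω : ω ∈ B <;> simp [hω]
  · rw [pairing_single_left, ← integral_indicator (ℱ.le t _ hB)]
    refine integral_congr_ae (hf.mono fun ω h => ?_)
    simp only [h]
    by_cases hω : ω ∈ B <;> simp [hω]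

lemma coeFn_condPairing_convexComb (hτθ : ∀ᵐ ω ∂P, τ ω ≤ θ ω) {l : Ω →ₘ[P] ℝ}
    (hl : l ∈ LInfTau P hτ) (ha : a ∈ DST P hτ hθ) (hb : b ∈ DST P hτ hθ) (hX : X ∈ RInf P ℱ) :
    ∀ᵐ ω ∂P, condPairing hτ θ X (scale l a + scale (1 - l) b) ω
      = l ω * condPairing hτ θ X a ω + (1 - l ω) * condPairing hτ θ X b ω := by
  have hl' : 1 - l ∈ LInfTau P hτ := sub_mem_LInfTau one_mem_LInfTau hl
  obtain ⟨haA, -, has, -⟩ := (mem_DST_iff hτθ).1 ha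
  obtain ⟨hbA, -, hbs, -⟩ := (mem_DST_iff hτθ).1 hb
  have hla := scale_mem_A1_of_DST hτθ hl ha
  have hlb := scale_mem_A1_of_DST hτθ hl' hb
  rw [condPairing_add_right hla (has.scale l) hlb (hbs.scale _) hX,
    condPairing_scale_right haA has hX hl.1 hla, condPairing_scale_right hbA hbs hX hl'.1 hlb]
  filter_upwards [AEEqFun.coeFn_add (l * condPairing hτ θ X a) ((1 - l) * condPairing hτ θ X b),
    AEEqFun.coeFn_mul l (condPairing hτ θ X a), AEEqFun.coeFn_mul (1 - l) (condPairing hτ θ X b),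
    coeFn_one_sub l] with ω h1 h2 h3 h4
  rw [h1, Pi.add_apply, h2, h3, Pi.mul_apply, Pi.mul_apply, h4]

variable [IsProbabilityMeasure P]

/-- The zero process is acceptable and pairs to 0, so the infimum over the acceptance set is 0 as
soon as all its members pair non-negatively. -/
theorem QZero_eq (hτθ : ∀ᵐ ω ∂P, τ ω ≤ θ ω) (hφ : IsCoherent hτ hθ φ) :
    QZero hτ hθ φ = dualCone hτ hθ φ ∩ DST P hτ hθ := by
  ext a
  change a ∈ DST P hτ hθ ∧ sharp hτ hθ φ a = toE 0 ↔ _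
  rw [Set.mem_inter_iff, and_comm, and_congr_left_iff]
  intro ha
  obtain ⟨haA, ha0, has, -⟩ := (mem_DST_iff hτθ).1 ha
  have h0L : (0 : Ω →ₘ[P] ℝ) ∈ LInfTau P hτ := constRV_mem_LInfTau 0
  have hX0 : scale 0 (indFrom P hτ) ∈ acceptanceSet hτ hθ φ :=
    ⟨scale_mem_RInfST hτθ h0L (indFrom_mem_RInfST hτθ), (hφ.map_scale_indFrom hτθ h0L).ge⟩
  have himg : sharp hτ hθ φ a
      = essInfFam (toE '' ((fun X => condPairing hτ θ X a) '' acceptanceSet hτ hθ φ)) := by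
    rw [Set.image_image]
    rfl
  rw [himg, eq_comm, toE_eq_essInfFam_iff (Set.Nonempty.image _ ⟨_, hX0⟩)]
  constructor
  · exact fun h => ⟨haA, ha0, has, fun X hX => h.1 (Set.mem_image_of_mem _ hX)⟩
  · rintro ⟨-, -, -, h⟩
    refine IsLeast.isGLB ⟨⟨_, hX0, condPairing_scale_indFrom hτθ ha h0L⟩, ?_⟩
    rintro _ ⟨X, hX, rfl⟩
    exact h X hX

lemma subset_QZero (hτθ : ∀ᵐ ω ∂P, τ ω ≤ θ ω) (hQ : Q.Nonempty) (hQD : Q ⊆ DST P hτ hθ)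
    (h : Represents hτ hθ Q φ) : Q ⊆ QZero hτ hθ φ := by
  rw [QZero_eq hτθ (h.isCoherent hτθ hQ hQD)]
  intro q hq
  obtain ⟨hqA, hq0, hqs, -⟩ := (mem_DST_iff hτθ).1 (hQD hq)
  exact ⟨⟨hqA, hq0, hqs, fun X hX => hX.2.trans
    (((represents_iff hQ).1 h X hX.1).1 ⟨q, hq, rfl⟩)⟩, hQD hq⟩

/-- Enlarging Q can only lower the infimum, and every element of Q⁰_φ still dominates φ. -/
theorem represents_QZero (hτθ : ∀ᵐ ω ∂P, τ ω ≤ θ ω) (hQ : Q.Nonempty) (hQD : Q ⊆ DST P hτ hθ)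
    (h : Represents hτ hθ Q φ) : Represents hτ hθ (QZero hτ hθ φ) φ := by
  have hsub := subset_QZero hτθ hQ hQD h
  have hφ := h.isCoherent hτθ hQ hQD
  refine (represents_iff (hQ.mono hsub)).2 fun X hX => ⟨?_, fun f hf => ?_⟩
  · rintro _ ⟨a, ha, rfl⟩
    rw [QZero_eq hτθ hφ] at ha
    exact le_condPairing hτθ hφ hX ha
  · exact ((represents_iff hQ).1 h X hX).2 fun f' hf' => hf (Set.image_mono hsub hf')

theorem tauConvex_QZero (hτθ : ∀ᵐ ω ∂P, τ ω ≤ θ ω) (hφ : IsCoherent hτ hθ φ) :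
    TauConvex hτ (QZero hτ hθ φ) := by
  rw [QZero_eq hτθ hφ]
  rintro a ⟨ha, haD⟩ b ⟨hb, hbD⟩ l hl hl0 hl1
  have hl' : 1 - l ∈ LInfTau P hτ := sub_mem_LInfTau one_mem_LInfTau hl
  have h := add_mem_dualCone hτθ
    (scale_mem_dualCone hτθ ha hl.1 hl0 (scale_mem_A1_of_DST hτθ hl haD))
    (scale_mem_dualCone hτθ hb hl'.1 (nonneg_one_sub hl1) (scale_mem_A1_of_DST hτθ hl' hbD))
  refine ⟨h, (mem_DST_iff hτθ).2 ⟨h.1, h.2.1, h.2.2.1, AEEqFun.ext ?_⟩⟩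
  filter_upwards [coeFn_condPairing_convexComb hτθ hl haD hbD (one_mem_RInf (ℱ := ℱ)),
    AEEqFun.coeFn_one (β := ℝ) (μ := P)] with ω h1 h2
  rw [h1, ((mem_DST_iff hτθ).1 haD).2.2.2, ((mem_DST_iff hτθ).1 hbD).2.2.2, h2, Pi.one_apply]
  ring

/-- Non-negative increments, support on [τ, θ], conditional mass one and membership in the dual cone
are each expressed by scalar pairings with bounded processes. The mass condition becomes that the
pairing with 1_B 1_{[τ,∞)} equals P(B) for all B in F_τ. -/
theorem isClosed_QZero (hτθ : ∀ᵐ ω ∂P, τ ω ≤ θ ω) (hφ : IsCoherent hτ hθ φ) :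
    IsClosed[sigmaAR P ℱ] {a : A1 P ℱ | a.1 ∈ QZero hτ hθ φ} := by
  have hI : indFrom P hτ ∈ RInf P ℱ := ((mem_RInfST_iff hτ hθ hτθ).1 (indFrom_mem_RInfST hτθ)).1
  choose Y hY hYa using fun (t : ℕ) (B : {B : Set Ω // MeasurableSet[ℱ t] B}) =>
    exists_pairing_eq_setIntegral (P := P) B.2
  let E : (t : ℕ) → {B : Set Ω // MeasurableSet[ℱ t] B} := fun t =>
    ⟨_, (measurableSet_interval hτ hθ t).compl⟩
  have hIB : ∀ B : {B : Set Ω // MeasurableSet[hτ.measurableSpace] B},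
      scale (ind hτ B.2) (indFrom P hτ) ∈ RInf P ℱ := fun B =>
    ((mem_RInfST_iff hτ hθ hτθ).1
      (scale_mem_RInfST hτθ (ind_mem_LInfTau hτ B.2) (indFrom_mem_RInfST hτθ))).1
  have hset : {a : A1 P ℱ | a.1 ∈ QZero hτ hθ φ} =
      ((⋂ t : ℕ, ⋂ B : {B : Set Ω // MeasurableSet[ℱ t] B},
        (fun a : A1 P ℱ => pairing (Y t B) a.1) ⁻¹' Set.Ici 0) ∩
      (⋂ t : ℕ, (fun a : A1 P ℱ => pairing (Y t (E t)) a.1) ⁻¹' {0})) ∩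
      ((⋂ B : {B : Set Ω // MeasurableSet[hτ.measurableSpace] B},
        (fun a : A1 P ℱ => pairing (scale (ind hτ B.2) (indFrom P hτ)) a.1) ⁻¹' {P.real B.1}) ∩
      ⋂ X : acceptanceSet hτ hθ φ, (fun a : A1 P ℱ => pairing X.1 a.1) ⁻¹' Set.Ici 0) := by
    rw [QZero_eq hτθ hφ]
    ext ⟨a, haA⟩
    simp only [Set.mem_inter_iff, Set.mem_iInter, Set.mem_preimage, Set.mem_Ici,
      Set.mem_singleton_iff]
    change a ∈ dualCone hτ hθ φ ∧ a ∈ DST P hτ hθ ↔ _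
    constructor
    · rintro ⟨h1, h2⟩
      refine ⟨⟨fun t B => ?_, fun t => ?_⟩, fun B => ?_, fun X =>
        pairing_nonneg_of_mem_dualCone hτθ h1 X.2⟩
      · rw [hYa]
        exact integral_nonneg_of_ae (ae_restrict_of_ae (coeFn_nonneg_iff.1 (h1.2.1 t)))
      · rw [hYa]
        refine setIntegral_eq_zero_of_ae_eq_zero (h1.2.2.1.mono fun ω h hω => h t hω)
      · rw [← integral_condPairing (hτ := hτ) haA h1.2.2.1 (hIB B),
          condPairing_scale_indFrom hτθ h2 (ind_mem_LInfTau hτ B.2),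
          integral_congr_ae (coeFn_ind (P := P) hτ B.2),
          integral_indicator_one (hτ.measurableSpace_le _ B.2)]
    · rintro ⟨⟨h1, h2⟩, h3, h4⟩
      have ha0 : ∀ t, 0 ≤ incr a t := fun t => coeFn_nonneg_iff.2 <|
        ae_nonneg_of_setIntegral_nonneg (ℱ.le t) (incr_mem_R0 haA.1 t) (integrable_incr haA t)
          fun B hB => by rw [← hYa t ⟨B, hB⟩]; exact h1 t ⟨B, hB⟩
      have has : SupportedOn τ θ a := by
        refine ae_all_iff.2 fun t => ?_
        have h5 := h2 t
        rw [hYa, setIntegral_eq_zero_iff_of_nonneg_ae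
          (ae_restrict_of_ae (coeFn_nonneg_iff.1 (ha0 t))) (integrable_incr haA t).integrableOn]
          at h5
        exact (ae_restrict_iff' (ℱ.le t _ (E t).2)).1 h5
      have hC := mem_dualCone_of_pairing hτθ hφ haA ha0 has fun X hX => h4 ⟨X, hX⟩
      refine ⟨hC, (mem_DST_iff hτθ).2 ⟨haA, ha0, has, ?_⟩⟩
      rw [← condPairing_indFrom has]
      have hset : ∀ B, MeasurableSet[hτ.measurableSpace] B →
          ∫ ω in B, condPairing hτ θ (indFrom P hτ) a ω ∂P = P.real B := fun B hB => by
        rw [setIntegral_condPairing haA has hI hB, setIntegral_totalSum_eq_pairing_left hB]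
        exact h3 ⟨B, hB⟩
      have hm := aestronglyMeasurable_condPairing (θ := θ) hτ (indFrom P hτ) a
      have hi := integrable_condPairing (θ := θ) hτ (indFrom P hτ) a
      have h5 := ae_nonneg_of_setIntegral_nonneg hτ.measurableSpace_le
        (f := fun ω => condPairing hτ θ (indFrom P hτ) a ω - 1)
        (hm.sub aestronglyMeasurable_const) (hi.sub (integrable_const 1)) fun B hB => by
          rw [integral_sub hi.integrableOn (integrable_const _), hset B hB]
          simp
      have h6 := ae_nonneg_of_setIntegral_nonneg hτ.measurableSpace_le
        (f := fun ω => 1 - condPairing hτ θ (indFrom P hτ) a ω)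
        (aestronglyMeasurable_const.sub hm) ((integrable_const 1).sub hi) fun B hB => by
          rw [integral_sub (integrable_const _) hi.integrableOn, hset B hB]
          simp
      refine AEEqFun.ext ?_
      filter_upwards [h5, h6, AEEqFun.coeFn_one (β := ℝ) (μ := P)] with ω h7 h8 h9
      rw [h9, Pi.one_apply]
      linarith
  rw [hset]
  let := sigmaAR P ℱ
  refine IsClosed.inter (IsClosed.inter
    (isClosed_iInter fun t => isClosed_iInter fun B => ?_) (isClosed_iInter fun t => ?_))
    (IsClosed.inter (isClosed_iInter fun B => ?_) (isClosed_iInter fun X => ?_))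
  · exact isClosed_Ici.preimage (continuous_pairing_right (hY t B))
  · exact isClosed_singleton.preimage (continuous_pairing_right (hY t _))
  · exact isClosed_singleton.preimage (continuous_pairing_right (hIB B))
  · exact isClosed_Ici.preimage
      (continuous_pairing_right (RInf_of_acceptanceSet hτθ X.2))

end Polar

/-! ### Hahn–Banach for the weak topology on A¹ -/

section WeakSeparation

variable {Ω : Type*} {mΩ : MeasurableSpace Ω} {P : Measure Ω} {ℱ : Filtration ℕ mΩ}
  {X Y a b : Process0 P}

lemma pairing_add_left (ha : a ∈ A1 P ℱ) (hX : X ∈ RInf P ℱ) (hY : Y ∈ RInf P ℱ) :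
    pairing (X + Y) a = pairing X a + pairing Y a := by
  change ∫ ω, totalSum (X + Y) a ω ∂P = _
  rw [integral_congr_ae (totalSum_add_left ha hX hY)]
  exact integral_add (integrable_totalSum_of_mem ha hX) (integrable_totalSum_of_mem ha hY)

lemma pairing_add_right (ha : a ∈ A1 P ℱ) (hb : b ∈ A1 P ℱ) (hX : X ∈ RInf P ℱ) :
    pairing X (a + b) = pairing X a + pairing X b := by
  change ∫ ω, totalSum X (a + b) ω ∂P = _
  rw [integral_congr_ae (totalSum_add_right ha hb hX)]
  exact integral_add (integrable_totalSum_of_mem ha hX) (integrable_totalSum_of_mem hb hX)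

lemma pairing_scale_const_left (c : ℝ) (X a : Process0 P) :
    pairing (scale (constRV P c) X) a = c * pairing X a := by
  change ∫ ω, totalSum (scale (constRV P c) X) a ω ∂P = c * ∫ ω, totalSum X a ω ∂P
  rw [← integral_const_mul]
  refine integral_congr_ae ?_
  filter_upwards [totalSum_scale_left (constRV P c) X a, coeFn_constRV (P := P) c] with ω h1 h2
  rw [h1, h2]

lemma pairing_scale_const_right (c : ℝ) (X a : Process0 P) :
    pairing X (scale (constRV P c) a) = c * pairing X a := by
  change ∫ ω, totalSum X (scale (constRV P c) a) ω ∂P = c * ∫ ω, totalSum X a ω ∂P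
  rw [← integral_const_mul]
  refine integral_congr_ae ?_
  filter_upwards [totalSum_scale_right (constRV P c) X a, coeFn_constRV (P := P) c] with ω h1 h2
  rw [h1, h2]

lemma scale_const_mem_RInf (c : ℝ) (hX : X ∈ RInf P ℱ) : scale (constRV P c) X ∈ RInf P ℱ := by
  obtain ⟨hXR, m, hm⟩ := hX
  refine ⟨fun t => aestronglyMeasurable_mul
    ⟨fun _ => c, stronglyMeasurable_const, coeFn_constRV c⟩ (hXR t), |c| * m, ?_⟩
  filter_upwards [coeFn_scale (constRV P c) X, coeFn_constRV (P := P) c, hm] with ω h1 h2 h3 t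
  rw [h1, h2, abs_mul]
  exact mul_le_mul_of_nonneg_left (h3 t) (abs_nonneg c)

/-- A point outside a weakly closed convex set of processes of integrable variation is separated
from it by a bounded process. -/
theorem exists_separating_bounded_process {K : Set (Process0 P)} (hK : K ⊆ A1 P ℱ)
    (hconv : ∀ a ∈ K, ∀ b ∈ K, ∀ r : ℝ, 0 ≤ r → r ≤ 1 →
      scale (constRV P r) a + scale (constRV P (1 - r)) b ∈ K)
    (hsmul : ∀ a ∈ K, ∀ r : ℝ, scale (constRV P r) a ∈ A1 P ℱ)
    (hcl : IsClosed[sigmaAR P ℱ] {a : A1 P ℱ | a.1 ∈ K}) {a₀ : Process0 P} (ha₀ : a₀ ∈ A1 P ℱ)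
    (h : a₀ ∉ K) : ∃ X ∈ RInf P ℱ, ∃ u : ℝ, pairing X a₀ < u ∧ ∀ a ∈ K, u ≤ pairing X a := by
  let T : A1 P ℱ → RInf P ℱ → ℝ := fun a X => pairing X.1 a.1
  -- The weak topology is pulled back from the product space of all real functions on R^∞, which is
  -- locally convex.
  have hind : sigmaAR P ℱ = TopologicalSpace.induced T inferInstance :=
    (induced_to_pi T).symm
  rw [hind] at hcl
  obtain ⟨F, hF, hFK⟩ := isClosed_induced_iff.1 hcl
  have hmemF : ∀ a : A1 P ℱ, T a ∈ F ↔ a.1 ∈ K := fun a => Set.ext_iff.1 hFK a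
  set S : Set (RInf P ℱ → ℝ) := T '' {a | a.1 ∈ K}
  have hSconv : Convex ℝ S := by
    rintro _ ⟨a, ha, rfl⟩ _ ⟨b, hb, rfl⟩ r s hr hs hrs
    have h1 := hconv a.1 ha b.1 hb r hr (by linarith)
    refine ⟨⟨_, hK h1⟩, h1, funext fun X => ?_⟩
    change pairing X.1 (_ + _) = r * pairing X.1 a.1 + s * pairing X.1 b.1
    rw [pairing_add_right (hsmul _ ha _) (hsmul _ hb _) X.2, pairing_scale_const_right,
      pairing_scale_const_right]
    have : 1 - r = s := by linarith
    rw [this]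
  have hSF : closure S ⊆ F := closure_minimal
    (by rintro _ ⟨a, ha, rfl⟩; exact (hmemF a).2 ha) hF
  obtain ⟨f, u, hf₀, hfS⟩ := geometric_hahn_banach_point_closed hSconv.closure isClosed_closure
    (x := T ⟨a₀, ha₀⟩) fun hmem => h ((hmemF ⟨a₀, ha₀⟩).1 (hSF hmem))
  -- A continuous functional on a product of lines is a finite combination of coordinates; pulled
  -- back to A¹, it is the pairing with one bounded process.
  have hspan : (f : (RInf P ℱ → ℝ) →ₗ[ℝ] ℝ) ∈
      Submodule.span ℝ (Set.range fun X : RInf P ℱ =>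
        (LinearMap.proj X : (RInf P ℱ → ℝ) →ₗ[ℝ] ℝ)) :=
    (LinearMap.mem_span_iff_continuous _).2 f.continuous
  obtain ⟨X, hX, hXf⟩ : ∃ X ∈ RInf P ℱ, ∀ a : A1 P ℱ, f (T a) = pairing X a.1 := by
    refine Submodule.span_induction
      (p := fun (g : (RInf P ℱ → ℝ) →ₗ[ℝ] ℝ) _ =>
        ∃ X ∈ RInf P ℱ, ∀ a : A1 P ℱ, g (T a) = pairing X a.1) ?_ ?_ ?_ ?_ hspan
    · rintro _ ⟨X, rfl⟩
      exact ⟨X.1, X.2, fun a => rfl⟩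
    · refine ⟨0, ⟨fun t => ⟨0, stronglyMeasurable_zero, AEEqFun.coeFn_zero⟩, 0, ?_⟩, fun a => ?_⟩
      · filter_upwards [coeFn_process_zero (P := P)] with ω h t
        rw [h, abs_zero]
      · rw [LinearMap.zero_apply]
        refine (integral_eq_zero_of_ae ?_).symm
        filter_upwards [coeFn_process_zero (P := P)] with ω h
        exact (tsum_congr fun t => by rw [h t, zero_mul]).trans tsum_zero
    · rintro g g' - - ⟨X, hX, hXg⟩ ⟨X', hX', hXg'⟩
      refine ⟨X + X', add_mem_RInf hX hX', fun a => ?_⟩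
      rw [LinearMap.add_apply, hXg, hXg', pairing_add_left a.2 hX hX']
    · rintro c g - ⟨X, hX, hXg⟩
      refine ⟨scale (constRV P c) X, scale_const_mem_RInf c hX, fun a => ?_⟩
      rw [LinearMap.smul_apply, hXg, pairing_scale_const_left, smul_eq_mul]
  refine ⟨X, hX, u, ?_, fun a ha => ?_⟩
  · rw [← hXf ⟨a₀, ha₀⟩]
    exact hf₀
  · rw [← hXf ⟨a, hK ha⟩]
    exact (hfS _ (subset_closure ⟨⟨a, hK ha⟩, ha, rfl⟩)).le

end WeakSeparation

/-! ### Minimality of Q⁰_φ -/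

section Minimality

variable {Ω : Type*} {mΩ : MeasurableSpace Ω} {P : Measure Ω}
  {ℱ : Filtration ℕ mΩ} {τ θ : Ω → WithTop ℕ} {hτ : IsStoppingTime ℱ τ} {hθ : IsStoppingTime ℱ θ}
  {φ : Process0 P → Ω →ₘ[P] ℝ} {X a b : Process0 P} {Q K : Set (Process0 P)}

/-- Use a on the F_τ-event where its conditional pairing is the smaller one and b elsewhere;
F_τ-convexity keeps the mixture in K. -/
lemma exists_condPairing_le_both (hτθ : ∀ᵐ ω ∂P, τ ω ≤ θ ω) (hKD : K ⊆ DST P hτ hθ)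
    (hKc : TauConvex hτ K) (hX : X ∈ RInf P ℱ) (ha : a ∈ K) (hb : b ∈ K) :
    ∃ c ∈ K, ∀ᵐ ω ∂P, condPairing hτ θ X c ω ≤ condPairing hτ θ X a ω ∧
      condPairing hτ θ X c ω ≤ condPairing hτ θ X b ω := by
  obtain ⟨g, hg, hga⟩ := aestronglyMeasurable_condPairing (θ := θ) hτ X a
  obtain ⟨k, hk, hkb⟩ := aestronglyMeasurable_condPairing (θ := θ) hτ X b
  have hB : MeasurableSet[hτ.measurableSpace] {ω | g ω ≤ k ω} :=
    (hg.measurable.prodMk hk.measurable) measurableSet_le'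
  refine ⟨_, hKc a ha b hb _ (ind_mem_LInfTau hτ hB) (ind_nonneg hτ hB) (ind_le_one hτ hB), ?_⟩
  filter_upwards [coeFn_condPairing_convexComb hτθ (ind_mem_LInfTau hτ hB) (hKD ha) (hKD hb) hX,
    coeFn_ind (P := P) hτ hB, hga, hkb] with ω h1 h2 h3 h4
  rw [h1, h2, h3, h4]
  by_cases hω : g ω ≤ k ω
  · rw [Set.indicator_of_mem (s := {ω | g ω ≤ k ω}) hω, Pi.one_apply]
    constructor <;> linarith
  · rw [Set.indicator_of_notMem (s := {ω | g ω ≤ k ω}) hω]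
    constructor <;> linarith

variable [IsProbabilityMeasure P]

theorem QZero_subset (hτθ : ∀ᵐ ω ∂P, τ ω ≤ θ ω) (hQ : Q.Nonempty) (hQD : Q ⊆ DST P hτ hθ)
    (h : Represents hτ hθ Q φ) (hKD : K ⊆ DST P hτ hθ) (hQK : Q ⊆ K)
    (hcl : IsClosed[sigmaAR P ℱ] {a : A1 P ℱ | a.1 ∈ K}) (hKc : TauConvex hτ K) :
    QZero hτ hθ φ ⊆ K := by
  intro a₀ ha₀
  by_contra ha₀K
  have hφ := h.isCoherent hτθ hQ hQD
  have hQZ := subset_QZero hτθ hQ hQD h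
  have hZc := tauConvex_QZero hτθ hφ
  rw [QZero_eq hτθ hφ] at ha₀ hQZ hZc
  have hone : ∀ r : ℝ, constRV P (1 - r) = 1 - constRV P r := fun r => by
    refine AEEqFun.ext ?_
    filter_upwards [coeFn_constRV (P := P) (1 - r), coeFn_constRV (P := P) r,
      coeFn_one_sub (constRV P r)] with ω h1 h2 h3
    rw [h1, h3, h2]
  obtain ⟨X₁, hX₁, u, hu, hKu⟩ := exists_separating_bounded_process
    (fun a ha => ((mem_DST_iff hτθ).1 (hKD ha)).1)
    (fun a ha b hb r hr0 hr1 => by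
      rw [hone]
      refine hKc a ha b hb _ (constRV_mem_LInfTau r) (nonneg_constRV hr0) ?_
      rw [← AEEqFun.coeFn_le]
      filter_upwards [coeFn_constRV (P := P) r, AEEqFun.coeFn_one (β := ℝ) (μ := P)] with ω h1 h2
      rwa [h1, h2])
    (fun a ha r => scale_mem_A1_of_DST hτθ (constRV_mem_LInfTau (hτ := hτ) r) (hKD ha))
    hcl ha₀.1.1 ha₀K
  -- Projecting brings the separating process into the domain of φ without changing its pairings
  -- with processes supported on [τ, θ].
  set X := proj hτ hθ X₁
  have hX : X ∈ RInfST P hτ hθ := ⟨X₁, hX₁, rfl⟩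
  have hXR := ((mem_RInfST_iff hτ hθ hτθ).1 hX).1
  obtain ⟨a, haQ, hainf⟩ := h.exists_seq hQ hX
  -- Membership in K supplies the bound u from the separation; membership in the normalised dual
  -- cone keeps the conditional pairings above φ X, which K alone need not do.
  have hseq : ∀ n, ∃ b ∈ K ∩ (dualCone hτ hθ φ ∩ DST P hτ hθ), ∀ᵐ ω ∂P, ∀ k ≤ n,
      condPairing hτ θ X b ω ≤ condPairing hτ θ X (a k) ω := by
    intro n
    induction n with
    | zero =>
      refine ⟨a 0, ⟨hQK (haQ 0), hQZ (haQ 0)⟩, Eventually.of_forall fun ω k hk => ?_⟩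
      rw [Nat.le_zero.1 hk]
    | succ n ih =>
      obtain ⟨b, hb, hbn⟩ := ih
      obtain ⟨c, hc, hcb⟩ := exists_condPairing_le_both (K := K ∩ (dualCone hτ hθ φ ∩ DST P hτ hθ))
        hτθ (fun x hx => hx.2.2) (fun x hx y hy l hl h0 h1 =>
          ⟨hKc x hx.1 y hy.1 l hl h0 h1, hZc x hx.2 y hy.2 l hl h0 h1⟩) hXR hb
          ⟨hQK (haQ (n + 1)), hQZ (haQ (n + 1))⟩
      refine ⟨c, hc, ?_⟩
      filter_upwards [hbn, hcb] with ω h1 h2 k hk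
      rcases Nat.le_succ_iff.1 hk with hk' | rfl
      · exact h2.1.trans (h1 k hk')
      · exact h2.2
  choose b hbK hba using hseq
  have hφb : ∀ᵐ ω ∂P, ∀ n, φ X ω ≤ condPairing hτ θ X (b n) ω := ae_all_iff.2 fun n =>
    AEEqFun.coeFn_le.2 (le_condPairing hτθ hφ hX (hbK n).2)
  obtain ⟨m, hm⟩ := hXR.2
  -- The conditional pairings are squeezed between φ X and running minima that tend to it, and they
  -- are uniformly bounded, so expectations converge.
  have hlim : Tendsto (fun n => ∫ ω, condPairing hτ θ X (b n) ω ∂P) atTop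
      (𝓝 (∫ ω, φ X ω ∂P)) := by
    refine tendsto_integral_of_dominated_convergence (fun _ => m)
      (fun n => (condPairing hτ θ X (b n)).aestronglyMeasurable) (integrable_const m)
      (fun n => abs_condPairing_le hτθ (hbK n).2.2 hX hm) ?_
    filter_upwards [hainf, ae_all_iff.2 hba, hφb] with ω h1 h2 h3
    refine tendsto_order.2 ⟨fun x hx => Eventually.of_forall fun n => hx.trans_le (h3 n),
      fun x hx => ?_⟩
    obtain ⟨_, ⟨k, rfl⟩, hk⟩ := (isGLB_lt_iff h1).1 hx
    filter_upwards [eventually_ge_atTop k] with n hn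
    exact (h2 n k hn).trans_lt hk
  have hpair : ∀ c ∈ DST P hτ hθ, ∫ ω, condPairing hτ θ X c ω ∂P = pairing X₁ c := fun c hc => by
    obtain ⟨hcA, -, hcs, -⟩ := (mem_DST_iff hτθ).1 hc
    rw [integral_condPairing hcA hcs hXR, pairing_proj hcs]
  have hge : u ≤ ∫ ω, φ X ω ∂P := ge_of_tendsto' hlim fun n => by
    rw [hpair _ (hbK n).2.2]
    exact hKu _ (hbK n).1
  obtain ⟨c, hc⟩ := (hφ.mapsTo X hX).2
  have hle : ∫ ω, φ X ω ∂P ≤ ∫ ω, condPairing hτ θ X a₀ ω ∂P :=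
    integral_mono_ae (Integrable.of_bound (φ X).aestronglyMeasurable c hc)
      (integrable_condPairing hτ X a₀) (AEEqFun.coeFn_le.2 (le_condPairing hτθ hφ hX ha₀))
  rw [hpair _ ha₀.2] at hle
  linarith

end Minimality

end CondUtil

theorem mainTheorem8 {Ω : Type*} {mΩ : MeasurableSpace Ω} (P : Measure Ω) [IsProbabilityMeasure P]
    (ℱ : Filtration ℕ mΩ) (τ θ : Ω → WithTop ℕ)
    (hτ : IsStoppingTime ℱ τ) (hθ : IsStoppingTime ℱ θ)
    (hτ_fin : ∀ᵐ ω ∂P, τ ω < ⊤) (hτθ : ∀ᵐ ω ∂P, τ ω ≤ θ ω)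
    (φ : Process0 P → Ω →ₘ[P] ℝ) :
    List.TFAE [
      ∃ Q : Set (Process0 P), Q.Nonempty ∧ Q ⊆ DST P hτ hθ ∧ Represents hτ hθ Q φ,
      IsCoherent hτ hθ φ ∧
        IsClosed[sigmaRA P ℱ] {X : RInf P ℱ | X.1 ∈ acceptanceSet hτ hθ φ},
      IsCoherent hτ hθ φ ∧ ContinuousForBoundedDecreasing hτ hθ φ] ∧
    ∀ Q : Set (Process0 P), Q.Nonempty → Q ⊆ DST P hτ hθ → Represents hτ hθ Q φ →
      IsLeast {K : Set (Process0 P) | K ⊆ DST P hτ hθ ∧ Q ⊆ K ∧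
        IsClosed[sigmaAR P ℱ] {a : A1 P ℱ | a.1 ∈ K} ∧ TauConvex hτ K} (QZero hτ hθ φ) ∧
      Represents hτ hθ (QZero hτ hθ φ) φ := by
  refine ⟨?_, fun Q hQ hQD h => ⟨⟨⟨fun a ha => ha.1, subset_QZero hτθ hQ hQD h, ?_, ?_⟩, ?_⟩,
    represents_QZero hτθ hQ hQD h⟩⟩
  · tfae_have 1 → 2 := fun ⟨Q, hQ, hQD, h⟩ =>
      ⟨h.isCoherent hτθ hQ hQD, h.isClosed_acceptanceSet hτθ hQ hQD⟩
    tfae_have 2 → 3 := fun ⟨hφ, hcl⟩ =>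
      ⟨hφ, continuousForBoundedDecreasing_of_isClosed hτθ hφ.toIsMonetary hcl⟩
    tfae_have 3 → 1 := fun ⟨hφ, hcont⟩ => exists_represents hτθ hφ hcont
    tfae_finish
  · exact isClosed_QZero hτθ (h.isCoherent hτθ hQ hQD)
  · exact tauConvex_QZero hτθ (h.isCoherent hτθ hQ hQD)
  · rintro K ⟨hKD, hQK, hcl, hKc⟩
    exact QZero_subset hτθ hQ hQD h hKD hQK hcl hKc
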